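/- **Setting.** Let $l>0$, $I=(-\tfrac l2,\tfrac l2)$, $S_\varepsilon=I\times(-\tfrac\varepsilon2,\tfrac\varepsilon2)$ for $\varepsilon>0$, $S=S_1$, $\Gamma=\partial I\times(-\tfrac12,\tfrac12)$. Let $Q$ be a quadratic form on $\mathbb R^{2\times2}$ that depends only on the symmetric part of a matrix and is positive definite on $\mathbb R^{2\times 2}_{\rm sym}$. Let $\hat u_1\in W^{1,2}(I)$ and $\hat u_2,\hat v\in W^{2,2}(I)$. Functions on $I$ are also regarded as functions on $S_\varepsilon$ that do not depend on $x_2$, and boundary values are understood in the sense of traces. For $f_\varepsilon\in L^2(S_\varepsilon)$, $g_\varepsilon\in L^2(S_\varepsilon;\mathbb R^2)$, $u\in W^{1,2}(S_\varepsilon;\mathbb R^2)$, $v\in W^{2,2}(S_\varepsilon)$ and $e(u)=\tfrac12(\nabla u+\nabla u^T)$ put $$\phi_\varepsilon(u,v)=\frac1\varepsilon\int_{S_\varepsilon}\tfrac12Q\big(e(u)+\tfrac12\nabla v\otimes\nabla v\big)\,dx+\frac1\varepsilon\int_{S_\varepsilon}\tfrac1{24}Q(\nabla^2v)\,dx-\frac1\varepsilon\int_{S_\varepsilon}\big(f_\varepsilon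 v+g_\varepsilon\cdot u\big)\,dx .$$ For $M>0$ let $\mathscr S^{2D}_{\varepsilon,M}$ be the set of all $(u,v)\in W^{1,2}(S_\varepsilon;\mathbb R^2)\times W^{2,2}(S_\varepsilon)$ with $\phi_\varepsilon(u,v)\le M$ and, on $\partial I\times(-\tfrac\varepsilon2,\tfrac\varepsilon2)$, $$u(x)=\Big(\hat u_1(x_1)-\tfrac{x_2}{\varepsilon}\,\hat u_2'(x_1),\ \tfrac1\varepsilon\hat u_2(x_1)\Big),\qquad v(x)=\hat v(x_1),\qquad \partial_1v(x)=\hat v'(x_1).$$ The scaled displacements on $S$ are $$y_1(x)=u_1(x_1,\varepsilon x_2),\qquad y_2(x)=\varepsilon u_2(x_1,\varepsilon x_2),\qquad w(x)=v(x_1,\varepsilon x_2),$$ and the scaled operators are $$E^\varepsilon y=\begin{pmatrix}\partial_1y_1&\frac1{2\varepsilon}(\partial_1y_2+\partial_2y_1)\\ \frac1{2\varepsilon}(\partial_2y_1+\partial_1y_2)&\frac1{\varepsilon^2}\partial_2y_2\end{pmatrix},\quad \nabla_\varepsilon w=\big(\partial_1w,\tfrac1\varepsilon\partial_2w\big),\quad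 \nabla^2_\varepsilon w=\begin{pmatrix}\partial^2_{11}w&\frac1\varepsilon\partial^2_{12}w\\ \frac1\varepsilon\partial^2_{21}w&\frac1{\varepsilon^2}\partial^2_{22}w\end{pmatrix}.$$ Let $W^{2,2}_{\hat v}(I)$ be the set of $w\in W^{2,2}(I)$ with $w=\hat v$ and $w'=\hat v'$ on $\partial I$, let $W^{1,2}_0(I)$ be the set of $\theta\in W^{1,2}(I)$ with $\theta=0$ on $\partial I$, and let the space of Bernoulli–Navier displacements be $$BN_{(\hat u_1,\hat u_2)}(S;\mathbb R^2)=\big\{y\in W^{1,2}(S;\mathbb R^2):\ e(y)_{12}=e(y)_{22}=0,\ \ y_1=\hat u_1-x_2\hat u_2',\ \ y_2=\hat u_2\ \text{ on }\Gamma\big\}.$$ **Proposition (Compactness).** Let $\varepsilon\to0$ along a sequence of positive numbers, and let the forces satisfy $f_\varepsilon(x_1,\varepsilon x_2)\rightharpoonup f^{1D}$, $g_{\varepsilon,1}(x_1,\varepsilon x_2)\rightharpoonup g^{1D}_1$ and $\tfrac1\varepsilon g_{\varepsilon,2}(x_1,\varepsilon x_2)\rightharpoonup g_2^{1D}$ weakly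 in $L^2(S)$, for some $f^{1D}\in L^2(I)$ and $g^{1D}\in L^2(I;\mathbb R^2)$. Let $M>0$, let $(u_\varepsilon,v_\varepsilon)\in\mathscr S^{2D}_{\varepsilon,M}$ for all $\varepsilon$ in the sequence, and let $(y_\varepsilon,w_\varepsilon)$ be the corresponding scaled displacements. Then there are a subsequence (not relabeled), $w\in W^{2,2}_{\hat v}(I)$, $\theta\in W^{1,2}_0(I)$, $y\in BN_{(\hat u_1,\hat u_2)}(S;\mathbb R^2)$, $\gamma\in L^2(S)$ and $E\in L^2(S;\mathbb R^{2\times2}_{\rm sym})$ with $E_{11}=\partial_1y_1$ such that $$w_\varepsilon\rightharpoonup w\ \text{ in }W^{2,2}(S),\qquad \nabla_\varepsilon w_\varepsilon\rightharpoonup(w',\theta)\ \text{ in }W^{1,2}(S;\mathbb R^2),$$ $$\nabla^2_\varepsilon w_\varepsilon\rightharpoonup\begin{pmatrix}w''&\theta'\\ \theta'&\gamma\end{pmatrix}\ \text{ in }L^2(S;\mathbb R^{2\times2}_{\rm sym}),$$ $$y_\varepsilon\rightharpoonup y\ \text{ in }W^{1,2}(S;\mathbb R^2),\qquad E^\varepsilon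 y_\varepsilon\rightharpoonup E\ \text{ in }L^2(S;\mathbb R^{2\times2}_{\rm sym}).$$ -/

import Mathlib

open MeasureTheory Set Filter Topology
open scoped ContDiff

noncomputable section

namespace Ribbon

/-! ## Weak derivatives -/

/-- `g` is a weak derivative of `f` in direction `e` on the (open) set `Ω`. -/
def HasWeakDeriv {X : Type*} [NormedAddCommGroup X] [NormedSpace ℝ X] [MeasureSpace X]
    (Ω : Set X) (e : X) (f g : X → ℝ) : Prop :=
  LocallyIntegrableOn f Ω ∧ LocallyIntegrableOn g Ω ∧
    ∀ φ : X → ℝ, ContDiff ℝ ∞ φ → HasCompactSupport φ → tsupport φ ⊆ Ω →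
      ∫ x in Ω, f x * fderiv ℝ φ x e = - ∫ x in Ω, g x * φ x

open scoped Classical in
/-- The weak derivative of `f` in direction `e` on `Ω` (unique up to null sets; `0` if there is
none). -/
def weakDeriv {X : Type*} [NormedAddCommGroup X] [NormedSpace ℝ X] [MeasureSpace X]
    (Ω : Set X) (e : X) (f : X → ℝ) : X → ℝ :=
  if h : ∃ g, HasWeakDeriv Ω e f g then h.choose else 0

/-- `f ∈ L²(Ω)`. -/
def MemL2 {X : Type*} [MeasureSpace X] (Ω : Set X) (f : X → ℝ) : Prop :=
  MemLp f 2 (volume.restrict Ω)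

/-! ## Sobolev spaces on an interval -/

/-- The interval `I = (-l/2, l/2)`. -/
def interval (l : ℝ) : Set ℝ := Ioo (-l / 2) (l / 2)

/-- The weak derivative `f'` on `I`. -/
def D1 (l : ℝ) (f : ℝ → ℝ) : ℝ → ℝ := weakDeriv (interval l) (1 : ℝ) f

/-- `f ∈ W^{1,2}(I)`. -/
def MemW12I (l : ℝ) (f : ℝ → ℝ) : Prop :=
  MemL2 (interval l) f ∧ ∃ g, HasWeakDeriv (interval l) (1 : ℝ) f g ∧ MemL2 (interval l) g

/-- `f ∈ W^{2,2}(I)`. -/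
def MemW22I (l : ℝ) (f : ℝ → ℝ) : Prop :=
  MemW12I l f ∧ MemW12I l (D1 l f)

/-- `f` vanishes on `∂I` in the sense of traces: its continuous representative is zero at both
end points. -/
def ZeroTraceI (l : ℝ) (f : ℝ → ℝ) : Prop :=
  ∃ g : ℝ → ℝ, ContinuousOn g (Icc (-l / 2) (l / 2)) ∧
    g =ᵐ[volume.restrict (interval l)] f ∧ g (-l / 2) = 0 ∧ g (l / 2) = 0

/-- `f ∈ W^{1,2}_0(I)`. -/
def MemW12I0 (l : ℝ) (f : ℝ → ℝ) : Prop :=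
  MemW12I l f ∧ ZeroTraceI l f

/-- `f ∈ W^{2,2}_h(I)`: `f = h` and `f' = h'` on `∂I` in the sense of traces. -/
def MemW22IBdry (l : ℝ) (h f : ℝ → ℝ) : Prop :=
  MemW22I l f ∧ ZeroTraceI l (fun t => f t - h t) ∧ ZeroTraceI l (fun t => D1 l f t - D1 l h t)

/-! ## Sobolev spaces on the plate -/

/-- The rectangle `(-l/2, l/2) × (-ε/2, ε/2)`; `plate l ε` is `S_ε` and `plate l 1` is `S`. -/
def plate (l ε : ℝ) : Set (ℝ × ℝ) := Ioo (-l / 2) (l / 2) ×ˢ Ioo (-ε / 2) (ε / 2)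

/-- The coordinate directions of the plane; index `0` is `x₁`, index `1` is `x₂`. -/
def dir : Fin 2 → ℝ × ℝ := ![(1, 0), (0, 1)]

/-- The weak partial derivative `∂ᵢ f` on `Ω`. -/
def pd (Ω : Set (ℝ × ℝ)) (i : Fin 2) (f : ℝ × ℝ → ℝ) : ℝ × ℝ → ℝ := weakDeriv Ω (dir i) f

/-- `f ∈ W^{1,2}(Ω)`. -/
def MemW12 (Ω : Set (ℝ × ℝ)) (f : ℝ × ℝ → ℝ) : Prop :=
  MemL2 Ω f ∧ ∀ i, ∃ g, HasWeakDeriv Ω (dir i) f g ∧ MemL2 Ω g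

/-- `f ∈ W^{2,2}(Ω)`. -/
def MemW22 (Ω : Set (ℝ × ℝ)) (f : ℝ × ℝ → ℝ) : Prop :=
  MemW12 Ω f ∧ ∀ i, MemW12 Ω (pd Ω i f)

/-- `f ∈ W^{1,2}(plate l ε)` has zero trace on the lateral boundary `∂I × (-ε/2, ε/2)`. The trace
is the continuous extension, from `W^{1,2}` to `L²` of the lateral boundary, of the restriction of
functions that are smooth up to the boundary. -/
def ZeroLateralTrace (l ε : ℝ) (f : ℝ × ℝ → ℝ) : Prop :=
  ∃ φ : ℕ → ℝ × ℝ → ℝ, (∀ n, ContDiff ℝ ∞ (φ n)) ∧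
    Tendsto (fun n => eLpNorm (fun x => φ n x - f x) 2 (volume.restrict (plate l ε)))
      atTop (𝓝 0) ∧
    (∀ i, Tendsto (fun n => eLpNorm (fun x => fderiv ℝ (φ n) x (dir i) - pd (plate l ε) i f x) 2
      (volume.restrict (plate l ε))) atTop (𝓝 0)) ∧
    ∀ s ∈ ({-l / 2, l / 2} : Set ℝ),
      Tendsto (fun n => eLpNorm (fun t => φ n (s, t)) 2 (volume.restrict (Ioo (-ε / 2) (ε / 2))))
        atTop (𝓝 0)

/-- `f = g` on `∂I × (-ε/2, ε/2)` in the sense of traces, for `f, g ∈ W^{1,2}(plate l ε)`. -/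
def LateralTraceEq (l ε : ℝ) (f g : ℝ × ℝ → ℝ) : Prop :=
  ZeroLateralTrace l ε (fun x => f x - g x)

/-! ## Weak convergence -/

/-- `fₙ ⇀ f` weakly in `L²(Ω)`. -/
def WeakL2 (Ω : Set (ℝ × ℝ)) (fn : ℕ → ℝ × ℝ → ℝ) (f : ℝ × ℝ → ℝ) : Prop :=
  (∀ n, MemL2 Ω (fn n)) ∧ MemL2 Ω f ∧
    ∀ h, MemL2 Ω h → Tendsto (fun n => ∫ x in Ω, fn n x * h x) atTop (𝓝 (∫ x in Ω, f x * h x))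

/-- `fₙ ⇀ f` weakly in `W^{1,2}(Ω)`: the functions and their first weak derivatives converge
weakly in `L²(Ω)`. -/
def WeakW12 (Ω : Set (ℝ × ℝ)) (fn : ℕ → ℝ × ℝ → ℝ) (f : ℝ × ℝ → ℝ) : Prop :=
  (∀ n, MemW12 Ω (fn n)) ∧ MemW12 Ω f ∧ WeakL2 Ω fn f ∧
    ∀ i, WeakL2 Ω (fun n => pd Ω i (fn n)) (pd Ω i f)

/-- `fₙ ⇀ f` weakly in `W^{2,2}(Ω)`: the functions and their weak derivatives up to order two
converge weakly in `L²(Ω)`. -/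
def WeakW22 (Ω : Set (ℝ × ℝ)) (fn : ℕ → ℝ × ℝ → ℝ) (f : ℝ × ℝ → ℝ) : Prop :=
  (∀ n, MemW22 Ω (fn n)) ∧ MemW22 Ω f ∧ WeakL2 Ω fn f ∧
    (∀ i, WeakL2 Ω (fun n => pd Ω i (fn n)) (pd Ω i f)) ∧
    ∀ i j, WeakL2 Ω (fun n => pd Ω i (pd Ω j (fn n))) (pd Ω i (pd Ω j f))

/-- `Fₙ ⇀ F` weakly in `L²(Ω; ℝ^{2×2})`. -/
def WeakL2Matrix (Ω : Set (ℝ × ℝ)) (Fn : ℕ → ℝ × ℝ → Matrix (Fin 2) (Fin 2) ℝ)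
    (F : ℝ × ℝ → Matrix (Fin 2) (Fin 2) ℝ) : Prop :=
  ∀ i j, WeakL2 Ω (fun n x => Fn n x i j) (fun x => F x i j)

/-! ## The von Kármán energy

A displacement `u : Fin 2 → ℝ × ℝ → ℝ` is given by its components `u 0`, `u 1`. -/

/-- The linear strain `e(u)`. -/
def strain (Ω : Set (ℝ × ℝ)) (u : Fin 2 → ℝ × ℝ → ℝ) (x : ℝ × ℝ) : Matrix (Fin 2) (Fin 2) ℝ :=
  Matrix.of fun i j => (pd Ω j (u i) x + pd Ω i (u j) x) / 2

/-- The gradient `∇v`. -/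
def grad (Ω : Set (ℝ × ℝ)) (v : ℝ × ℝ → ℝ) (x : ℝ × ℝ) : Fin 2 → ℝ :=
  fun i => pd Ω i v x

/-- The Hessian `∇²v`. -/
def hess (Ω : Set (ℝ × ℝ)) (v : ℝ × ℝ → ℝ) (x : ℝ × ℝ) : Matrix (Fin 2) (Fin 2) ℝ :=
  Matrix.of fun i j => pd Ω i (pd Ω j v) x

/-- The von Kármán energy on `plate l ε` with forces `f`, `g`, divided by the width `ε`. -/
def energy (Q : QuadraticForm ℝ (Matrix (Fin 2) (Fin 2) ℝ)) (l ε : ℝ) (f : ℝ × ℝ → ℝ)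
    (g : Fin 2 → ℝ × ℝ → ℝ) (u : Fin 2 → ℝ × ℝ → ℝ) (v : ℝ × ℝ → ℝ) : ℝ :=
  (1 / ε) * (∫ x in plate l ε, (1 / 2) * Q (strain (plate l ε) u x +
      (1 / 2 : ℝ) • Matrix.vecMulVec (grad (plate l ε) v x) (grad (plate l ε) v x))) +
  (1 / ε) * (∫ x in plate l ε, (1 / 24) * Q (hess (plate l ε) v x)) -
  (1 / ε) * (∫ x in plate l ε, (f x * v x + ∑ i, g i x * u i x))

/-- The admissible displacements of the plate of width `ε`. -/
structure Admissible (l ε : ℝ) (uhat₁ uhat₂ vhat : ℝ → ℝ) (u : Fin 2 → ℝ × ℝ → ℝ)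
    (v : ℝ × ℝ → ℝ) : Prop where
  u_mem : ∀ i, MemW12 (plate l ε) (u i)
  v_mem : MemW22 (plate l ε) v
  u_bdry₁ : LateralTraceEq l ε (u 0) (fun x => uhat₁ x.1 - x.2 / ε * D1 l uhat₂ x.1)
  u_bdry₂ : LateralTraceEq l ε (u 1) (fun x => 1 / ε * uhat₂ x.1)
  v_bdry : LateralTraceEq l ε v (fun x => vhat x.1)
  dv_bdry : LateralTraceEq l ε (pd (plate l ε) 0 v) (fun x => D1 l vhat x.1)

/-! ## Scaled quantities on the fixed domain -/

/-- `x ↦ f (x₁, ε x₂)`. -/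
def rescale (ε : ℝ) (f : ℝ × ℝ → ℝ) : ℝ × ℝ → ℝ := fun x => f (x.1, ε * x.2)

/-- The scaled in-plane displacement: `y₁(x) = u₁(x₁, ε x₂)`, `y₂(x) = ε u₂(x₁, ε x₂)`. -/
def scaledY (ε : ℝ) (u : Fin 2 → ℝ × ℝ → ℝ) : Fin 2 → ℝ × ℝ → ℝ :=
  ![rescale ε (u 0), fun x => ε * rescale ε (u 1) x]

/-- The scaled strain `E^ε y`. -/
def scaledStrain (Ω : Set (ℝ × ℝ)) (ε : ℝ) (y : Fin 2 → ℝ × ℝ → ℝ) (x : ℝ × ℝ) :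
    Matrix (Fin 2) (Fin 2) ℝ :=
  !![pd Ω 0 (y 0) x, 1 / (2 * ε) * (pd Ω 0 (y 1) x + pd Ω 1 (y 0) x);
     1 / (2 * ε) * (pd Ω 1 (y 0) x + pd Ω 0 (y 1) x), 1 / ε ^ 2 * pd Ω 1 (y 1) x]

/-- The scaled gradient `∇_ε w`. -/
def scaledGrad (Ω : Set (ℝ × ℝ)) (ε : ℝ) (w : ℝ × ℝ → ℝ) (x : ℝ × ℝ) : Fin 2 → ℝ :=
  ![pd Ω 0 w x, 1 / ε * pd Ω 1 w x]

/-- The scaled Hessian `∇²_ε w`. -/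
def scaledHess (Ω : Set (ℝ × ℝ)) (ε : ℝ) (w : ℝ × ℝ → ℝ) (x : ℝ × ℝ) :
    Matrix (Fin 2) (Fin 2) ℝ :=
  !![pd Ω 0 (pd Ω 0 w) x, 1 / ε * pd Ω 0 (pd Ω 1 w) x;
     1 / ε * pd Ω 1 (pd Ω 0 w) x, 1 / ε ^ 2 * pd Ω 1 (pd Ω 1 w) x]

/-- Bernoulli–Navier displacements on `S = plate l 1` with lateral boundary values
`y₁ = û₁ - x₂ û₂'`, `y₂ = û₂`. -/
structure BernoulliNavier (l : ℝ) (uhat₁ uhat₂ : ℝ → ℝ) (y : Fin 2 → ℝ × ℝ → ℝ) : Prop where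
  mem : ∀ i, MemW12 (plate l 1) (y i)
  strain_zero : ∀ᵐ x ∂volume.restrict (plate l 1),
    strain (plate l 1) y x 0 1 = 0 ∧ strain (plate l 1) y x 1 1 = 0
  bdry₁ : LateralTraceEq l 1 (y 0) (fun x => uhat₁ x.1 - x.2 * D1 l uhat₂ x.1)
  bdry₂ : LateralTraceEq l 1 (y 1) (fun x => uhat₂ x.1)

end Ribbon

end

open Ribbon

/-! Transported to the fixed plate, a displacement becomes a family of fields: the scaled gradient
q, the scaled Hessian h, the derivatives of y, and the nonlinear strain p = E + ½ q ⊗ q. Let P and H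
be the sums of the L² norms of the entries of p and h. Coercivity of Q on symmetric matrices
(`exists_coercive`) turns the energy bound into c (P² + H²) ≤ C (1 + ‖w‖ + ‖y₁‖ + ‖y₂‖)
(`energy_lower_bound`). The difficulty is the load on y. Korn's inequality bounds y by its linear
strain, which equals p minus a quadratic term in q. Estimated naively, q₁² is of order H², the same
order as the coercive term, and the forces are not assumed small.

The remedy comes from the boundary condition. The mean of ∂₁y₁ is prescribed, so ∫ q₁² is determined
by ∫ p₁₁ and the data, and ‖q₁‖² ≤ C (1 + P). Interpolating with Ladyzhenskaya's inequality gives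
‖q₁²‖ of order P^{1/2} H (`IsScaled.gradient`), which Young's inequality absorbs. The terms
containing q₂ enter the linear strain of y with a factor ε, because that strain has entries 2ε E₁₂
and ε² E₂₂ outside the position 11 (`IsScaled.stretching`); they are absorbed once ε is small
(`exists_bound_of_quadratic_le`). The outcome is a uniform L² bound on all fields and scaled strains
(`exists_boundedBy`).

A subsequence then converges weakly in L². Derivative relations and trace conditions are written as
linear integral identities against fixed smooth functions, so they survive the limit
(`HasWeakDeriv.of_weakL2`, `HasLat.of_weakL2`). At ε = 0 the x₂-derivatives of w, q₁ and q₂ vanish,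
so these limits depend on x₁ only (`HasLat.exists_avg`), and 2ε E₁₂ and ε² E₂₂ tend weakly to zero,
which is the Bernoulli–Navier condition. The limit θ of q₂ has zero boundary values because ∂₂ of a
function z has zero lateral trace whenever z and ∂₁z have (`HasLat.deriv₁_hasLat`).

The inequalities of Poincaré, Ladyzhenskaya and Korn are proved for smooth functions vanishing for
|x₁| ≥ l/2. Density (`HasLat.exists_approx`) comes from mollifying after an area-preserving map that
stretches x₁ and shrinks x₂. For Korn, the product ∂₁ψ₂ ∂₂ψ₁ is exchanged for ∂₂ψ₂ ∂₁ψ₁ through the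
Jacobian determinant, whose integral is a boundary pairing on the two long sides; an extension
across each side bounds this pairing from above by strains (`side_pairing_le`). -/

noncomputable section

namespace Ribbon

/-! ## The `L²` norm -/

section nrm

variable {X : Type*} [MeasurableSpace X] {μ : Measure X} {f g h : X → ℝ}

/-- The `L²(μ)` norm as a real number. -/
def nrm (μ : Measure X) (f : X → ℝ) : ℝ := (eLpNorm f 2 μ).toReal

lemma nrm_nonneg (μ : Measure X) (f : X → ℝ) : 0 ≤ nrm μ f := ENNReal.toReal_nonneg

lemma nrm_congr (hfg : f =ᵐ[μ] g) : nrm μ f = nrm μ g := by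
  rw [nrm, nrm, eLpNorm_congr_ae hfg]

lemma nrm_add_le (hf : MemLp f 2 μ) (hg : MemLp g 2 μ) :
    nrm μ (fun x => f x + g x) ≤ nrm μ f + nrm μ g := by
  rw [nrm, nrm, nrm, ← ENNReal.toReal_add hf.eLpNorm_ne_top hg.eLpNorm_ne_top]
  exact ENNReal.toReal_mono (ENNReal.add_ne_top.2 ⟨hf.eLpNorm_ne_top, hg.eLpNorm_ne_top⟩)
    (eLpNorm_add_le hf.1 hg.1 (by norm_num))

lemma nrm_sub_le (hf : MemLp f 2 μ) (hg : MemLp g 2 μ) :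
    nrm μ (fun x => f x - g x) ≤ nrm μ f + nrm μ g := by
  rw [nrm, nrm, nrm, ← ENNReal.toReal_add hf.eLpNorm_ne_top hg.eLpNorm_ne_top]
  exact ENNReal.toReal_mono (ENNReal.add_ne_top.2 ⟨hf.eLpNorm_ne_top, hg.eLpNorm_ne_top⟩)
    (eLpNorm_sub_le hf.1 hg.1 (by norm_num))

lemma nrm_const_mul (c : ℝ) (f : X → ℝ) : nrm μ (fun x => c * f x) = |c| * nrm μ f := by
  have : (fun x => c * f x) = c • f := by ext; simp
  rw [nrm, nrm, this, eLpNorm_const_smul]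
  simp

lemma nrm_mono (hg : MemLp g 2 μ) (h : ∀ᵐ x ∂μ, |f x| ≤ |g x|) : nrm μ f ≤ nrm μ g :=
  ENNReal.toReal_mono hg.eLpNorm_ne_top (eLpNorm_mono_ae h)

lemma nrm_sub_comm (f g : X → ℝ) : nrm μ (fun x => f x - g x) = nrm μ (fun x => g x - f x) := by
  rw [nrm, nrm]
  congr 1
  exact eLpNorm_sub_comm f g 2 μ

lemma nrm_le_add_sub (hf : MemLp f 2 μ) (hg : MemLp g 2 μ) :
    nrm μ f ≤ nrm μ g + nrm μ (fun x => f x - g x) := by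
  have := nrm_add_le hg (hf.sub hg)
  refine le_trans (le_of_eq ?_) this
  congr 1; ext x; simp

lemma integrable_mul_of_memLp (hf : MemLp f 2 μ) (hg : MemLp g 2 μ) :
    Integrable (fun x => f x * g x) μ := hf.integrable_mul hg

lemma nrm_sq (hf : MemLp f 2 μ) : nrm μ f ^ 2 = ∫ x, f x ^ 2 ∂μ := by
  have h := integral_eq_lintegral_of_nonneg_ae (μ := μ) (f := fun x => f x ^ 2)
    (Eventually.of_forall fun x => by positivity) hf.integrable_sq.1
  rw [h, nrm, ← ENNReal.toReal_pow]
  congr 1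
  rw [eLpNorm_eq_lintegral_rpow_enorm_toReal (by norm_num) (by norm_num)]
  simp only [ENNReal.toReal_ofNat]
  rw [← ENNReal.rpow_natCast, ← ENNReal.rpow_mul]
  norm_num
  refine lintegral_congr fun x => ?_
  rw [← ofReal_norm, ← ENNReal.ofReal_pow (norm_nonneg _)]
  simp

/-- Cauchy–Schwarz, from the discriminant of the nonnegative quadratic polynomial t ↦ ∫ (t f + g)².
-/
lemma abs_integral_mul_le (hf : MemLp f 2 μ) (hg : MemLp g 2 μ) :
    |∫ x, f x * g x ∂μ| ≤ nrm μ f * nrm μ g := by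
  refine abs_le_of_sq_le_sq ?_ (mul_nonneg (nrm_nonneg _ _) (nrm_nonneg _ _))
  have key : ∀ t : ℝ, 0 ≤ (∫ x, f x ^ 2 ∂μ) * (t * t) + (2 * ∫ x, f x * g x ∂μ) * t +
      ∫ x, g x ^ 2 ∂μ := by
    intro t
    have : (∫ x, f x ^ 2 ∂μ) * (t * t) + (2 * ∫ x, f x * g x ∂μ) * t + ∫ x, g x ^ 2 ∂μ
        = ∫ x, (t * f x + g x) ^ 2 ∂μ := by
      have e : ∀ x, (t * f x + g x) ^ 2 = (t * t) * f x ^ 2 + (2 * t) * (f x * g x) + g x ^ 2 :=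
        fun x => by ring
      simp_rw [e]
      rw [integral_add, integral_add, integral_const_mul, integral_const_mul]
      · ring
      · exact hf.integrable_sq.const_mul _
      · exact (hf.integrable_mul hg).const_mul _
      · exact (hf.integrable_sq.const_mul _).add ((hf.integrable_mul hg).const_mul _)
      · exact hg.integrable_sq
    rw [this]
    exact integral_nonneg fun x => by positivity
  have := discrim_le_zero key
  rw [mul_pow, nrm_sq hf, nrm_sq hg]
  rw [discrim] at this
  nlinarith

lemma nrm_eq_zero (hf : MemLp f 2 μ) : nrm μ f = 0 ↔ f =ᵐ[μ] 0 := by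
  rw [nrm, ENNReal.toReal_eq_zero_iff, or_iff_left hf.eLpNorm_ne_top,
    eLpNorm_eq_zero_iff hf.1 (by norm_num)]

lemma nrm_le_of_sq_le (hf : MemLp f 2 μ) {c : ℝ} (hc : 0 ≤ c) (h : ∫ x, f x ^ 2 ∂μ ≤ c ^ 2) :
    nrm μ f ≤ c := by
  rw [← nrm_sq hf] at h
  exact (abs_le_of_sq_le_sq' h hc).2

lemma tendsto_nrm {F : ℕ → X → ℝ} (hF : ∀ n, MemLp (F n) 2 μ) (hf : MemLp f 2 μ)
    (h : Tendsto (fun n => nrm μ (fun x => F n x - f x)) atTop (𝓝 0)) :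
    Tendsto (fun n => nrm μ (F n)) atTop (𝓝 (nrm μ f)) := by
  rw [tendsto_iff_dist_tendsto_zero]
  refine squeeze_zero (fun _ => dist_nonneg) (fun n => ?_) h
  rw [Real.dist_eq, abs_le]
  have h1 := nrm_le_add_sub (hF n) hf
  have h2 := nrm_le_add_sub hf (hF n)
  rw [nrm_sub_comm] at h2
  constructor <;> linarith

lemma tendsto_integral_mul_of_nrm {F : ℕ → X → ℝ} (hF : ∀ n, MemLp (F n) 2 μ) (hf : MemLp f 2 μ)
    (h : Tendsto (fun n => nrm μ (fun x => F n x - f x)) atTop (𝓝 0)) (hg : MemLp g 2 μ) :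
    Tendsto (fun n => ∫ x, F n x * g x ∂μ) atTop (𝓝 (∫ x, f x * g x ∂μ)) := by
  rw [tendsto_iff_dist_tendsto_zero]
  have h' := h.mul_const (nrm μ g)
  rw [zero_mul] at h'
  refine squeeze_zero (fun _ => dist_nonneg) (fun n => ?_) h'
  rw [Real.dist_eq, ← integral_sub (integrable_mul_of_memLp (hF n) hg) (integrable_mul_of_memLp hf hg)]
  have := abs_integral_mul_le ((hF n).sub hf) hg
  refine le_trans (le_of_eq ?_) this
  congr 2; ext x; simp [sub_mul]

lemma tendsto_nrm_iff {F : ℕ → X → ℝ} (hF : ∀ n, MemLp (F n) 2 μ) :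
    Tendsto (fun n => nrm μ (F n)) atTop (𝓝 0) ↔
      Tendsto (fun n => eLpNorm (F n) 2 μ) atTop (𝓝 0) := by
  have := ENNReal.tendsto_toReal_iff (fi := atTop) (fun n => (hF n).eLpNorm_ne_top) ENNReal.zero_ne_top
  simpa [nrm] using this

end nrm

/-! ## Weak derivatives -/

set_option linter.unusedSectionVars false

section weakDeriv

variable {X : Type*} [NormedAddCommGroup X] [NormedSpace ℝ X] [MeasureSpace X]
  {Ω : Set X} {e : X} {f g f' g' : X → ℝ}

lemma hasWeakDeriv_weakDeriv (h : ∃ g, HasWeakDeriv Ω e f g) :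
    HasWeakDeriv Ω e f (weakDeriv Ω e f) := by
  rw [weakDeriv, dif_pos h]; exact h.choose_spec

lemma HasWeakDeriv.congr (h : HasWeakDeriv Ω e f g) (hf : f =ᵐ[volume.restrict Ω] f')
    (hg : g =ᵐ[volume.restrict Ω] g') (hf' : LocallyIntegrableOn f' Ω)
    (hg' : LocallyIntegrableOn g' Ω) : HasWeakDeriv Ω e f' g' := by
  refine ⟨hf', hg', fun φ hφ hc hs => ?_⟩
  have := h.2.2 φ hφ hc hs
  rw [integral_congr_ae (g := fun x => f x * fderiv ℝ φ x e) (hf.mono fun x hx => by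
      simp only [hx]), this,
    integral_congr_ae (g := fun x => g' x * φ x) (hg.mono fun x hx => by simp only [hx])]

variable [OpensMeasurableSpace X]

lemma integrableOn_mul_of_tsupport (hΩ : MeasurableSet Ω) (hf : LocallyIntegrableOn f Ω) {φ : X → ℝ}
    (hφ : Continuous φ) (hc : HasCompactSupport φ) (hs : tsupport φ ⊆ Ω) :
    IntegrableOn (fun x => f x * φ x) Ω := by
  have := (hf.integrableOn_compact_subset hs hc).mul_continuousOn hφ.continuousOn hc
  refine this.of_forall_sdiff_eq_zero hΩ fun x hx => ?_
  rw [image_eq_zero_of_notMem_tsupport hx.2, mul_zero]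

lemma integrableOn_mul_fderiv (hΩ : MeasurableSet Ω) (hf : LocallyIntegrableOn f Ω) {φ : X → ℝ}
    (hφ : ContDiff ℝ ∞ φ) (hc : HasCompactSupport φ) (hs : tsupport φ ⊆ Ω) (e : X) :
    IntegrableOn (fun x => f x * fderiv ℝ φ x e) Ω :=
  integrableOn_mul_of_tsupport hΩ hf
    ((hφ.continuous_fderiv (by simp)).clm_apply continuous_const)
    (hc.fderiv_apply ℝ e) ((tsupport_fderiv_apply_subset ℝ e).trans hs)

/-- The fundamental lemma of the calculus of variations. Since `weakDeriv` is picked by choice, this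
is what identifies it with an explicitly computed derivative. -/
lemma HasWeakDeriv.ae_eq [FiniteDimensional ℝ X] [BorelSpace X]
    (hΩ : IsOpen Ω) (h1 : HasWeakDeriv Ω e f g) (h2 : HasWeakDeriv Ω e f g') :
    g =ᵐ[volume.restrict Ω] g' := by
  have := hΩ.ae_eq_zero_of_integral_contDiff_smul_eq_zero (μ := volume)
    (f := fun x => g x - g' x) (h1.2.1.sub h2.2.1) (fun φ hφ hc hs => by
      have e1 := h1.2.2 φ hφ hc hs
      have e2 := h2.2.2 φ hφ hc hs
      have i1 := integrableOn_mul_of_tsupport hΩ.measurableSet h1.2.1 hφ.continuous hc hs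
      have i2 := integrableOn_mul_of_tsupport hΩ.measurableSet h2.2.1 hφ.continuous hc hs
      rw [← setIntegral_eq_integral_of_forall_compl_eq_zero (s := Ω)]
      · have : ∀ x, φ x • (g x - g' x) = g x * φ x - g' x * φ x := fun x => by
          simp only [smul_eq_mul]; ring
        simp_rw [this]
        rw [integral_sub i1 i2]
        linarith
      · intro x hx
        rw [image_eq_zero_of_notMem_tsupport (fun h => hx (hs h)), zero_smul])
  rw [EventuallyEq, ae_restrict_iff' hΩ.measurableSet]
  filter_upwards [this] with x hx hxΩ
  linarith [hx hxΩ]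

lemma HasWeakDeriv.weakDeriv_ae_eq [FiniteDimensional ℝ X] [BorelSpace X]
    (hΩ : IsOpen Ω) (h : HasWeakDeriv Ω e f g) : weakDeriv Ω e f =ᵐ[volume.restrict Ω] g :=
  (hasWeakDeriv_weakDeriv ⟨g, h⟩).ae_eq hΩ h

lemma HasWeakDeriv.add (hΩ : MeasurableSet Ω) (h1 : HasWeakDeriv Ω e f g)
    (h2 : HasWeakDeriv Ω e f' g') :
    HasWeakDeriv Ω e (fun x => f x + f' x) (fun x => g x + g' x) := by
  refine ⟨h1.1.add h2.1, h1.2.1.add h2.2.1, fun φ hφ hc hs => ?_⟩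
  simp_rw [add_mul]
  rw [integral_add (integrableOn_mul_fderiv hΩ h1.1 hφ hc hs e)
      (integrableOn_mul_fderiv hΩ h2.1 hφ hc hs e),
    integral_add (integrableOn_mul_of_tsupport hΩ h1.2.1 hφ.continuous hc hs)
      (integrableOn_mul_of_tsupport hΩ h2.2.1 hφ.continuous hc hs),
    h1.2.2 φ hφ hc hs, h2.2.2 φ hφ hc hs]
  ring

lemma _root_.MeasureTheory.LocallyIntegrableOn.const_mul' (h : LocallyIntegrableOn f Ω) (c : ℝ) :
    LocallyIntegrableOn (fun x => c * f x) Ω := fun x hx => by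
  obtain ⟨s, hs, hi⟩ := h x hx
  exact ⟨s, hs, hi.const_mul c⟩

lemma HasWeakDeriv.const_mul (c : ℝ) (h : HasWeakDeriv Ω e f g) :
    HasWeakDeriv Ω e (fun x => c * f x) (fun x => c * g x) := by
  refine ⟨h.1.const_mul' c, h.2.1.const_mul' c, fun φ hφ hc hs => ?_⟩
  simp_rw [mul_assoc]
  rw [integral_const_mul, integral_const_mul, h.2.2 φ hφ hc hs]
  ring

lemma HasWeakDeriv.sub (hΩ : MeasurableSet Ω) (h1 : HasWeakDeriv Ω e f g)
    (h2 : HasWeakDeriv Ω e f' g') :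
    HasWeakDeriv Ω e (fun x => f x - f' x) (fun x => g x - g' x) := by
  simpa [sub_eq_add_neg] using h1.add hΩ (h2.const_mul (-1))

lemma MemL2.integrableOn [IsFiniteMeasure (volume.restrict Ω : Measure X)] (h : MemL2 Ω f) :
    IntegrableOn f Ω := h.integrable (by norm_num)

lemma MemL2.locallyIntegrableOn [IsFiniteMeasure (volume.restrict Ω : Measure X)]
    (h : MemL2 Ω f) : LocallyIntegrableOn f Ω := h.integrableOn.locallyIntegrableOn

end weakDeriv

/-! ## The plate and the interval -/

section plate

variable (l ε : ℝ)

lemma isOpen_plate : IsOpen (plate l ε) := isOpen_Ioo.prod isOpen_Ioo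

lemma measurableSet_plate : MeasurableSet (plate l ε) := (isOpen_plate l ε).measurableSet

lemma isOpen_interval : IsOpen (interval l) := isOpen_Ioo

lemma measurableSet_interval : MeasurableSet (interval l) := measurableSet_Ioo

instance : IsFiniteMeasure (volume.restrict (interval l)) :=
  ⟨by simp [interval]⟩

lemma restrict_plate : (volume.restrict (plate l ε) : Measure (ℝ × ℝ)) =
    (volume.restrict (interval l)).prod (volume.restrict (Ioo (-ε / 2) (ε / 2))) := by
  rw [Measure.prod_restrict, ← Measure.volume_eq_prod]; rfl

instance : IsFiniteMeasure (volume.restrict (plate l ε) : Measure (ℝ × ℝ)) := by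
  have : IsFiniteMeasure (volume.restrict (Ioo (-ε / 2) (ε / 2))) := ⟨by simp⟩
  rw [restrict_plate]; infer_instance

/-- A continuous function is in every `Lᵖ` of a bounded set. -/
lemma memLp_of_continuous {f : ℝ × ℝ → ℝ} (hf : Continuous f) (p : ENNReal) :
    MemLp f p (volume.restrict (plate l ε)) := by
  have hK : IsCompact (Icc (-l / 2) (l / 2) ×ˢ Icc (-ε / 2) (ε / 2)) :=
    isCompact_Icc.prod isCompact_Icc
  obtain ⟨C, hC⟩ := hK.exists_bound_of_continuousOn hf.continuousOn
  refine MemLp.of_bound hf.aestronglyMeasurable C ?_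
  rw [ae_restrict_iff' (measurableSet_plate l ε)]
  exact Eventually.of_forall fun x hx => hC x ⟨Ioo_subset_Icc_self hx.1, Ioo_subset_Icc_self hx.2⟩

lemma memLp_of_continuous_interval {f : ℝ → ℝ} (hf : Continuous f) (p : ENNReal) :
    MemLp f p (volume.restrict (interval l)) := by
  obtain ⟨C, hC⟩ := (isCompact_Icc (a := -l / 2) (b := l / 2)).exists_bound_of_continuousOn
    hf.continuousOn
  refine MemLp.of_bound hf.aestronglyMeasurable C ?_
  rw [ae_restrict_iff' (measurableSet_interval l)]
  exact Eventually.of_forall fun x hx => hC x (Ioo_subset_Icc_self hx)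

end plate

/-! ## Smooth approximation of functions with zero lateral trace -/

/-- `f ∈ W^{1,2}(S)` has zero lateral trace and weak derivatives `g₀`, `g₁`. The trace condition is
expressed through integration by parts against functions that need not vanish on the lateral
boundary. -/
structure HasLat (l : ℝ) (f g₀ g₁ : ℝ × ℝ → ℝ) : Prop where
  mem : MemL2 (plate l 1) f
  mem₀ : MemL2 (plate l 1) g₀
  mem₁ : MemL2 (plate l 1) g₁
  deriv₀ : ∀ φ : ℝ × ℝ → ℝ, ContDiff ℝ ∞ φ →
    ∫ x in plate l 1, f x * fderiv ℝ φ x (1, 0) = - ∫ x in plate l 1, g₀ x * φ x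
  deriv₁ : HasWeakDeriv (plate l 1) (dir 1) f g₁

/-- The inner radii of the bumps increase to l/2 while the outer radii stay below it. Multiplying a
test function by such a cutoff in one variable and letting n → ∞ removes the support condition in
that variable. -/
lemma exists_cutoff {l : ℝ} (hl : 0 < l) : ∃ χ : ℕ → ℝ → ℝ, (∀ n, ContDiff ℝ ∞ (χ n)) ∧
    (∀ n, HasCompactSupport (χ n)) ∧ (∀ n, tsupport (χ n) ⊆ Ioo (-l / 2) (l / 2)) ∧
    (∀ n x, |χ n x| ≤ 1) ∧ ∀ x ∈ Ioo (-l / 2) (l / 2), ∀ᶠ n in atTop, χ n x = 1 := by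
  let b : ℕ → ContDiffBump (0 : ℝ) := fun n =>
    { rIn := l / 2 * (1 - 1 / (n + 2))
      rOut := l / 2 * (1 - 1 / (n + 3))
      rIn_pos := by
        have : 1 / ((n : ℝ) + 2) < 1 := by rw [div_lt_one (by positivity)]; linarith [n.cast_nonneg (α := ℝ)]
        exact mul_pos (by positivity) (by linarith)
      rIn_lt_rOut := by
        have : 1 / ((n : ℝ) + 3) < 1 / (n + 2) :=
          one_div_lt_one_div_of_lt (by positivity) (by linarith)
        exact mul_lt_mul_of_pos_left (by linarith) (by positivity) }
  refine ⟨fun n => b n, fun n => (b n).contDiff, fun n => (b n).hasCompactSupport, fun n => ?_,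
    fun n x => ?_, fun x hx => ?_⟩
  · rw [(b n).tsupport_eq, Real.closedBall_eq_Icc]
    have : 0 < l / 2 * (1 / ((n : ℝ) + 3)) := by positivity
    apply Icc_subset_Ioo <;> simp only [b] <;> linarith
  · rw [abs_of_nonneg (b n).nonneg]; exact (b n).le_one
  · have h1 : Tendsto (fun n : ℕ => l / 2 * (1 - 1 / ((n : ℝ) + 2))) atTop (𝓝 (l / 2 * (1 - 0))) := by
      refine (tendsto_const_nhds.sub ?_).const_mul _
      have := (tendsto_one_div_add_atTop_nhds_zero_nat (𝕜 := ℝ)).comp (tendsto_add_atTop_nat 1)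
      refine this.congr fun n => ?_
      simp only [Function.comp]; push_cast; ring
    have h2 : |x| < l / 2 * (1 - 0) := by
      rw [abs_lt]; constructor <;> linarith [hx.1, hx.2]
    filter_upwards [h1.eventually (lt_mem_nhds h2)] with n hn
    refine (b n).one_of_mem_closedBall ?_
    rw [mem_closedBall_zero_iff, Real.norm_eq_abs]
    exact hn.le

lemma tendsto_integral_cutoff {X : Type*} [MeasurableSpace X] {μ : Measure X} {h : X → ℝ}
    (hh : Integrable h μ) {χ : ℕ → X → ℝ} (hm : ∀ n, AEStronglyMeasurable (χ n) μ)
    (hb : ∀ n x, |χ n x| ≤ 1) (hχ : ∀ᵐ x ∂μ, ∀ᶠ n in atTop, χ n x = 1) :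
    Tendsto (fun n => ∫ x, h x * χ n x ∂μ) atTop (𝓝 (∫ x, h x ∂μ)) := by
  refine tendsto_integral_of_dominated_convergence (fun x => |h x|) (fun n => hh.1.mul (hm n))
    hh.abs (fun n => Eventually.of_forall fun x => ?_) ?_
  · rw [Real.norm_eq_abs, abs_mul]
    exact mul_le_of_le_one_right (abs_nonneg _) (hb n x)
  · filter_upwards [hχ] with x hx
    refine tendsto_const_nhds.congr' ?_
    filter_upwards [hx] with n hn
    rw [hn, mul_one]

lemma fderiv_fst_comp {a : ℝ → ℝ} (ha : ContDiff ℝ ∞ a) (x v : ℝ × ℝ) :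
    fderiv ℝ (fun x : ℝ × ℝ => a x.1) x v = deriv a x.1 * v.1 := by
  have h : HasFDerivAt (fun x : ℝ × ℝ => a x.1) _ x :=
    ((ha.differentiable (by simp)) x.1).hasFDerivAt.comp x hasFDerivAt_fst
  rw [h.fderiv]; simp [mul_comm]

lemma fderiv_snd_comp {a : ℝ → ℝ} (ha : ContDiff ℝ ∞ a) (x v : ℝ × ℝ) :
    fderiv ℝ (fun x : ℝ × ℝ => a x.2) x v = deriv a x.2 * v.2 := by
  have h : HasFDerivAt (fun x : ℝ × ℝ => a x.2) _ x :=
    ((ha.differentiable (by simp)) x.2).hasFDerivAt.comp x hasFDerivAt_snd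
  rw [h.fderiv]; simp [mul_comm]

lemma continuous_fderivApply {φ : ℝ × ℝ → ℝ} (hφ : ContDiff ℝ ∞ φ) (v : ℝ × ℝ) :
    Continuous fun x => fderiv ℝ φ x v :=
  (hφ.continuous_fderiv (by simp)).clm_apply continuous_const

lemma contDiff_fderivApply {φ : ℝ × ℝ → ℝ} (hφ : ContDiff ℝ ∞ φ) (v : ℝ × ℝ) :
    ContDiff ℝ ∞ fun x => fderiv ℝ φ x v :=
  (hφ.fderiv_right (m := ∞) (by simp)).clm_apply contDiff_const

lemma fderiv_mul_apply {φ χ : ℝ × ℝ → ℝ} (hφ : ContDiff ℝ ∞ φ) (hχ : ContDiff ℝ ∞ χ) (x v : ℝ × ℝ) :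
    fderiv ℝ (fun x => φ x * χ x) x v = fderiv ℝ φ x v * χ x + φ x * fderiv ℝ χ x v := by
  have := ((hφ.differentiable (by simp) x).hasFDerivAt.mul
    (hχ.differentiable (by simp) x).hasFDerivAt).fderiv
  have h2 : (fun x => φ x * χ x) = φ * χ := rfl
  rw [h2, this]; simp; ring

/-- The integration by parts formula in the direction `x₂` holds for test functions that need not
vanish on the lateral boundary. -/
lemma integral_deriv_snd {l : ℝ} (hl : 0 < l) {f g : ℝ × ℝ → ℝ} (hf : MemL2 (plate l 1) f)
    (hg : MemL2 (plate l 1) g) (h : HasWeakDeriv (plate l 1) (dir 1) f g) {φ : ℝ × ℝ → ℝ}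
    (hφ : ContDiff ℝ ∞ φ)
    (hs : tsupport φ ⊆ univ ×ˢ Ioo (-1 / 2) (1 / 2)) :
    ∫ x in plate l 1, f x * fderiv ℝ φ x (0, 1) = - ∫ x in plate l 1, g x * φ x := by
  obtain ⟨χ, hχ, hχc, hχs, hχb, hχ1⟩ := exists_cutoff hl
  have hχ' : ∀ n, ContDiff ℝ ∞ fun x : ℝ × ℝ => χ n x.1 := fun n => (hχ n).comp contDiff_fst
  have hae : ∀ᵐ x ∂(volume.restrict (plate l 1)), ∀ᶠ n in atTop, χ n x.1 = 1 := by
    rw [ae_restrict_iff' (measurableSet_plate l 1)]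
    exact Eventually.of_forall fun x hx => hχ1 x.1 hx.1
  have h1 := tendsto_integral_cutoff (hf.integrable_mul
    (memLp_of_continuous l 1 (continuous_fderivApply hφ (0, 1)) 2))
    (fun n => (hχ' n).continuous.aestronglyMeasurable) (fun n x => hχb n x.1) hae
  have h2 := tendsto_integral_cutoff (hg.integrable_mul (memLp_of_continuous l 1 hφ.continuous 2))
    (fun n => (hχ' n).continuous.aestronglyMeasurable) (fun n x => hχb n x.1) hae
  refine tendsto_nhds_unique h1 (h2.neg.congr fun n => ?_)
  -- The cutoff depends on x₁ only, so ∂₂ does not see it: the product is an admissible test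
  -- function and its x₂-derivative is ∂₂φ times the cutoff.
  have hsup : tsupport (fun x : ℝ × ℝ => φ x * χ n x.1) ⊆ plate l 1 := by
    intro x hx
    have e1 := hs (tsupport_mul_subset_left (f := φ) hx)
    have e2 := tsupport_mul_subset_right (f := φ) (g := fun x : ℝ × ℝ => χ n x.1) hx
    refine ⟨hχs n ?_, e1.2⟩
    exact tsupport_comp_subset_preimage (χ n) continuous_fst e2
  have hcs : HasCompactSupport fun x : ℝ × ℝ => φ x * χ n x.1 :=
    (isCompact_Icc.prod isCompact_Icc).of_isClosed_subset (isClosed_tsupport _)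
      (hsup.trans (prod_mono Ioo_subset_Icc_self Ioo_subset_Icc_self))
  have h3 := h.2.2 (fun x => φ x * χ n x.1) (hφ.mul (hχ' n)) hcs hsup
  rw [eq_comm]
  simp only [Pi.mul_apply]
  refine Eq.trans ?_ (h3.trans ?_)
  · refine integral_congr_ae (Eventually.of_forall fun x => ?_)
    simp only [dir, Matrix.cons_val_one, Matrix.cons_val_fin_one]
    rw [fderiv_mul_apply hφ (hχ' n), fderiv_fst_comp (hχ n)]
    simp; ring
  · simp only [mul_assoc]

/-- The area-preserving linear map `x ↦ (e^{-s} x₁, e^s x₂)`. -/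
def squeeze (s : ℝ) : ℝ × ℝ →L[ℝ] ℝ × ℝ :=
  (Real.exp (-s) • ContinuousLinearMap.fst ℝ ℝ ℝ).prod (Real.exp s • ContinuousLinearMap.snd ℝ ℝ ℝ)

@[simp] lemma squeeze_apply (s : ℝ) (x : ℝ × ℝ) :
    squeeze s x = (Real.exp (-s) * x.1, Real.exp s * x.2) := by
  simp [squeeze]

lemma map_volume_scale {a b : ℝ} (ha : a ≠ 0) (hb : b ≠ 0) :
    Measure.map (fun x : ℝ × ℝ => (a * x.1, b * x.2)) volume =
      ENNReal.ofReal |a⁻¹| • ENNReal.ofReal |b⁻¹| • (volume : Measure (ℝ × ℝ)) := by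
  have h := Measure.map_prod_map (volume : Measure ℝ) (volume : Measure ℝ)
    (measurable_const_mul a) (measurable_const_mul b)
  rw [Real.map_volume_mul_left ha, Real.map_volume_mul_left hb] at h
  rw [Measure.volume_eq_prod]
  change Measure.map (Prod.map (a * ·) (b * ·)) (volume.prod volume) = _
  rw [← h, Measure.prod_smul_left, Measure.prod_smul_right]

lemma measurePreserving_squeeze (s : ℝ) : MeasurePreserving (squeeze s) := by
  refine ⟨(squeeze s).continuous.measurable, ?_⟩
  have : (squeeze s : ℝ × ℝ → ℝ × ℝ) = fun x => (Real.exp (-s) * x.1, Real.exp s * x.2) := by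
    ext x <;> simp
  rw [this, map_volume_scale (Real.exp_pos _).ne' (Real.exp_pos _).ne', smul_smul,
    ← ENNReal.ofReal_mul (abs_nonneg _), ← abs_mul, ← mul_inv, ← Real.exp_add]
  simp

lemma measurePreserving_squeeze_sub (s : ℝ) (v : ℝ × ℝ) :
    MeasurePreserving fun x => squeeze s x - v :=
  (measurePreserving_sub_right volume v).comp (measurePreserving_squeeze s)

lemma eLpNorm_two_sq {X : Type*} [MeasurableSpace X] {μ : Measure X} (f : X → ℝ) :
    eLpNorm f 2 μ ^ 2 = ∫⁻ x, ‖f x‖ₑ ^ 2 ∂μ := by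
  have := eLpNorm_nnreal_pow_eq_lintegral (f := f) (μ := μ) (p := 2) (by norm_num)
  simpa using this

/-- Continuity in `L²` of small perturbations of the identity. -/
lemma tendsto_eLpNorm_squeeze_sub {F : ℝ × ℝ → ℝ} (hF : MemLp F 2 volume) :
    Tendsto (fun p : ℝ × (ℝ × ℝ) => eLpNorm (fun x => F (squeeze p.1 x - p.2) - F x) 2 volume)
      (𝓝 0) (𝓝 0) := by
  have : Fact ((1 : ENNReal) ≤ 2) := ⟨by norm_num⟩
  -- Currying makes the maps depend continuously on (s, v) in the compact-open topology, the mode of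
  -- convergence under which composition with measure-preserving maps is continuous in L².
  let G : C(ℝ × (ℝ × ℝ), C(ℝ × ℝ, ℝ × ℝ)) := ContinuousMap.curry
    ⟨fun q => squeeze q.1.1 q.2 - q.1.2, by simp only [squeeze_apply]; fun_prop⟩
  have hG : ∀ p x, G p x = squeeze p.1 x - p.2 := fun p x => rfl
  have hm : ∀ p, MeasurePreserving (G p) := fun p => measurePreserving_squeeze_sub p.1 p.2
  have h := Filter.Tendsto.compMeasurePreservingLp (l := 𝓝 (0 : ℝ × (ℝ × ℝ)))
    (f := fun _ => hF.toLp F) (f₀ := hF.toLp F) (g := G) (g₀ := G 0) tendsto_const_nhds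
    (G.continuous.tendsto 0) hm (hm 0) (by norm_num)
  have h0 : Lp.compMeasurePreserving (G 0) (hm 0) (hF.toLp F) = hF.toLp F := by
    refine Lp.ext ?_
    filter_upwards [Lp.coeFn_compMeasurePreserving (hF.toLp F) (hm 0)] with x hx
    rw [hx]; simp [hG]
  rw [h0, tendsto_iff_edist_tendsto_0] at h
  refine h.congr fun p => ?_
  rw [Lp.edist_def]
  refine eLpNorm_congr_ae ?_
  filter_upwards [Lp.coeFn_compMeasurePreserving (hF.toLp F) (hm p), hF.coeFn_toLp,
    (hm p).quasiMeasurePreserving.ae hF.coeFn_toLp] with x h1 h2 h3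
  simp only [Pi.sub_apply]
  rw [h1, h2, Function.comp, h3, hG]

/-- Mollification of `F` at scale `b`, composed with `squeeze s`. -/
def mollify (b : ContDiffBump (0 : ℝ × ℝ)) (s : ℝ) (F : ℝ × ℝ → ℝ) (x : ℝ × ℝ) : ℝ :=
  ∫ t, F t * b.normed volume (squeeze s x - t)

lemma mollify_eq_convolution (b : ContDiffBump (0 : ℝ × ℝ)) (s : ℝ) (F : ℝ × ℝ → ℝ) :
    mollify b s F = (convolution F (b.normed volume) (ContinuousLinearMap.mul ℝ ℝ) volume) ∘
      squeeze s := by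
  ext x; simp [mollify, convolution]

lemma contDiff_mollify (b : ContDiffBump (0 : ℝ × ℝ)) (s : ℝ) {F : ℝ × ℝ → ℝ}
    (hF : LocallyIntegrable F) : ContDiff ℝ ∞ (mollify b s F) := by
  rw [mollify_eq_convolution]
  exact (b.hasCompactSupport_normed.contDiff_convolution_right (n := ⊤) _ hF
    b.contDiff_normed).comp (squeeze s).contDiff

/-- The derivative is moved onto the kernel as a function of the integration variable, which makes
the kernel a test function for F; the minus sign comes from differentiating `squeeze s x - t` in t.
-/
lemma fderiv_mollify (b : ContDiffBump (0 : ℝ × ℝ)) (s : ℝ) {F : ℝ × ℝ → ℝ}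
    (hF : LocallyIntegrable F) (x v : ℝ × ℝ) :
    fderiv ℝ (mollify b s F) x v =
      - ∫ t, F t * fderiv ℝ (fun t => b.normed volume (squeeze s x - t)) t (squeeze s v) := by
  have hb : ContDiff ℝ ∞ (b.normed volume) := b.contDiff_normed
  have h1 := (b.hasCompactSupport_normed (μ := volume)).hasFDerivAt_convolution_right
    (ContinuousLinearMap.mul ℝ ℝ) hF (hb.of_le (by simp)) (squeeze s x)
  have h2 := h1.comp x (squeeze s).hasFDerivAt
  rw [mollify_eq_convolution, h2.fderiv, ContinuousLinearMap.comp_apply,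
    convolution_precompR_apply _ hF (b.hasCompactSupport_normed.fderiv ℝ)
      (hb.continuous_fderiv (by simp)), convolution, ← integral_neg]
  refine integral_congr_ae (Eventually.of_forall fun t => ?_)
  have h3 : HasFDerivAt (fun t => b.normed volume (squeeze s x - t)) _ t :=
    ((hb.differentiable (by simp)) (squeeze s x - t)).hasFDerivAt.comp t
      ((hasFDerivAt_id t).const_sub (squeeze s x))
  simp only [h3.fderiv]
  simp

/-- Mollifications converge in `L²`. -/
lemma eLpNorm_mollify_sub_le (b : ContDiffBump (0 : ℝ × ℝ)) (s : ℝ) {F : ℝ × ℝ → ℝ}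
    (hF : MemLp F 2 volume) (hFm : StronglyMeasurable F) {η : ENNReal}
    (hη : ∀ v : ℝ × ℝ, ‖v‖ ≤ b.rOut →
      eLpNorm (fun x => F (squeeze s x - v) - F x) 2 volume ≤ η) :
    eLpNorm (fun x => mollify b s F x - F x) 2 volume ≤ η := by
  set ρ := b.normed (volume : Measure (ℝ × ℝ)) with hρ
  have hρc : Continuous ρ := b.continuous_normed
  have hFl : LocallyIntegrable F := hF.locallyIntegrable (by norm_num)
  let ν : Measure (ℝ × ℝ) := volume.withDensity fun v => ENNReal.ofReal (ρ v)
  have hρi : ∫⁻ v, ENNReal.ofReal (ρ v) = 1 := by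
    rw [← ofReal_integral_eq_lintegral_ofReal b.integrable_normed
      (Eventually.of_forall fun v => b.nonneg_normed v), b.integral_normed]
    simp
  have hprob : IsProbabilityMeasure ν := ⟨by simp [ν, hρi]⟩
  have hmeas : Measurable fun v => ENNReal.ofReal (ρ v) := hρc.measurable.ennreal_ofReal
  -- Jensen's inequality: with the mollifier as density of a probability measure ν, the error at x
  -- is the ν-average of the differences F(`squeeze s x` − v) − F(x). Tonelli then exchanges the x
  -- and v integrals.
  have key : ∀ x, ‖mollify b s F x - F x‖ₑ ^ 2 ≤
      ∫⁻ v, ‖F (squeeze s x - v) - F x‖ₑ ^ 2 ∂ν := by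
    intro x
    have hint : Integrable (fun v => F (squeeze s x - v) * ρ v) := by
      have := (b.hasCompactSupport_normed (μ := volume)).convolutionExists_right
        (ContinuousLinearMap.mul ℝ ℝ) hFl hρc (squeeze s x)
      have h2 := this.integrable.comp_sub_left (squeeze s x)
      simpa using h2
    have e1 : mollify b s F x = ∫ v, F (squeeze s x - v) ∂ν := by
      rw [integral_withDensity_eq_integral_toReal_smul hmeas (by simp), mollify,
        ← integral_sub_left_eq_self _ volume (squeeze s x)]
      refine integral_congr_ae (Eventually.of_forall fun v => ?_)
      simp only [sub_sub_cancel, smul_eq_mul]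
      rw [ENNReal.toReal_ofReal (b.nonneg_normed v), mul_comm]
    have hint2 : Integrable (fun v => F (squeeze s x - v)) ν := by
      rw [integrable_withDensity_iff hmeas (by simp)]
      refine hint.congr (Eventually.of_forall fun v => ?_)
      simp only
      rw [ENNReal.toReal_ofReal (b.nonneg_normed v)]
    have e2 : mollify b s F x - F x = ∫ v, F (squeeze s x - v) - F x ∂ν := by
      rw [integral_sub hint2 (integrable_const _), e1]; simp
    rw [e2, ← eLpNorm_two_sq]
    gcongr
    refine (enorm_integral_le_lintegral_enorm _).trans ?_
    rw [← eLpNorm_one_eq_lintegral_enorm]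
    exact eLpNorm_le_eLpNorm_of_exponent_le (by norm_num) (hint2.1.sub aestronglyMeasurable_const)
  have hFmeas := hFm.measurable
  have : eLpNorm (fun x => mollify b s F x - F x) 2 volume ^ 2 ≤ η ^ 2 := by
    rw [eLpNorm_two_sq]
    calc ∫⁻ x, ‖mollify b s F x - F x‖ₑ ^ 2
        ≤ ∫⁻ x, ∫⁻ v, ‖F (squeeze s x - v) - F x‖ₑ ^ 2 ∂ν := lintegral_mono key
      _ = ∫⁻ v, ∫⁻ x, ‖F (squeeze s x - v) - F x‖ₑ ^ 2 ∂volume ∂ν := by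
          refine lintegral_lintegral_swap (Measurable.aemeasurable ?_)
          have m1 : Measurable fun p : (ℝ × ℝ) × (ℝ × ℝ) => squeeze s p.1 - p.2 :=
            ((squeeze s).continuous.measurable.comp measurable_fst).sub measurable_snd
          exact (((hFmeas.comp m1).sub (hFmeas.comp measurable_fst)).enorm).pow_const 2
      _ ≤ ∫⁻ v, η ^ 2 ∂ν := by
          refine lintegral_mono_ae ?_
          rw [ae_withDensity_iff hmeas]
          refine Eventually.of_forall fun v hv => ?_
          rw [← eLpNorm_two_sq]
          gcongr
          refine hη v ?_
          have : v ∈ Function.support ρ := fun h0 => hv (by simp [h0])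
          rw [hρ, b.support_normed_eq] at this
          simpa using (Metric.ball_subset_closedBall this)
      _ = η ^ 2 := by simp
  exact (ENNReal.pow_le_pow_left_iff (by norm_num)).1 this

lemma tendsto_mollify {b : ℕ → ContDiffBump (0 : ℝ × ℝ)} {s : ℕ → ℝ}
    (hb : Tendsto (fun n => (b n).rOut) atTop (𝓝 0)) (hs : Tendsto s atTop (𝓝 0))
    {F : ℝ × ℝ → ℝ} (hF : MemLp F 2 volume) (hFm : StronglyMeasurable F) :
    Tendsto (fun n => eLpNorm (fun x => mollify (b n) (s n) F x - F x) 2 volume) atTop (𝓝 0) := by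
  rw [ENNReal.tendsto_nhds_zero]
  intro η hη
  have h := ENNReal.tendsto_nhds_zero.1 (tendsto_eLpNorm_squeeze_sub hF) η hη
  rw [Metric.eventually_nhds_iff] at h
  obtain ⟨r, hr, h⟩ := h
  filter_upwards [hb.eventually (gt_mem_nhds hr), hs.eventually (Metric.ball_mem_nhds 0 hr)]
    with n h1 h2
  refine eLpNorm_mollify_sub_le _ _ hF hFm fun v hv => h (y := (s n, v)) ?_
  rw [dist_zero_right, Prod.norm_def, max_lt_iff]
  exact ⟨by simpa using h2, hv.trans_lt h1⟩

/-- Strong measurability on the whole plane is needed for Tonelli, and vanishing off Ω makes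
integrals over the plane and over Ω interchangeable. -/
lemma exists_extension {Ω : Set (ℝ × ℝ)} (hΩ : MeasurableSet Ω) {f : ℝ × ℝ → ℝ} (hf : MemL2 Ω f) :
    ∃ F : ℝ × ℝ → ℝ, StronglyMeasurable F ∧ MemLp F 2 volume ∧ F =ᵐ[volume.restrict Ω] f ∧
      ∀ x ∉ Ω, F x = 0 := by
  have h1 : Ω.indicator (hf.1.mk f) =ᵐ[volume.restrict Ω] f := by
    filter_upwards [hf.1.ae_eq_mk, ae_restrict_mem hΩ] with x hx hx2
    rw [indicator_of_mem hx2, hx]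
  refine ⟨Ω.indicator (hf.1.mk f), hf.1.stronglyMeasurable_mk.indicator hΩ, ?_, h1,
    fun x hx => indicator_of_notMem hx _⟩
  rw [memLp_indicator_iff_restrict hΩ]
  exact hf.ae_eq hf.1.ae_eq_mk

lemma integral_extension {Ω : Set (ℝ × ℝ)} {f F : ℝ × ℝ → ℝ}
    (h : F =ᵐ[volume.restrict Ω] f) (h0 : ∀ x ∉ Ω, F x = 0) (k : ℝ × ℝ → ℝ) :
    ∫ x, F x * k x = ∫ x in Ω, f x * k x := by
  rw [← setIntegral_eq_integral_of_forall_compl_eq_zero (s := Ω)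
    (fun x hx => by rw [h0 x hx, zero_mul])]
  exact integral_congr_ae (h.mono fun x hx => by simp only [hx])

/-- Absorbs the chain-rule factors e^{∓s} produced by composing a mollification with `squeeze s`. -/
lemma tendsto_nrm_mul_sub {X : Type*} [MeasurableSpace X] {μ : Measure X} {f : X → ℝ}
    {F : ℕ → X → ℝ} (hF : ∀ n, MemLp (F n) 2 μ) (hf : MemLp f 2 μ)
    (h : Tendsto (fun n => nrm μ fun x => F n x - f x) atTop (𝓝 0)) {c : ℕ → ℝ}
    (hc : Tendsto c atTop (𝓝 1)) :
    Tendsto (fun n => nrm μ fun x => c n * F n x - f x) atTop (𝓝 0) := by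
  have h1 : Tendsto (fun n => |c n| * nrm μ (fun x => F n x - f x) + |c n - 1| * nrm μ f)
      atTop (𝓝 (|1| * 0 + |1 - 1| * nrm μ f)) :=
    (hc.abs.mul h).add (((hc.sub_const 1).abs).mul_const _)
  simp only [mul_zero, sub_self, abs_zero, zero_mul, add_zero] at h1
  refine squeeze_zero (fun n => nrm_nonneg _ _) (fun n => ?_) h1
  rw [← nrm_const_mul, ← nrm_const_mul]
  refine le_trans (le_of_eq ?_)
    (nrm_add_le (((hF n).sub hf).const_mul (c n)) (hf.const_mul (c n - 1)))
  congr 1; ext x; ring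

/-- A function of zero lateral trace is a limit of smooth functions vanishing outside the strip. -/
theorem HasLat.exists_approx {l : ℝ} (hl : 0 < l) {f g₀ g₁ : ℝ × ℝ → ℝ} (h : HasLat l f g₀ g₁) :
    ∃ ψ : ℕ → ℝ × ℝ → ℝ, (∀ n, ContDiff ℝ ∞ (ψ n)) ∧ (∀ n x, l / 2 ≤ |x.1| → ψ n x = 0) ∧
      Tendsto (fun n => nrm (volume.restrict (plate l 1)) fun x => ψ n x - f x) atTop (𝓝 0) ∧
      Tendsto (fun n => nrm (volume.restrict (plate l 1))
        fun x => fderiv ℝ (ψ n) x (1, 0) - g₀ x) atTop (𝓝 0) ∧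
      Tendsto (fun n => nrm (volume.restrict (plate l 1))
        fun x => fderiv ℝ (ψ n) x (0, 1) - g₁ x) atTop (𝓝 0) := by
  set μ := (volume.restrict (plate l 1) : Measure (ℝ × ℝ)) with hμ
  obtain ⟨F, hFm, hF2, hFf, hF0⟩ := exists_extension (measurableSet_plate l 1) h.mem
  obtain ⟨G₀, hG₀m, hG₀2, hG₀f, hG₀0⟩ := exists_extension (measurableSet_plate l 1) h.mem₀
  obtain ⟨G₁, hG₁m, hG₁2, hG₁f, hG₁0⟩ := exists_extension (measurableSet_plate l 1) h.mem₁
  have loc : ∀ {H : ℝ × ℝ → ℝ}, MemLp H 2 volume → LocallyIntegrable H :=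
    fun hH => hH.locallyIntegrable (by norm_num)
  -- Negative s: the sampling point `squeeze s x` is pushed outward in x₁ and inward in x₂.
  let s : ℕ → ℝ := fun n => -(1 / ((n : ℝ) + 1))
  have hs0 : Tendsto s atTop (𝓝 0) := by
    simpa [s] using (tendsto_one_div_add_atTop_nhds_zero_nat (𝕜 := ℝ)).neg
  have hsneg : ∀ n, s n < 0 := fun n => by simp only [s]; rw [neg_lt_zero]; positivity
  have he1 : ∀ n, Real.exp (s n) < 1 := fun n => by simpa using hsneg n
  have he2 : ∀ n, 1 < Real.exp (-s n) := fun n => Real.one_lt_exp_iff.2 (by linarith [hsneg n])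
  -- The mollification radius tends to zero and is smaller than both displacements: the outward one
  -- at |x₁| = l/2 and the inward one at |x₂| = 1/2.
  let δ : ℕ → ℝ := fun n => min (1 / ((n : ℝ) + 1))
    (min ((1 - Real.exp (s n)) / 4) ((Real.exp (-s n) - 1) * l / 4))
  have hδ : ∀ n, 0 < δ n := fun n => lt_min (by positivity)
    (lt_min (by linarith [he1 n]) (div_pos (mul_pos (by linarith [he2 n]) hl) (by norm_num)))
  let b : ℕ → ContDiffBump (0 : ℝ × ℝ) := fun n =>
    { rIn := δ n / 2, rOut := δ n, rIn_pos := half_pos (hδ n), rIn_lt_rOut := half_lt_self (hδ n) }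
  have hb : Tendsto (fun n => (b n).rOut) atTop (𝓝 0) :=
    squeeze_zero (fun n => (hδ n).le) (fun n => min_le_left _ _)
      tendsto_one_div_add_atTop_nhds_zero_nat
  have hsm : ∀ n {H : ℝ × ℝ → ℝ}, MemLp H 2 volume → ContDiff ℝ ∞ (mollify (b n) (s n) H) :=
    fun n H hH => contDiff_mollify _ _ (loc hH)
  have conv : ∀ {H h : ℝ × ℝ → ℝ}, MemLp H 2 volume → StronglyMeasurable H → H =ᵐ[μ] h →
      Tendsto (fun n => nrm μ fun x => mollify (b n) (s n) H x - h x) atTop (𝓝 0) := by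
    intro H h hH hHm hHh
    have h1 := tendsto_mollify hb hs0 hH hHm
    have h2 : Tendsto (fun n => eLpNorm (fun x => mollify (b n) (s n) H x - H x) 2 μ)
        atTop (𝓝 0) :=
      tendsto_of_tendsto_of_tendsto_of_le_of_le tendsto_const_nhds h1 (fun _ => zero_le)
        (fun n => eLpNorm_mono_measure _ Measure.restrict_le_self)
    have h3 := (tendsto_nrm_iff (F := fun n x => mollify (b n) (s n) H x - H x) (fun n =>
      (memLp_of_continuous l 1 (hsm n hH).continuous 2).sub (hH.restrict _))).2 h2
    refine h3.congr fun n => nrm_congr ?_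
    filter_upwards [hHh] with x hx
    rw [hx]
  have hder : ∀ n x v, fderiv ℝ (mollify (b n) (s n) F) x v =
      - ∫ t in plate l 1, f t *
        fderiv ℝ (fun t => (b n).normed volume (squeeze (s n) x - t)) t (squeeze (s n) v) :=
    fun n x v => by
      rw [fderiv_mollify _ _ (loc hF2), integral_extension hFf hF0]
  have hker : ∀ n (x : ℝ × ℝ), ContDiff ℝ ∞ fun t => (b n).normed volume (squeeze (s n) x - t) :=
    fun n x => (b n).contDiff_normed.comp (contDiff_const.sub contDiff_id)
  have hker2 : ∀ n (x : ℝ × ℝ), tsupport (fun t => (b n).normed volume (squeeze (s n) x - t)) ⊆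
      Metric.closedBall (squeeze (s n) x) (δ n) := by
    intro n x
    refine closure_minimal (fun t ht => ?_) Metric.isClosed_closedBall
    have h1 : squeeze (s n) x - t ∈ Function.support ((b n).normed volume) := ht
    rw [(b n).support_normed_eq, mem_ball_zero_iff] at h1
    rw [mem_closedBall_iff_norm']
    exact h1.le
  have hsq : ∀ n x, x ∈ plate l 1 → ∀ t ∈ Metric.closedBall (squeeze (s n) x) (δ n),
      t.2 ∈ Ioo (-1 / 2 : ℝ) (1 / 2) := by
    intro n x hx t ht
    rw [mem_closedBall_iff_norm, Prod.norm_def] at ht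
    have h1 := (le_max_right _ _).trans ht
    simp only [squeeze_apply, Prod.snd_sub, Real.norm_eq_abs] at h1
    have h2 : δ n ≤ (1 - Real.exp (s n)) / 4 := (min_le_right _ _).trans (min_le_left _ _)
    have h3 : |Real.exp (s n) * x.2| ≤ Real.exp (s n) * (1 / 2) := by
      rw [abs_mul, abs_of_pos (Real.exp_pos _)]
      refine mul_le_mul_of_nonneg_left ?_ (Real.exp_pos _).le
      rw [abs_le]; have := hx.2; constructor <;> linarith [this.1, this.2]
    rw [abs_le] at h1 h3
    constructor <;> linarith [he1 n]
  refine ⟨fun n => mollify (b n) (s n) F, fun n => hsm n hF2, fun n x hx => ?_,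
    conv hF2 hFm hFf, ?_, ?_⟩
  -- For |x₁| ≥ l/2 the first coordinate of the sampling point lies beyond the support of F by at
  -- least the radius, so the kernel misses the plate.
  · change ∫ t, F t * (b n).normed volume (squeeze (s n) x - t) = 0
    refine integral_eq_zero_of_ae (Eventually.of_forall fun t => ?_)
    by_cases ht : t ∈ plate l 1
    · have : squeeze (s n) x - t ∉ Function.support ((b n).normed volume) := by
        rw [(b n).support_normed_eq, mem_ball_zero_iff, Prod.norm_def, not_lt]
        refine le_trans ?_ (le_max_left _ _)
        simp only [squeeze_apply, Prod.fst_sub, Real.norm_eq_abs]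
        have h1 : δ n ≤ (Real.exp (-s n) - 1) * l / 4 := (min_le_right _ _).trans (min_le_right _ _)
        have h2 : Real.exp (-s n) * (l / 2) ≤ |Real.exp (-s n) * x.1| := by
          rw [abs_mul, abs_of_pos (Real.exp_pos _)]
          exact mul_le_mul_of_nonneg_left hx (Real.exp_pos _).le
        have h3 : |t.1| ≤ l / 2 := by
          rw [abs_le]; have := ht.1; constructor <;> linarith [this.1, this.2]
        have h4 := abs_sub_abs_le_abs_sub (Real.exp (-s n) * x.1) t.1
        have h5 : 0 ≤ (Real.exp (-s n) - 1) * l := mul_nonneg (by linarith [he2 n]) hl.le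
        change δ n ≤ _
        nlinarith
      exact mul_eq_zero_of_right _ (Function.notMem_support.1 this)
    · simp [hF0 t ht]
  · have hc : Tendsto (fun n => Real.exp (-s n)) atTop (𝓝 1) := by
      have := (Real.continuous_exp.tendsto 0).comp (by simpa using hs0.neg : Tendsto (fun n => -s n) atTop (𝓝 0))
      simpa [Function.comp_def] using this
    refine (tendsto_nrm_mul_sub (fun n => memLp_of_continuous l 1 (hsm n hG₀2).continuous 2)
      h.mem₀ (conv hG₀2 hG₀m hG₀f) hc).congr fun n => ?_
    congr 1; ext x; congr 1
    have e : squeeze (s n) (1, 0) = Real.exp (-s n) • (1, 0) := by simp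
    rw [hder, e]
    simp only [map_smul, smul_eq_mul]
    simp_rw [mul_left_comm (f _)]
    -- The kernel may reach across the lateral sides, and near x₂ = ±1/2 as well; the trace identity
    -- accepts every smooth test function.
    rw [integral_const_mul, h.deriv₀ _ (hker n x), mollify, integral_extension hG₀f hG₀0]
    ring
  · have hc : Tendsto (fun n => Real.exp (s n)) atTop (𝓝 1) := by
      have := (Real.continuous_exp.tendsto 0).comp hs0
      simpa [Function.comp_def] using this
    refine (tendsto_nrm_mul_sub (fun n => memLp_of_continuous l 1 (hsm n hG₁2).continuous 2)
      h.mem₁ (conv hG₁2 hG₁m hG₁f) hc).congr fun n => nrm_congr ?_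
    filter_upwards [ae_restrict_mem (measurableSet_plate l 1)] with x hx
    congr 1
    have e : squeeze (s n) (0, 1) = Real.exp (s n) • (0, 1) := by simp
    rw [hder, e]
    simp only [map_smul, smul_eq_mul]
    simp_rw [mul_left_comm (f _)]
    -- For x in the plate the inward shift keeps the support of the kernel away from x₂ = ±1/2,
    -- which is all that is required in this direction.
    rw [integral_const_mul, integral_deriv_snd hl h.mem h.mem₁ h.deriv₁ (hker n x)
      (fun t ht => ⟨mem_univ _, hsq n x hx t (hker2 n x ht)⟩), mollify,
      integral_extension hG₁f hG₁0]
    ring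

/-! ## Integration by parts on rectangles -/

lemma integral_div_rect {F G : ℝ × ℝ → ℝ} (hF : ContDiff ℝ 1 F) (hG : ContDiff ℝ 1 G)
    {a₁ b₁ a₂ b₂ : ℝ} (h₁ : a₁ ≤ b₁) (h₂ : a₂ ≤ b₂) :
    ∫ x in Ioo a₁ b₁ ×ˢ Ioo a₂ b₂, (fderiv ℝ F x (1, 0) + fderiv ℝ G x (0, 1)) =
      (((∫ x in a₁..b₁, G (x, b₂)) - ∫ x in a₁..b₁, G (x, a₂)) + ∫ y in a₂..b₂, F (b₁, y)) -
        ∫ y in a₂..b₂, F (a₁, y) := by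
  have hc : Continuous fun x => fderiv ℝ F x (1, 0) + fderiv ℝ G x (0, 1) :=
    ((hF.continuous_fderiv (by simp)).clm_apply continuous_const).add
      ((hG.continuous_fderiv (by simp)).clm_apply continuous_const)
  have h := integral_divergence_prod_Icc_of_hasFDerivAt_of_le F G (fderiv ℝ F) (fderiv ℝ G)
    (a₁, a₂) (b₁, b₂) ⟨h₁, h₂⟩ hF.continuous.continuousOn hG.continuous.continuousOn
    (fun x _ => (hF.differentiable (by simp) x).hasFDerivAt)
    (fun x _ => (hG.differentiable (by simp) x).hasFDerivAt)
    (hc.continuousOn.integrableOn_compact isCompact_Icc)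
  rw [← h]
  refine setIntegral_congr_set ?_
  rw [← Icc_prod_Icc, Measure.volume_eq_prod]
  exact Measure.set_prod_ae_eq Ioo_ae_eq_Icc Ioo_ae_eq_Icc

lemma integral_fderiv_fst_plate {l ε : ℝ} (hl : 0 ≤ l) (hε : 0 ≤ ε) {F : ℝ × ℝ → ℝ}
    (hF : ContDiff ℝ 1 F) :
    ∫ x in plate l ε, fderiv ℝ F x (1, 0) =
      (∫ y in Ioo (-ε / 2) (ε / 2), F (l / 2, y)) - ∫ y in Ioo (-ε / 2) (ε / 2), F (-l / 2, y) := by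
  have h := integral_div_rect hF (contDiff_const (c := (0 : ℝ))) (by linarith : -l / 2 ≤ l / 2)
    (by linarith : -ε / 2 ≤ ε / 2)
  simp only [fderiv_fun_const, Pi.zero_apply, zero_apply, add_zero,
    intervalIntegral.integral_zero, sub_zero, zero_add] at h
  rw [plate, h, intervalIntegral.integral_of_le (by linarith),
    intervalIntegral.integral_of_le (by linarith), integral_Ioc_eq_integral_Ioo,
    integral_Ioc_eq_integral_Ioo]

lemma memLp_slice {φ : ℝ × ℝ → ℝ} (hφ : Continuous φ) (s ε : ℝ) :
    MemLp (fun t => φ (s, t)) 2 (volume.restrict (Ioo (-ε / 2) (ε / 2))) :=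
  memLp_of_continuous_interval ε (hφ.comp (by fun_prop : Continuous fun t => (s, t))) 2

/-- Functions of zero lateral trace satisfy the integration by parts formula in direction `x₁`
for all smooth test functions. -/
lemma ZeroLateralTrace.integral_mul_fderiv {l ε : ℝ} (hl : 0 < l) (hε : 0 < ε) {f : ℝ × ℝ → ℝ}
    (hf : MemW12 (plate l ε) f) (h : ZeroLateralTrace l ε f) {φ : ℝ × ℝ → ℝ}
    (hφ : ContDiff ℝ ∞ φ) :
    ∫ x in plate l ε, f x * fderiv ℝ φ x (1, 0) = - ∫ x in plate l ε, pd (plate l ε) 0 f x * φ x := by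
  obtain ⟨ψ, hψ, h0, h1, htr⟩ := h
  have hpd : MemL2 (plate l ε) (pd (plate l ε) 0 f) := by
    obtain ⟨g, hg, hg2⟩ := hf.2 0
    exact (memLp_congr_ae (hg.weakDeriv_ae_eq (isOpen_plate l ε))).2 hg2
  have mψ : ∀ n, MemLp (ψ n) 2 (volume.restrict (plate l ε)) :=
    fun n => memLp_of_continuous l ε (hψ n).continuous 2
  have mdψ : ∀ n, MemLp (fun x => fderiv ℝ (ψ n) x (1, 0)) 2 (volume.restrict (plate l ε)) :=
    fun n => memLp_of_continuous l ε (continuous_fderivApply (hψ n) _) 2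
  have mφ := memLp_of_continuous l ε hφ.continuous 2
  have mdφ := memLp_of_continuous l ε (continuous_fderivApply hφ (1, 0)) 2
  have c0 := tendsto_integral_mul_of_nrm mψ hf.1
    ((tendsto_nrm_iff fun n => (mψ n).sub hf.1).2 h0) mdφ
  have c1 := tendsto_integral_mul_of_nrm mdψ hpd
    ((tendsto_nrm_iff fun n => (mdψ n).sub hpd).2 (h1 0)) mφ
  have hb : ∀ s ∈ ({-l / 2, l / 2} : Set ℝ),
      Tendsto (fun n => ∫ t in Ioo (-ε / 2) (ε / 2), ψ n (s, t) * φ (s, t)) atTop (𝓝 0) := by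
    intro s hs
    have := tendsto_integral_mul_of_nrm (fun n => memLp_slice (hψ n).continuous s ε)
      (f := fun _ => 0) (memLp_const 0)
      (by simpa using (tendsto_nrm_iff fun n => memLp_slice (hψ n).continuous s ε).2 (htr s hs))
      (memLp_slice hφ.continuous s ε)
    simpa using this
  have hibp : ∀ n, (∫ x in plate l ε, fderiv ℝ (ψ n) x (1, 0) * φ x) +
      ∫ x in plate l ε, ψ n x * fderiv ℝ φ x (1, 0) =
      (∫ t in Ioo (-ε / 2) (ε / 2), ψ n (l / 2, t) * φ (l / 2, t)) -
        ∫ t in Ioo (-ε / 2) (ε / 2), ψ n (-l / 2, t) * φ (-l / 2, t) := by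
    intro n
    rw [← integral_fderiv_fst_plate hl.le hε.le (F := fun x => ψ n x * φ x)
      (((hψ n).mul hφ).of_le (by simp)), ← integral_add (integrable_mul_of_memLp (mdψ n) mφ)
      (integrable_mul_of_memLp (mψ n) mdφ)]
    refine integral_congr_ae (Eventually.of_forall fun x => ?_)
    simp only [fderiv_mul_apply (hψ n) hφ]
  have hlim := tendsto_nhds_unique ((c1.add c0).congr hibp)
    ((hb (l / 2) (by simp)).sub (hb (-l / 2) (by simp)))
  linarith

lemma HasLat.hasWeakDeriv₀ {l : ℝ} {f g₀ g₁ : ℝ × ℝ → ℝ} (h : HasLat l f g₀ g₁) :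
    HasWeakDeriv (plate l 1) (dir 0) f g₀ :=
  ⟨h.mem.locallyIntegrableOn, h.mem₀.locallyIntegrableOn, fun φ hφ _ _ => h.deriv₀ φ hφ⟩

lemma HasLat.pd_zero {l : ℝ} {f g₀ g₁ : ℝ × ℝ → ℝ} (h : HasLat l f g₀ g₁) :
    pd (plate l 1) 0 f =ᵐ[volume.restrict (plate l 1)] g₀ :=
  h.hasWeakDeriv₀.weakDeriv_ae_eq (isOpen_plate l 1)

lemma HasLat.pd_one {l : ℝ} {f g₀ g₁ : ℝ × ℝ → ℝ} (h : HasLat l f g₀ g₁) :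
    pd (plate l 1) 1 f =ᵐ[volume.restrict (plate l 1)] g₁ :=
  h.deriv₁.weakDeriv_ae_eq (isOpen_plate l 1)

/-- The approximating functions vanish identically on the lateral sides, so their boundary norms are
zero and not merely small. -/
lemma HasLat.zeroLateralTrace {l : ℝ} (hl : 0 < l) {f g₀ g₁ : ℝ × ℝ → ℝ} (h : HasLat l f g₀ g₁) :
    ZeroLateralTrace l 1 f := by
  obtain ⟨ψ, hψ, h0, c, c0, c1⟩ := h.exists_approx hl
  have mψ : ∀ n, MemLp (ψ n) 2 (volume.restrict (plate l 1)) :=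
    fun n => memLp_of_continuous l 1 (hψ n).continuous 2
  have mdψ : ∀ v n, MemLp (fun x => fderiv ℝ (ψ n) x v) 2 (volume.restrict (plate l 1)) :=
    fun v n => memLp_of_continuous l 1 (continuous_fderivApply (hψ n) _) 2
  refine ⟨ψ, hψ, (tendsto_nrm_iff fun n => (mψ n).sub h.mem).1 c, fun i => ?_, fun s hs => ?_⟩
  · fin_cases i
    · refine ((tendsto_nrm_iff fun n => (mdψ _ n).sub h.mem₀).1 c0).congr fun n => ?_
      refine eLpNorm_congr_ae (h.pd_zero.mono fun x hx => ?_)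
      simp [hx, dir]
    · refine ((tendsto_nrm_iff fun n => (mdψ _ n).sub h.mem₁).1 c1).congr fun n => ?_
      refine eLpNorm_congr_ae (h.pd_one.mono fun x hx => ?_)
      simp [hx, dir]
  · refine tendsto_const_nhds.congr fun n => ?_
    have : (fun t => ψ n (s, t)) = 0 := by
      ext t
      refine h0 n (s, t) ?_
      rcases hs with rfl | rfl
      · simp only [neg_div, abs_neg]; exact le_abs_self _
      · exact le_abs_self _
    rw [this]; simp

/-! ## Poincaré and Ladyzhenskaya inequalities -/

lemma nrm_le_of_sq_le_mul {a b : ℝ} (ha : 0 ≤ a) (hb : 0 ≤ b) (h : a ^ 2 ≤ b * a) : a ≤ b := by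
  rcases ha.eq_or_lt with rfl | h0
  · exact hb
  · nlinarith

/-- Integrate ∂₁(x₁ψ²) = ψ² + 2 x₁ψ∂₁ψ over the plate: the boundary terms vanish, and |x₁| ≤ l/2
with Cauchy–Schwarz gives the constant l. -/
lemma poincare_smooth {l : ℝ} (hl : 0 < l) {ψ : ℝ × ℝ → ℝ} (hψ : ContDiff ℝ ∞ ψ)
    (h0 : ∀ x, l / 2 ≤ |x.1| → ψ x = 0) :
    nrm (volume.restrict (plate l 1)) ψ ≤
      l * nrm (volume.restrict (plate l 1)) fun x => fderiv ℝ ψ x (1, 0) := by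
  set μ := (volume.restrict (plate l 1) : Measure (ℝ × ℝ)) with hμ
  have mψ : MemLp ψ 2 μ := memLp_of_continuous l 1 hψ.continuous 2
  have mdψ : MemLp (fun x => fderiv ℝ ψ x (1, 0)) 2 μ :=
    memLp_of_continuous l 1 (continuous_fderivApply hψ _) 2
  have mx : MemLp (fun x : ℝ × ℝ => x.1 * fderiv ℝ ψ x (1, 0)) 2 μ :=
    memLp_of_continuous l 1 (continuous_fst.mul (continuous_fderivApply hψ _)) 2
  have e := integral_fderiv_fst_plate hl.le zero_le_one (F := fun x => x.1 * (ψ x * ψ x))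
    ((contDiff_fst.mul (hψ.mul hψ)).of_le (by simp))
  have z1 : ∀ y, ψ (l / 2, y) = 0 := fun y => h0 _ (le_abs_self _)
  have z2 : ∀ y, ψ (-l / 2, y) = 0 := fun y => h0 _ (by simp only [neg_div, abs_neg]; exact le_abs_self _)
  simp only [z1, z2, mul_zero, integral_zero, sub_zero] at e
  have e2 : ∀ x, fderiv ℝ (fun x : ℝ × ℝ => x.1 * (ψ x * ψ x)) x (1, 0) =
      ψ x ^ 2 + 2 * (ψ x * (x.1 * fderiv ℝ ψ x (1, 0))) := fun x => by
    rw [fderiv_mul_apply contDiff_fst (hψ.mul hψ), fderiv_mul_apply hψ hψ]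
    simp only [fderiv_fst, ContinuousLinearMap.coe_fst']; ring
  simp only [e2] at e
  rw [integral_add mψ.integrable_sq ((integrable_mul_of_memLp mψ mx).const_mul 2),
    integral_const_mul, ← nrm_sq mψ] at e
  have h1 := abs_integral_mul_le mψ mx
  have h2 : nrm μ (fun x : ℝ × ℝ => x.1 * fderiv ℝ ψ x (1, 0)) ≤
      l / 2 * nrm μ fun x => fderiv ℝ ψ x (1, 0) := by
    rw [← abs_of_pos (half_pos hl), ← nrm_const_mul]
    refine nrm_mono (mdψ.const_mul _) ?_
    rw [hμ, ae_restrict_iff' (measurableSet_plate l 1)]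
    refine Eventually.of_forall fun x hx => ?_
    rw [abs_mul, abs_mul]
    refine mul_le_mul_of_nonneg_right ?_ (abs_nonneg _)
    rw [abs_of_pos (half_pos hl), abs_le]
    have := hx.1; constructor <;> linarith [this.1, this.2]
  refine nrm_le_of_sq_le_mul (nrm_nonneg _ _) (mul_nonneg hl.le (nrm_nonneg _ _)) ?_
  have h3 := mul_le_mul_of_nonneg_left h2 (nrm_nonneg μ ψ)
  have h4 := (abs_le.1 h1).1
  nlinarith

lemma abs_sub_le_integral_deriv {g : ℝ → ℝ} (hg : ContDiff ℝ 1 g) {a b s t : ℝ}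
    (hs : s ∈ Icc a b) (ht : t ∈ Icc a b) : |g s - g t| ≤ ∫ x in Ioo a b, |deriv g x| := by
  have hc : Continuous (deriv g) := hg.continuous_deriv (by simp)
  rw [← intervalIntegral.integral_deriv_eq_sub (fun x _ => hg.differentiable (by simp) x)
    (hc.intervalIntegrable _ _), ← Real.norm_eq_abs]
  refine (intervalIntegral.norm_integral_le_integral_norm_uIoc).trans ?_
  rw [← integral_Ioc_eq_integral_Ioo]
  refine setIntegral_mono_set ?_ (Eventually.of_forall fun x => abs_nonneg _)
    (LE.le.eventuallyLE (Ioc_subset_Ioc (le_min ht.1 hs.1) (max_le ht.2 hs.2)))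
  exact (hc.abs.continuousOn.integrableOn_compact isCompact_Icc).mono_set Ioc_subset_Icc_self

lemma deriv_slice_fst {ψ : ℝ × ℝ → ℝ} (hψ : ContDiff ℝ 1 ψ) (s t : ℝ) :
    deriv (fun s => ψ (s, t)) s = fderiv ℝ ψ (s, t) (1, 0) := by
  have h : HasDerivAt (fun s : ℝ => (s, t)) ((1 : ℝ), (0 : ℝ)) s :=
    (hasDerivAt_id s).prodMk (hasDerivAt_const s t)
  exact ((hψ.differentiable (by simp) (s, t)).hasFDerivAt.comp_hasDerivAt s h).deriv

lemma deriv_slice_snd {ψ : ℝ × ℝ → ℝ} (hψ : ContDiff ℝ 1 ψ) (s t : ℝ) :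
    deriv (fun t => ψ (s, t)) t = fderiv ℝ ψ (s, t) (0, 1) := by
  have h : HasDerivAt (fun t : ℝ => (s, t)) ((0 : ℝ), (1 : ℝ)) t :=
    (hasDerivAt_const t s).prodMk (hasDerivAt_id t)
  exact ((hψ.differentiable (by simp) (s, t)).hasFDerivAt.comp_hasDerivAt t h).deriv

/-- Two one-dimensional bounds are multiplied. Since ψ vanishes at x₁ = l/2, ψ² ≤ B(x₂), the
integral of |∂₁(ψ²)| along x₁. Along x₂ there is no boundary condition, so ψ² is bounded by its mean
over the cross section plus its variation, which gives ψ² ≤ A(x₁). Hence ∫ ψ⁴ ≤ ∫ A(x₁) B(x₂), which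
factorises. The asymmetric form of the right-hand side matters: it is n₀² times a bound linear in n₀
+ 2n₂ and in n₁. -/
lemma ladyzhenskaya_smooth {l : ℝ} (hl : 0 < l) {ψ : ℝ × ℝ → ℝ} (hψ : ContDiff ℝ ∞ ψ)
    (h0 : ∀ x, l / 2 ≤ |x.1| → ψ x = 0) {n₀ n₁ n₂ : ℝ}
    (hn₀ : nrm (volume.restrict (plate l 1)) ψ = n₀)
    (hn₁ : nrm (volume.restrict (plate l 1)) (fun x => fderiv ℝ ψ x (1, 0)) = n₁)
    (hn₂ : nrm (volume.restrict (plate l 1)) (fun x => fderiv ℝ ψ x (0, 1)) = n₂) :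
    nrm (volume.restrict (plate l 1)) (fun x => ψ x ^ 2) ^ 2 ≤
      (n₀ ^ 2 + 2 * (n₀ * n₂)) * (2 * (n₀ * n₁)) := by
  set μ := (volume.restrict (plate l 1) : Measure (ℝ × ℝ)) with hμ
  have hψ1 : ContDiff ℝ 1 ψ := hψ.of_le (by simp)
  have hc := hψ.continuous
  have hc1 := continuous_fderivApply hψ (1, 0)
  have hc2 := continuous_fderivApply hψ (0, 1)
  have mψ : MemLp ψ 2 μ := memLp_of_continuous l 1 hc 2
  have m1 : MemLp (fun x => fderiv ℝ ψ x (1, 0)) 2 μ := memLp_of_continuous l 1 hc1 2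
  have m2 : MemLp (fun x => fderiv ℝ ψ x (0, 1)) 2 μ := memLp_of_continuous l 1 hc2 2
  let α : ℝ × ℝ → ℝ := fun x => ψ x ^ 2 + 2 * |ψ x * fderiv ℝ ψ x (0, 1)|
  let β : ℝ × ℝ → ℝ := fun x => 2 * |ψ x * fderiv ℝ ψ x (1, 0)|
  have hα : Continuous α := by fun_prop
  have hβ : Continuous β := by fun_prop
  have iα : Integrable α μ := (memLp_of_continuous l 1 hα 2).integrable (by norm_num)
  have iβ : Integrable β μ := (memLp_of_continuous l 1 hβ 2).integrable (by norm_num)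
  let A : ℝ → ℝ := fun s => ∫ t in Ioo (-1 / 2 : ℝ) (1 / 2), α (s, t)
  let B : ℝ → ℝ := fun t => ∫ s in interval l, β (s, t)
  have hIα : ∫ x, α x ∂μ = ∫ s in interval l, A s := by
    rw [hμ, restrict_plate] at iα ⊢
    exact integral_prod _ iα
  have hIβ : ∫ x, β x ∂μ = ∫ t in Ioo (-1 / 2 : ℝ) (1 / 2), B t := by
    rw [hμ, restrict_plate] at iβ ⊢
    exact integral_prod_symm _ iβ
  have hiA : Integrable A (volume.restrict (interval l)) := by
    rw [hμ, restrict_plate] at iα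
    exact iα.integral_prod_left
  have hiB : Integrable B (volume.restrict (Ioo (-1 / 2 : ℝ) (1 / 2))) := by
    rw [hμ, restrict_plate] at iβ
    exact iβ.integral_prod_right
  have hAβ : ∫ x, A x.1 * B x.2 ∂μ = (∫ x, α x ∂μ) * ∫ x, β x ∂μ := by
    rw [hIα, hIβ, hμ, restrict_plate]
    exact integral_prod_mul A B
  have hiAB : Integrable (fun x : ℝ × ℝ => A x.1 * B x.2) μ := by
    rw [hμ, restrict_plate]; exact hiA.mul_prod hiB
  have hsq1 : ∀ t, ContDiff ℝ 1 fun s => ψ (s, t) ^ 2 := fun t =>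
    (hψ1.comp (contDiff_id.prodMk contDiff_const)).pow 2
  have hsq2 : ∀ s, ContDiff ℝ 1 fun t => ψ (s, t) ^ 2 := fun s =>
    (hψ1.comp (contDiff_const.prodMk contDiff_id)).pow 2
  have d1 : ∀ s t, |deriv (fun s => ψ (s, t) ^ 2) s| = β (s, t) := fun s t => by
    have h : DifferentiableAt ℝ (fun s => ψ (s, t)) s :=
      (hψ1.comp (contDiff_id.prodMk contDiff_const)).differentiable (by simp) s
    rw [deriv_fun_pow h, deriv_slice_fst hψ1]
    simp [β, abs_mul, mul_assoc]
  have d2 : ∀ s t, |deriv (fun t => ψ (s, t) ^ 2) t| = 2 * |ψ (s, t) * fderiv ℝ ψ (s, t) (0, 1)| :=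
      fun s t => by
    have h : DifferentiableAt ℝ (fun t => ψ (s, t)) t :=
      (hψ1.comp (contDiff_const.prodMk contDiff_id)).differentiable (by simp) t
    rw [deriv_fun_pow h, deriv_slice_snd hψ1]
    simp [abs_mul, mul_assoc]
  have hB : ∀ x ∈ plate l 1, ψ x ^ 2 ≤ B x.2 := by
    intro x hx
    have h := abs_sub_le_integral_deriv (hsq1 x.2) (Ioo_subset_Icc_self hx.1)
      (right_mem_Icc.2 (by linarith : -l / 2 ≤ l / 2))
    simp only [d1] at h
    rw [h0 (l / 2, x.2) (le_abs_self _)] at h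
    simpa [B, interval] using h
  have hA : ∀ x ∈ plate l 1, ψ x ^ 2 ≤ A x.1 := by
    intro x hx
    have hcont1 : Continuous fun t => ψ (x.1, t) ^ 2 := (hsq2 x.1).continuous
    have hcont2 : Continuous fun t => 2 * |ψ (x.1, t) * fderiv ℝ ψ (x.1, t) (0, 1)| := by
      fun_prop
    have hi1 := (memLp_of_continuous_interval 1 hcont1 2).integrable (by norm_num)
    have hi2 := (memLp_of_continuous_interval 1 hcont2 2).integrable (by norm_num)
    have hcst : ∀ c : ℝ, ∫ _ in Ioo (-1 / 2 : ℝ) (1 / 2), c = c := fun c => by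
      simp; norm_num
    have : A x.1 = (∫ t in Ioo (-1 / 2 : ℝ) (1 / 2), ψ (x.1, t) ^ 2) +
        ∫ t in Ioo (-1 / 2 : ℝ) (1 / 2), 2 * |ψ (x.1, t) * fderiv ℝ ψ (x.1, t) (0, 1)| :=
      integral_add hi1 hi2
    rw [this, ← sub_le_iff_le_add, ← hcst (ψ x ^ 2 - _)]
    refine setIntegral_mono_on (integrable_const _) hi1 measurableSet_Ioo fun t ht => ?_
    have h := abs_sub_le_integral_deriv (hsq2 x.1) (Ioo_subset_Icc_self hx.2)
      (Ioo_subset_Icc_self ht)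
    simp only [d2] at h
    linarith [(abs_le.1 h).2]
  have m4 : MemLp (fun x => ψ x ^ 2) 2 μ := memLp_of_continuous l 1 (hc.pow 2) 2
  rw [nrm_sq m4]
  have i1 : ∫ x, (ψ x ^ 2) ^ 2 ∂μ ≤ ∫ x, A x.1 * B x.2 ∂μ := by
    refine integral_mono_ae m4.integrable_sq hiAB ?_
    rw [hμ, EventuallyLE, ae_restrict_iff' (measurableSet_plate l 1)]
    refine Eventually.of_forall fun x hx => ?_
    rw [sq (ψ x ^ 2)]
    exact mul_le_mul (hA x hx) (hB x hx) (by positivity) ((sq_nonneg _).trans (hA x hx))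
  refine i1.trans (hAβ.le.trans ?_)
  have habs : ∀ {k : ℝ × ℝ → ℝ}, MemLp k 2 μ → ∫ x, |ψ x * k x| ∂μ ≤ n₀ * nrm μ k := by
    intro k hk
    have := abs_integral_mul_le (mψ.abs) (hk.abs)
    have e : ∀ k : ℝ × ℝ → ℝ, nrm μ |k| = nrm μ k := fun k => by
      rw [nrm, nrm]; congr 1; exact eLpNorm_congr_norm_ae (by simp)
    rw [e, e, hn₀] at this
    simpa [abs_mul] using (le_abs_self _).trans this
  refine mul_le_mul ?_ ?_ (integral_nonneg fun x => by positivity) ?_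
  · have : ∫ x, α x ∂μ = ∫ x, ψ x ^ 2 ∂μ + ∫ x, 2 * |ψ x * fderiv ℝ ψ x (0, 1)| ∂μ :=
      integral_add mψ.integrable_sq ((integrable_mul_of_memLp mψ m2).abs.const_mul 2)
    rw [this, integral_const_mul, ← nrm_sq mψ, hn₀]
    have := habs m2
    rw [hn₂] at this
    linarith
  · simp only [β]
    rw [integral_const_mul]
    have := habs m1
    rw [hn₁] at this
    linarith
  · rw [← hn₀, ← hn₂]
    have := nrm_nonneg μ ψ
    have := nrm_nonneg μ (fun x => fderiv ℝ ψ x (0, 1))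
    positivity

/-- Poincaré's inequality for functions with zero lateral trace. -/
lemma HasLat.nrm_le {l : ℝ} (hl : 0 < l) {f g₀ g₁ : ℝ × ℝ → ℝ} (h : HasLat l f g₀ g₁) :
    nrm (volume.restrict (plate l 1)) f ≤ l * nrm (volume.restrict (plate l 1)) g₀ := by
  obtain ⟨ψ, hψ, h0, c, c0, c1⟩ := h.exists_approx hl
  exact le_of_tendsto_of_tendsto'
    (tendsto_nrm (fun n => memLp_of_continuous l 1 (hψ n).continuous 2) h.mem c)
    ((tendsto_nrm (fun n => memLp_of_continuous l 1 (continuous_fderivApply (hψ n) _) 2)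
      h.mem₀ c0).const_mul l) fun n => poincare_smooth hl (hψ n) (h0 n)

/-- Ladyzhenskaya's inequality for functions with zero lateral trace. -/
lemma HasLat.memL2_sq {l : ℝ} (hl : 0 < l) {f g₀ g₁ : ℝ × ℝ → ℝ} (h : HasLat l f g₀ g₁)
    {n₀ n₁ n₂ : ℝ} (hn₀ : nrm (volume.restrict (plate l 1)) f = n₀)
    (hn₁ : nrm (volume.restrict (plate l 1)) g₀ = n₁)
    (hn₂ : nrm (volume.restrict (plate l 1)) g₁ = n₂) :
    MemL2 (plate l 1) (fun x => f x ^ 2) ∧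
      nrm (volume.restrict (plate l 1)) (fun x => f x ^ 2) ^ 2 ≤
        (n₀ ^ 2 + 2 * (n₀ * n₂)) * (2 * (n₀ * n₁)) := by
  set μ := (volume.restrict (plate l 1) : Measure (ℝ × ℝ)) with hμ
  obtain ⟨ψ, hψ, h0, c, c0, c1⟩ := h.exists_approx hl
  have mψ : ∀ n, MemLp (ψ n) 2 μ := fun n => memLp_of_continuous l 1 (hψ n).continuous 2
  have m4 : ∀ n, MemLp (fun x => ψ n x ^ 2) 2 μ :=
    fun n => memLp_of_continuous l 1 ((hψ n).continuous.pow 2) 2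
  have t0 := tendsto_nrm mψ h.mem c
  have t1 := tendsto_nrm (fun n => memLp_of_continuous l 1 (continuous_fderivApply (hψ n) (1, 0)) 2)
    h.mem₀ c0
  have t2 := tendsto_nrm (fun n => memLp_of_continuous l 1 (continuous_fderivApply (hψ n) (0, 1)) 2)
    h.mem₁ c1
  rw [hn₀] at t0; rw [hn₁] at t1; rw [hn₂] at t2
  have tR := ((t0.pow 2).add ((t0.mul t2).const_mul 2)).mul ((t0.mul t1).const_mul 2)
  set R := (n₀ ^ 2 + 2 * (n₀ * n₂)) * (2 * (n₀ * n₁)) with hR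
  -- Convergence in L² does not control fourth powers. Along an almost everywhere convergent
  -- subsequence, Fatou's lemma carries the smooth inequality over to f².
  have hin : TendstoInMeasure μ ψ atTop f :=
    tendstoInMeasure_of_tendsto_eLpNorm (p := 2) (by norm_num) (fun n => (mψ n).1) h.mem.1
      ((tendsto_nrm_iff fun n => (mψ n).sub h.mem).1 c)
  obtain ⟨k, hk, hae⟩ := hin.exists_seq_tendsto_ae
  have hle : eLpNorm (fun x => f x ^ 2) 2 μ ≤ ENNReal.ofReal √R := by
    have h1 := Lp.eLpNorm_lim_le_liminf_eLpNorm (p := 2) (μ := μ)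
      (f := fun n x => ψ (k n) x ^ 2) (fun n => (m4 (k n)).1) (fun x => f x ^ 2)
      (hae.mono fun x hx => hx.pow 2)
    refine h1.trans ?_
    have h2 := (ENNReal.continuous_ofReal.tendsto _).comp
      (((Real.continuous_sqrt.tendsto _).comp tR).comp hk.tendsto_atTop)
    rw [← h2.liminf_eq]
    refine liminf_le_liminf (Eventually.of_forall fun n => ?_)
    simp only [Function.comp]
    rw [ENNReal.le_ofReal_iff_toReal_le (m4 _).eLpNorm_ne_top (Real.sqrt_nonneg _)]
    exact Real.le_sqrt_of_sq_le (ladyzhenskaya_smooth hl (hψ (k n)) (h0 (k n)) rfl rfl rfl)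
  have hmem : MemLp (fun x => f x ^ 2) 2 μ :=
    ⟨h.mem.1.pow 2, hle.trans_lt ENNReal.ofReal_lt_top⟩
  refine ⟨hmem, ?_⟩
  have hR0 : 0 ≤ R := by
    rw [hR, ← hn₀, ← hn₁, ← hn₂]
    have := nrm_nonneg μ f
    have := nrm_nonneg μ g₀
    have := nrm_nonneg μ g₁
    positivity
  rw [ENNReal.le_ofReal_iff_toReal_le hmem.eLpNorm_ne_top (Real.sqrt_nonneg _)] at hle
  calc nrm μ (fun x => f x ^ 2) ^ 2 ≤ √R ^ 2 := pow_le_pow_left₀ (nrm_nonneg _ _) hle 2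
    _ = R := Real.sq_sqrt hR0

/-! ## Korn's inequality -/

lemma fderiv_fderiv_comm {ψ : ℝ × ℝ → ℝ} (hψ : ContDiff ℝ ∞ ψ) (x v w : ℝ × ℝ) :
    fderiv ℝ (fun x => fderiv ℝ ψ x v) x w = fderiv ℝ (fun x => fderiv ℝ ψ x w) x v := by
  have hd : DifferentiableAt ℝ (fderiv ℝ ψ) x :=
    (hψ.fderiv_right (m := ∞) (by simp)).differentiable (by simp) x
  have e : ∀ u, fderiv ℝ (fun x => fderiv ℝ ψ x u) x = (fderiv ℝ (fderiv ℝ ψ) x).flip u := by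
    intro u
    rw [fderiv_clm_apply hd (differentiableAt_const u)]
    simp
  rw [e, e]
  exact ((contDiff_infty.1 hψ 2).contDiffAt.isSymmSndFDerivAt (by simp)) w v

lemma integrableOn_rect {F : ℝ × ℝ → ℝ} (hF : Continuous F) (a₁ b₁ a₂ b₂ : ℝ) :
    IntegrableOn F (Ioo a₁ b₁ ×ˢ Ioo a₂ b₂) :=
  (hF.continuousOn.integrableOn_compact (isCompact_Icc.prod isCompact_Icc)).mono_set
    (prod_mono Ioo_subset_Icc_self Ioo_subset_Icc_self)

/-- A one-sided bound of the boundary pairing `∫ w₂ ∂₁w₁` in terms of the strain of `(w₁, w₂)`. -/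
lemma boundary_pairing_le {l : ℝ} (hl : 0 < l) {w₁ w₂ : ℝ × ℝ → ℝ} (h₁ : ContDiff ℝ ∞ w₁)
    (h₂ : ContDiff ℝ ∞ w₂) (z : ∀ x, l / 2 ≤ |x.1| → w₂ x = 0) {δ : ℝ} (hδ : 0 < δ) :
    ∫ x in (-l / 2)..(l / 2), w₂ (x, 0) * fderiv ℝ w₁ (x, 0) (1, 0) ≤
      ∫ x in Ioo (-l / 2) (l / 2) ×ˢ Ioo (0 : ℝ) (1 / 2),
        (δ * w₂ x ^ 2 + (1 / δ + 1 / 2) * fderiv ℝ w₁ x (1, 0) ^ 2 +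
          1 / 2 * fderiv ℝ w₂ x (0, 1) ^ 2 +
          1 / 4 * (fderiv ℝ w₂ x (1, 0) + fderiv ℝ w₁ x (0, 1)) ^ 2) := by
  have c₁ := contDiff_fderivApply h₁ (1, 0)
  have c₂ := contDiff_fderivApply h₁ (0, 1)
  have d₁ := contDiff_fderivApply h₂ (1, 0)
  have d₂ := contDiff_fderivApply h₂ (0, 1)
  -- The factor 1 − 2x₂ equals 1 on the side x₂ = 0 and vanishes at x₂ = 1/2. In the divergence of
  -- (−η w₂ ∂₂w₁, η w₂ ∂₁w₁) the second derivatives of w₁ cancel.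
  have hη : ContDiff ℝ ∞ fun t : ℝ => 1 - 2 * t := by fun_prop
  have hη' : ContDiff ℝ ∞ fun x : ℝ × ℝ => 1 - 2 * x.2 := hη.comp contDiff_snd
  have dη : ∀ t, deriv (fun t : ℝ => 1 - 2 * t) t = -2 := fun t => by
    have : HasDerivAt (fun t : ℝ => 1 - 2 * t) (-(2 * 1)) t :=
      ((hasDerivAt_id t).const_mul 2).const_sub 1
    rw [this.deriv]; ring
  have hdη : ∀ x v, fderiv ℝ (fun x : ℝ × ℝ => 1 - 2 * x.2) x v = -2 * v.2 := fun x v => by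
    rw [fderiv_snd_comp hη, dη]
  have hF : ContDiff ℝ ∞ fun x : ℝ × ℝ => -((1 - 2 * x.2) * (w₂ x * fderiv ℝ w₁ x (0, 1))) :=
    (hη'.mul (h₂.mul c₂)).neg
  have hG : ContDiff ℝ ∞ fun x : ℝ × ℝ => (1 - 2 * x.2) * (w₂ x * fderiv ℝ w₁ x (1, 0)) :=
    hη'.mul (h₂.mul c₁)
  have e := integral_div_rect (hF.of_le (by simp)) (hG.of_le (by simp))
    (by linarith : -l / 2 ≤ l / 2) (by norm_num : (0 : ℝ) ≤ 1 / 2)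
  have z1 : ∀ y, w₂ (l / 2, y) = 0 := fun y => z _ (le_abs_self _)
  have z2 : ∀ y, w₂ (-l / 2, y) = 0 :=
    fun y => z _ (by simp only [neg_div, abs_neg]; exact le_abs_self _)
  simp only [z1, z2, zero_mul, mul_zero, neg_zero, intervalIntegral.integral_zero, add_zero,
    sub_zero, one_mul, mul_one_div_cancel (two_ne_zero (α := ℝ)), sub_self, zero_sub] at e
  rw [eq_neg_iff_add_eq_zero, add_comm, ← eq_neg_iff_add_eq_zero, ← integral_neg] at e
  rw [e]
  have hcont : Continuous fun x : ℝ × ℝ =>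
      -(fderiv ℝ (fun x : ℝ × ℝ => -((1 - 2 * x.2) * (w₂ x * fderiv ℝ w₁ x (0, 1)))) x (1, 0) +
        fderiv ℝ (fun x : ℝ × ℝ => (1 - 2 * x.2) * (w₂ x * fderiv ℝ w₁ x (1, 0))) x (0, 1)) :=
    ((continuous_fderivApply hF _).add (continuous_fderivApply hG _)).neg
  refine setIntegral_mono_on (integrableOn_rect hcont _ _ _ _) (integrableOn_rect ?_ _ _ _ _)
    (measurableSet_Ioo.prod measurableSet_Ioo) fun x hx => ?_
  · have := h₂.continuous; have := c₁.continuous; have := c₂.continuous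
    have := d₁.continuous; have := d₂.continuous
    fun_prop
  · have e1 : fderiv ℝ (fun x : ℝ × ℝ => -((1 - 2 * x.2) * (w₂ x * fderiv ℝ w₁ x (0, 1)))) x (1, 0) =
        -((1 - 2 * x.2) * (fderiv ℝ w₂ x (1, 0) * fderiv ℝ w₁ x (0, 1) +
          w₂ x * fderiv ℝ (fun x => fderiv ℝ w₁ x (0, 1)) x (1, 0))) := by
      rw [fderiv_fun_neg, neg_apply, fderiv_mul_apply hη' (h₂.mul c₂),
        fderiv_mul_apply h₂ c₂, hdη]
      simp
    rw [e1, fderiv_mul_apply hη' (h₂.mul c₁), fderiv_mul_apply h₂ c₁, hdη, fderiv_fderiv_comm h₁]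
    have q0 : 0 ≤ 1 - 2 * x.2 := by linarith [hx.2.2]
    have q1 : 1 - 2 * x.2 ≤ 1 := by linarith [hx.2.1]
    generalize 1 - 2 * x.2 = q at q0 q1
    generalize fderiv ℝ w₁ x (1, 0) = a
    generalize fderiv ℝ w₂ x (0, 1) = b
    generalize fderiv ℝ w₂ x (1, 0) = c
    generalize fderiv ℝ w₁ x (0, 1) = d
    generalize w₂ x = w
    have i1 : 2 * (w * a) ≤ δ * w ^ 2 + 1 / δ * a ^ 2 := by
      have : δ * w ^ 2 + 1 / δ * a ^ 2 - 2 * (w * a) = (δ * w - a) ^ 2 / δ := by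
        field_simp; ring
      have h3 : 0 ≤ (δ * w - a) ^ 2 / δ := by positivity
      linarith
    have i2 : -(q * (b * a)) ≤ 1 / 2 * a ^ 2 + 1 / 2 * b ^ 2 := by
      nlinarith [mul_nonneg q0 (sq_nonneg (a + b)), mul_nonneg (sub_nonneg.2 q1) (sq_nonneg a),
        mul_nonneg (sub_nonneg.2 q1) (sq_nonneg b)]
    -- This is where the bound is one-sided: cd ≤ (c + d)²/4 holds, whereas −cd is not controlled by
    -- the shear c + d.
    have i3 : q * (c * d) ≤ 1 / 4 * (c + d) ^ 2 := by
      nlinarith [mul_nonneg q0 (sq_nonneg (c - d)), mul_nonneg (sub_nonneg.2 q1) (sq_nonneg (c + d))]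
    nlinarith

lemma fderiv_comp_affine {ψ : ℝ × ℝ → ℝ} (hψ : ContDiff ℝ ∞ ψ) (α β : ℝ) (x v : ℝ × ℝ) :
    fderiv ℝ (fun x : ℝ × ℝ => ψ (x.1, α + β * x.2)) x v =
      fderiv ℝ ψ (x.1, α + β * x.2) (v.1, β * v.2) := by
  have h1 : HasFDerivAt (fun x : ℝ × ℝ => (x.1, α + β * x.2))
      ((ContinuousLinearMap.fst ℝ ℝ ℝ).prod (β • ContinuousLinearMap.snd ℝ ℝ ℝ)) x :=
    hasFDerivAt_fst.prodMk ((hasFDerivAt_snd.const_mul β).const_add α)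
  have h2 := ((hψ.differentiable (by simp)) (x.1, α + β * x.2)).hasFDerivAt.comp x h1
  have h3 : (fun x : ℝ × ℝ => ψ (x.1, α + β * x.2)) = ψ ∘ fun x : ℝ × ℝ => (x.1, α + β * x.2) := rfl
  rw [h3, h2.fderiv]; simp

/-- For c ≤ 2 the affine map sends (0, 1/2) into the cross section, and for c ≥ 1 its Jacobian
factor 1/c is at most 1. -/
lemma integral_comp_affine_le_one {g : ℝ → ℝ} (hg : Continuous g) (h0 : ∀ t, 0 ≤ g t) {σ c : ℝ}
    (hσ : σ = 1 ∨ σ = -1) (hc : 1 ≤ c) (hc' : c ≤ 2) :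
    ∫ t in Ioo (0 : ℝ) (1 / 2), g (σ / 2 + -(σ * c) * t) ≤
      ∫ t in Ioo (-1 / 2 : ℝ) (1 / 2), g t := by
  have hne : -(σ * c) ≠ 0 := by rcases hσ with rfl | rfl <;> simp <;> linarith
  have key : ∀ a b, a ≤ b → -1 / 2 ≤ a → b ≤ 1 / 2 →
      c⁻¹ * ∫ t in a..b, g t ≤ ∫ t in (-1 / 2 : ℝ)..(1 / 2), g t := by
    intro a b hab ha hb
    refine le_trans ?_ (intervalIntegral.integral_mono_interval ha hab hb
      (Eventually.of_forall h0) (hg.intervalIntegrable _ _))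
    have : 0 ≤ ∫ t in a..b, g t := intervalIntegral.integral_nonneg hab fun t _ => h0 t
    exact mul_le_of_le_one_left this (inv_le_one_of_one_le₀ hc)
  rw [← integral_Ioc_eq_integral_Ioo, ← integral_Ioc_eq_integral_Ioo,
    ← intervalIntegral.integral_of_le (by norm_num), ← intervalIntegral.integral_of_le (by norm_num),
    intervalIntegral.integral_comp_add_mul g hne, smul_eq_mul]
  rcases hσ with rfl | rfl
  · rw [intervalIntegral.integral_symm, mul_neg, ← neg_mul, ← inv_neg]
    simp only [one_mul, neg_neg, mul_zero, add_zero]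
    exact key _ _ (by linarith) (by linarith) (by linarith)
  · simp only [neg_mul, one_mul, neg_neg, mul_zero, add_zero]
    exact key _ _ (by linarith) (by linarith) (by linarith)

lemma integral_comp_affine_le {l : ℝ} {Φ : ℝ × ℝ → ℝ} (hΦ : Continuous Φ)
    (h0 : ∀ x, 0 ≤ Φ x) {σ c : ℝ} (hσ : σ = 1 ∨ σ = -1) (hc : 1 ≤ c) (hc' : c ≤ 2) :
    ∫ x in Ioo (-l / 2) (l / 2) ×ˢ Ioo (0 : ℝ) (1 / 2), Φ (x.1, σ / 2 + -(σ * c) * x.2) ≤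
      ∫ x in plate l 1, Φ x := by
  have hcont : Continuous fun x : ℝ × ℝ => Φ (x.1, σ / 2 + -(σ * c) * x.2) := by fun_prop
  have i1 := integrableOn_rect hcont (-l / 2) (l / 2) 0 (1 / 2)
  have i2 := integrableOn_rect hΦ (-l / 2) (l / 2) (-1 / 2) (1 / 2)
  rw [IntegrableOn, Measure.volume_eq_prod, ← Measure.prod_restrict] at i1 i2
  rw [plate, Measure.volume_eq_prod, ← Measure.prod_restrict, ← Measure.prod_restrict,
    integral_prod _ i1, integral_prod _ i2]
  exact integral_mono i1.integral_prod_left i2.integral_prod_left fun s =>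
    integral_comp_affine_le_one (g := fun t => Φ (s, t)) (by fun_prop) (fun t => h0 _) hσ hc hc'

/-- One-sided bound for the boundary pairing on the side `x₂ = σ / 2`, obtained from an extension
of the displacement across this side that controls the strain. -/
lemma side_pairing_le {l : ℝ} (hl : 0 < l) {ψ₁ ψ₂ : ℝ × ℝ → ℝ} (h₁ : ContDiff ℝ ∞ ψ₁)
    (h₂ : ContDiff ℝ ∞ ψ₂) (z : ∀ x, l / 2 ≤ |x.1| → ψ₂ x = 0)
    {δ : ℝ} (hδ : 0 < δ) {σ : ℝ} (hσ : σ = 1 ∨ σ = -1) :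
    σ * ∫ x in (-l / 2)..(l / 2), ψ₂ (x, σ / 2) * fderiv ℝ ψ₁ (x, σ / 2) (1, 0) ≤
      2 * ∫ x in plate l 1, (32 * δ * ψ₂ x ^ 2 + 18 * (1 / δ + 1 / 2) * fderiv ℝ ψ₁ x (1, 0) ^ 2 +
          64 * fderiv ℝ ψ₂ x (0, 1) ^ 2 +
          8 * (fderiv ℝ ψ₂ x (1, 0) + fderiv ℝ ψ₁ x (0, 1)) ^ 2) := by
  set Φ : ℝ × ℝ → ℝ := fun x => 32 * δ * ψ₂ x ^ 2 +
    18 * (1 / δ + 1 / 2) * fderiv ℝ ψ₁ x (1, 0) ^ 2 + 64 * fderiv ℝ ψ₂ x (0, 1) ^ 2 +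
    8 * (fderiv ℝ ψ₂ x (1, 0) + fderiv ℝ ψ₁ x (0, 1)) ^ 2 with hΦ
  have hσ2 : σ * σ = 1 := by rcases hσ with rfl | rfl <;> norm_num
  have hΦc : Continuous Φ := by
    have := h₂.continuous; have := continuous_fderivApply h₁ (1, 0)
    have := continuous_fderivApply h₁ (0, 1); have := continuous_fderivApply h₂ (1, 0)
    have := continuous_fderivApply h₂ (0, 1)
    fun_prop
  have hΦ0 : ∀ x, 0 ≤ Φ x := fun x => by positivity
  have hcomp : ∀ {ψ : ℝ × ℝ → ℝ} (c : ℝ), ContDiff ℝ ∞ ψ →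
      ContDiff ℝ ∞ fun x : ℝ × ℝ => ψ (x.1, σ / 2 + -(σ * c) * x.2) := fun c hψ => by
    fun_prop
  -- In the outward coordinate of the side, w = (w₁, w₂) extends the displacement (ψ₁, σψ₂). Write
  -- the weights as (a₁, a₂) for w₁ and σ(b₁, b₂) for w₂. Matching values at x₂ = 0 requires a₁ + a₂
  -- = 1 and b₁ + b₂ = 1. Making the shear of w a combination of shears of ψ at the two reflected
  -- points requires b₁ = −a₁ and b₂ = −2a₂. The unique solution is 3, −2 and −3, 4. Passing outside
  -- the plate is what gives the pairing the favourable sign.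
  let w₁ : ℝ × ℝ → ℝ := fun x => 3 * ψ₁ (x.1, σ / 2 + -(σ * 1) * x.2) -
    2 * ψ₁ (x.1, σ / 2 + -(σ * 2) * x.2)
  let w₂ : ℝ × ℝ → ℝ := fun x => -3 * σ * ψ₂ (x.1, σ / 2 + -(σ * 1) * x.2) +
    4 * σ * ψ₂ (x.1, σ / 2 + -(σ * 2) * x.2)
  have hw₁ : ContDiff ℝ ∞ w₁ :=
    (contDiff_const.mul (hcomp 1 h₁)).sub (contDiff_const.mul (hcomp 2 h₁))
  have hw₂ : ContDiff ℝ ∞ w₂ :=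
    (contDiff_const.mul (hcomp 1 h₂)).add (contDiff_const.mul (hcomp 2 h₂))
  have diff : ∀ {ψ : ℝ × ℝ → ℝ} (c : ℝ) (x), ContDiff ℝ ∞ ψ →
      DifferentiableAt ℝ (fun x : ℝ × ℝ => ψ (x.1, σ / 2 + -(σ * c) * x.2)) x :=
    fun c x hψ => (hcomp c hψ).differentiable (by simp) x
  have scal : ∀ {ψ : ℝ × ℝ → ℝ} (x : ℝ × ℝ) (β : ℝ),
      fderiv ℝ ψ x (0, β) = β * fderiv ℝ ψ x (0, 1) := fun x β => by
    have : ((0 : ℝ), β) = β • ((0 : ℝ), (1 : ℝ)) := by simp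
    rw [this, map_smul, smul_eq_mul]
  have f1 : ∀ x v, fderiv ℝ w₁ x v = 3 * fderiv ℝ ψ₁ (x.1, σ / 2 + -(σ * 1) * x.2)
      (v.1, -(σ * 1) * v.2) - 2 * fderiv ℝ ψ₁ (x.1, σ / 2 + -(σ * 2) * x.2)
      (v.1, -(σ * 2) * v.2) := fun x v => by
    simp only [w₁]
    rw [fderiv_fun_sub ((diff 1 x h₁).const_mul 3) ((diff 2 x h₁).const_mul 2),
      fderiv_const_mul (diff 1 x h₁), fderiv_const_mul (diff 2 x h₁)]
    simp only [sub_apply, smul_apply, smul_eq_mul, fderiv_comp_affine h₁]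
  have f2 : ∀ x v, fderiv ℝ w₂ x v = -3 * σ * fderiv ℝ ψ₂ (x.1, σ / 2 + -(σ * 1) * x.2)
      (v.1, -(σ * 1) * v.2) + 4 * σ * fderiv ℝ ψ₂ (x.1, σ / 2 + -(σ * 2) * x.2)
      (v.1, -(σ * 2) * v.2) := fun x v => by
    simp only [w₂]
    rw [fderiv_fun_add ((diff 1 x h₂).const_mul _) ((diff 2 x h₂).const_mul _),
      fderiv_const_mul (diff 1 x h₂), fderiv_const_mul (diff 2 x h₂)]
    simp only [add_apply, smul_apply, smul_eq_mul, fderiv_comp_affine h₂]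
  have e := boundary_pairing_le hl hw₁ hw₂ (fun x hx => by
    have z' : ∀ t, ψ₂ (x.1, t) = 0 := fun t => z _ hx
    simp only [w₂, z']; ring) hδ
  have lhs : ∀ x, w₂ (x, 0) * fderiv ℝ w₁ (x, 0) (1, 0) =
      σ * (ψ₂ (x, σ / 2) * fderiv ℝ ψ₁ (x, σ / 2) (1, 0)) := fun x => by
    rw [f1]; simp only [w₂, mul_zero, add_zero]; ring
  simp only [lhs] at e
  rw [intervalIntegral.integral_const_mul] at e
  refine e.trans ?_
  have hc1 : Continuous fun x : ℝ × ℝ => Φ (x.1, σ / 2 + -(σ * 1) * x.2) := by fun_prop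
  have hc2 : Continuous fun x : ℝ × ℝ => Φ (x.1, σ / 2 + -(σ * 2) * x.2) := by fun_prop
  have b1 := integral_comp_affine_le (l := l) hΦc hΦ0 hσ le_rfl (by norm_num : (1 : ℝ) ≤ 2)
  have b2 := integral_comp_affine_le (l := l) hΦc hΦ0 hσ (by norm_num : (1 : ℝ) ≤ 2) le_rfl
  have b3 := integral_add (integrableOn_rect hc1 (-l / 2) (l / 2) 0 (1 / 2))
    (integrableOn_rect hc2 (-l / 2) (l / 2) 0 (1 / 2))
  have b4 : ∫ x in Ioo (-l / 2) (l / 2) ×ˢ Ioo (0 : ℝ) (1 / 2),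
        (δ * w₂ x ^ 2 + (1 / δ + 1 / 2) * fderiv ℝ w₁ x (1, 0) ^ 2 +
          1 / 2 * fderiv ℝ w₂ x (0, 1) ^ 2 +
          1 / 4 * (fderiv ℝ w₂ x (1, 0) + fderiv ℝ w₁ x (0, 1)) ^ 2) ≤
      ∫ x in Ioo (-l / 2) (l / 2) ×ˢ Ioo (0 : ℝ) (1 / 2),
        (Φ (x.1, σ / 2 + -(σ * 1) * x.2) + Φ (x.1, σ / 2 + -(σ * 2) * x.2)) := by
    refine setIntegral_mono_on (integrableOn_rect ?_ _ _ _ _)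
      (integrableOn_rect (hc1.add hc2) _ _ _ _) (measurableSet_Ioo.prod measurableSet_Ioo)
      fun x _ => ?_
    · have := hw₂.continuous; have := continuous_fderivApply hw₁ (1, 0)
      have := continuous_fderivApply hw₁ (0, 1); have := continuous_fderivApply hw₂ (1, 0)
      have := continuous_fderivApply hw₂ (0, 1)
      fun_prop
    · simp only [f1, f2]
      simp only [mul_zero, mul_one, w₂, hΦ]
      simp only [scal _ (-σ), scal _ (-(σ * 2))]
      set p := (x.1, σ / 2 + -σ * x.2)
      set q := (x.1, σ / 2 + -(σ * 2) * x.2)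
      -- The numerical constants in Φ are not sharp; Cauchy–Schwarz already gives 3² + 4² = 25 in
      -- place of 32 here.
      have k0 : δ * (-3 * σ * ψ₂ p + 4 * σ * ψ₂ q) ^ 2 ≤
          32 * δ * ψ₂ p ^ 2 + 32 * δ * ψ₂ q ^ 2 := by
        have : (-3 * σ * ψ₂ p + 4 * σ * ψ₂ q) ^ 2 = (σ * σ) * (-3 * ψ₂ p + 4 * ψ₂ q) ^ 2 := by ring
        rw [this, hσ2]
        nlinarith [mul_nonneg hδ.le (sq_nonneg (4 * ψ₂ p + 3 * ψ₂ q)),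
          mul_nonneg hδ.le (sq_nonneg (ψ₂ p)), mul_nonneg hδ.le (sq_nonneg (ψ₂ q))]
      have k1 : ∀ a b : ℝ, (1 / δ + 1 / 2) * (3 * a - 2 * b) ^ 2 ≤
          18 * (1 / δ + 1 / 2) * a ^ 2 + 18 * (1 / δ + 1 / 2) * b ^ 2 := fun a b => by
        have hk : 0 ≤ 1 / δ + 1 / 2 := by positivity
        generalize 1 / δ + 1 / 2 = κ at hk
        nlinarith [mul_nonneg hk (sq_nonneg (2 * a + 3 * b)), mul_nonneg hk (sq_nonneg a),
          mul_nonneg hk (sq_nonneg b)]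
      have k2 : ∀ a b : ℝ, 1 / 2 * (-3 * σ * (-σ * a) + 4 * σ * (-(σ * 2) * b)) ^ 2 ≤
          64 * a ^ 2 + 64 * b ^ 2 := fun a b => by
        have : -3 * σ * (-σ * a) + 4 * σ * (-(σ * 2) * b) = (σ * σ) * (3 * a - 8 * b) := by ring
        rw [this, hσ2]
        nlinarith [sq_nonneg (8 * a + 3 * b), sq_nonneg a, sq_nonneg b]
      have k3 : ∀ a b c d : ℝ, 1 / 4 * (-3 * σ * a + 4 * σ * b + (3 * (-σ * c) -
          2 * (-(σ * 2) * d))) ^ 2 ≤ 8 * (a + c) ^ 2 + 8 * (b + d) ^ 2 := fun a b c d => by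
        have : (-3 * σ * a + 4 * σ * b + (3 * (-σ * c) - 2 * (-(σ * 2) * d))) ^ 2 =
          (σ * σ) * (-3 * (a + c) + 4 * (b + d)) ^ 2 := by ring
        rw [this, hσ2]
        nlinarith [sq_nonneg (4 * (a + c) + 3 * (b + d)), sq_nonneg (a + c), sq_nonneg (b + d)]
      have l1 := k1 (fderiv ℝ ψ₁ p (1, 0)) (fderiv ℝ ψ₁ q (1, 0))
      have l2 := k2 (fderiv ℝ ψ₂ p (0, 1)) (fderiv ℝ ψ₂ q (0, 1))
      have l3 := k3 (fderiv ℝ ψ₂ p (1, 0)) (fderiv ℝ ψ₂ q (1, 0)) (fderiv ℝ ψ₁ p (0, 1))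
        (fderiv ℝ ψ₁ q (0, 1))
      linarith
  linarith

/-- Korn's inequality for smooth displacements vanishing on the lateral boundary. -/
lemma korn_smooth {l : ℝ} (hl : 0 < l) {ψ₁ ψ₂ : ℝ × ℝ → ℝ} (h₁ : ContDiff ℝ ∞ ψ₁)
    (h₂ : ContDiff ℝ ∞ ψ₂) (z₂ : ∀ x, l / 2 ≤ |x.1| → ψ₂ x = 0)
    {A B D : ℝ}
    (hA : A = nrm (volume.restrict (plate l 1)) (fun x => fderiv ℝ ψ₁ x (1, 0)))
    (hB : B = nrm (volume.restrict (plate l 1)) (fun x => fderiv ℝ ψ₂ x (0, 1)))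
    (hD : D = nrm (volume.restrict (plate l 1))
      (fun x => fderiv ℝ ψ₂ x (1, 0) + fderiv ℝ ψ₁ x (0, 1))) :
    nrm (volume.restrict (plate l 1)) (fun x => fderiv ℝ ψ₂ x (1, 0)) ^ 2 +
      nrm (volume.restrict (plate l 1)) (fun x => fderiv ℝ ψ₁ x (0, 1)) ^ 2 ≤
      (1026 + 147456 * l ^ 2) * (A ^ 2 + B ^ 2 + D ^ 2) := by
  set μ := (volume.restrict (plate l 1) : Measure (ℝ × ℝ)) with hμ
  have mc : ∀ {F : ℝ × ℝ → ℝ}, Continuous F → MemLp F 2 μ := fun h => memLp_of_continuous l 1 h 2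
  have k₂ := mc h₂.continuous
  have a := mc (continuous_fderivApply h₁ (1, 0))
  have c := mc (continuous_fderivApply h₁ (0, 1))
  have d := mc (continuous_fderivApply h₂ (1, 0))
  have b := mc (continuous_fderivApply h₂ (0, 1))
  have cd : MemLp (fun x => fderiv ℝ ψ₂ x (1, 0) + fderiv ℝ ψ₁ x (0, 1)) 2 μ := mc ((continuous_fderivApply h₂ (1, 0)).add (continuous_fderivApply h₁ (0, 1)))
  -- The two sides contribute 256 δ ‖ψ₂‖² in total to the final estimate. By Poincaré this choice
  -- makes that at most ½ ‖∂₁ψ₂‖², which is absorbed on the left; doubling the rest yields the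
  -- stated constant.
  set δ : ℝ := 1 / (512 * l ^ 2) with hδ
  have hδ0 : 0 < δ := by positivity
  have s1 := side_pairing_le hl h₁ h₂ z₂ hδ0 (σ := 1) (Or.inl rfl)
  have s2 := side_pairing_le hl h₁ h₂ z₂ hδ0 (σ := -1) (Or.inr rfl)
  have hΦ : ∫ x in plate l 1, (32 * δ * ψ₂ x ^ 2 + 18 * (1 / δ + 1 / 2) * fderiv ℝ ψ₁ x (1, 0) ^ 2 +
          64 * fderiv ℝ ψ₂ x (0, 1) ^ 2 +
          8 * (fderiv ℝ ψ₂ x (1, 0) + fderiv ℝ ψ₁ x (0, 1)) ^ 2) =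
      32 * δ * nrm μ ψ₂ ^ 2 + 18 * (1 / δ + 1 / 2) * A ^ 2 + 64 * B ^ 2 + 8 * D ^ 2 := by
    rw [integral_add, integral_add, integral_add, integral_const_mul, integral_const_mul,
      integral_const_mul, integral_const_mul, hA, hB, hD, nrm_sq k₂, nrm_sq a, nrm_sq b, nrm_sq cd]
    · exact k₂.integrable_sq.const_mul _
    · exact a.integrable_sq.const_mul _
    · exact (k₂.integrable_sq.const_mul _).add (a.integrable_sq.const_mul _)
    · exact b.integrable_sq.const_mul _
    · exact ((k₂.integrable_sq.const_mul _).add (a.integrable_sq.const_mul _)).add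
        (b.integrable_sq.const_mul _)
    · exact cd.integrable_sq.const_mul _
  rw [hΦ] at s1 s2
  have e := integral_div_rect (F := fun x => -(ψ₂ x * fderiv ℝ ψ₁ x (0, 1)))
    (G := fun x => ψ₂ x * fderiv ℝ ψ₁ x (1, 0))
    ((h₂.mul (contDiff_fderivApply h₁ _)).neg.of_le (by simp))
    ((h₂.mul (contDiff_fderivApply h₁ _)).of_le (by simp))
    (by linarith : -l / 2 ≤ l / 2) (by norm_num : (-1 / 2 : ℝ) ≤ 1 / 2)
  have z1 : ∀ y, ψ₂ (l / 2, y) = 0 := fun y => z₂ _ (le_abs_self _)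
  have z2 : ∀ y, ψ₂ (-l / 2, y) = 0 :=
    fun y => z₂ _ (by simp only [neg_div, abs_neg]; exact le_abs_self _)
  simp only [z1, z2, zero_mul, neg_zero, intervalIntegral.integral_zero, add_zero, sub_zero] at e
  have e1 : ∀ x, fderiv ℝ (fun x => -(ψ₂ x * fderiv ℝ ψ₁ x (0, 1))) x (1, 0) +
      fderiv ℝ (fun x => ψ₂ x * fderiv ℝ ψ₁ x (1, 0)) x (0, 1) =
      fderiv ℝ ψ₂ x (0, 1) * fderiv ℝ ψ₁ x (1, 0) -
        fderiv ℝ ψ₂ x (1, 0) * fderiv ℝ ψ₁ x (0, 1) := fun x => by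
    rw [fderiv_fun_neg, neg_apply, fderiv_mul_apply h₂ (contDiff_fderivApply h₁ _),
      fderiv_mul_apply h₂ (contDiff_fderivApply h₁ _), fderiv_fderiv_comm h₁]
    ring
  simp only [e1] at e
  -- The square of the shear contains the product ∂₁ψ₂ ∂₂ψ₁, which is traded for ∂₂ψ₂ ∂₁ψ₁ at the
  -- price of the Jacobian determinant. The integral of the latter is the boundary pairing computed
  -- in `e`.
  have e2 : nrm μ (fun x => fderiv ℝ ψ₂ x (1, 0)) ^ 2 + nrm μ (fun x => fderiv ℝ ψ₁ x (0, 1)) ^ 2 =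
      D ^ 2 - 2 * (∫ x, fderiv ℝ ψ₂ x (0, 1) * fderiv ℝ ψ₁ x (1, 0) ∂μ) +
        2 * ∫ x, (fderiv ℝ ψ₂ x (0, 1) * fderiv ℝ ψ₁ x (1, 0) -
        fderiv ℝ ψ₂ x (1, 0) * fderiv ℝ ψ₁ x (0, 1)) ∂μ := by
    rw [integral_sub (integrable_mul_of_memLp b a) (integrable_mul_of_memLp d c), hD, nrm_sq d,
      nrm_sq c, nrm_sq cd]
    have : ∀ x, (fderiv ℝ ψ₂ x (1, 0) + fderiv ℝ ψ₁ x (0, 1)) ^ 2 = fderiv ℝ ψ₂ x (1, 0) ^ 2 +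
      fderiv ℝ ψ₁ x (0, 1) ^ 2 + 2 * (fderiv ℝ ψ₂ x (1, 0) * fderiv ℝ ψ₁ x (0, 1)) := fun x => by
      ring
    simp only [this]
    rw [integral_add, integral_add d.integrable_sq c.integrable_sq, integral_const_mul]
    · ring
    · exact d.integrable_sq.add c.integrable_sq
    · exact (integrable_mul_of_memLp d c).const_mul 2
  have p := poincare_smooth hl h₂ z₂
  have cs := (abs_le.1 (abs_integral_mul_le b a)).1
  rw [← hA, ← hB] at cs
  rw [← hμ] at p
  have e' : ∫ x, (fderiv ℝ ψ₂ x (0, 1) * fderiv ℝ ψ₁ x (1, 0) -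
        fderiv ℝ ψ₂ x (1, 0) * fderiv ℝ ψ₁ x (0, 1)) ∂μ ≤
      4 * (32 * δ * nrm μ ψ₂ ^ 2 + 18 * (1 / δ + 1 / 2) * A ^ 2 + 64 * B ^ 2 + 8 * D ^ 2) := by
    refine (le_of_eq e).trans ?_
    rw [one_mul] at s1
    rw [neg_one_mul] at s2
    linarith
  have p2 : δ * nrm μ ψ₂ ^ 2 ≤ 1 / 512 * nrm μ (fun x => fderiv ℝ ψ₂ x (1, 0)) ^ 2 := by
    have := pow_le_pow_left₀ (nrm_nonneg _ _) p 2
    calc δ * nrm μ ψ₂ ^ 2 ≤ δ * (l * nrm μ fun x => fderiv ℝ ψ₂ x (1, 0)) ^ 2 := by gcongr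
      _ = _ := by rw [hδ]; field_simp
  have hδi : 1 / δ = 512 * l ^ 2 := by rw [hδ]; simp
  rw [hδi] at e'
  have := sq_nonneg (nrm μ fun x => fderiv ℝ ψ₁ x (0, 1))
  have := mul_nonneg (sq_nonneg l) (sq_nonneg B)
  have := mul_nonneg (sq_nonneg l) (sq_nonneg D)
  nlinarith [sq_nonneg (A - B)]

/-- Korn's inequality for displacements with zero lateral trace. -/
lemma korn {l : ℝ} (hl : 0 < l) {f₁ f₂ a c d b : ℝ × ℝ → ℝ} (h₁ : HasLat l f₁ a c)
    (h₂ : HasLat l f₂ d b) {A B D : ℝ} (hA : A = nrm (volume.restrict (plate l 1)) a)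
    (hB : B = nrm (volume.restrict (plate l 1)) b)
    (hD : D = nrm (volume.restrict (plate l 1)) (fun x => d x + c x)) :
    nrm (volume.restrict (plate l 1)) d ^ 2 + nrm (volume.restrict (plate l 1)) c ^ 2 ≤
      (1026 + 147456 * l ^ 2) * (A ^ 2 + B ^ 2 + D ^ 2) := by
  set μ := (volume.restrict (plate l 1) : Measure (ℝ × ℝ)) with hμ
  obtain ⟨φ, hφ, p0, -, p1, p2⟩ := h₁.exists_approx hl
  obtain ⟨ψ, hψ, q0, -, q1, q2⟩ := h₂.exists_approx hl
  have mc : ∀ {F : ℝ × ℝ → ℝ}, Continuous F → MemLp F 2 μ := fun h => memLp_of_continuous l 1 h 2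
  have mφ := fun v n => mc (continuous_fderivApply (hφ n) v)
  have mψ := fun v n => mc (continuous_fderivApply (hψ n) v)
  have ta := tendsto_nrm (mφ _) h₁.mem₀ p1
  have tc := tendsto_nrm (mφ _) h₁.mem₁ p2
  have td := tendsto_nrm (mψ _) h₂.mem₀ q1
  have tb := tendsto_nrm (mψ _) h₂.mem₁ q2
  have tD : Tendsto (fun n => nrm μ fun x => fderiv ℝ (ψ n) x (1, 0) + fderiv ℝ (φ n) x (0, 1))
      atTop (𝓝 (nrm μ fun x => d x + c x)) := by
    refine tendsto_nrm (fun n => (mψ _ n).add (mφ _ n)) (h₂.mem₀.add h₁.mem₁) ?_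
    have := q1.add p2
    rw [add_zero] at this
    refine squeeze_zero (fun n => nrm_nonneg _ _) (fun n => ?_) this
    refine le_trans (le_of_eq ?_) (nrm_add_le ((mψ (1, 0) n).sub h₂.mem₀)
      ((mφ (0, 1) n).sub h₁.mem₁))
    congr 1; ext x; ring
  rw [hA, hB, hD]
  exact le_of_tendsto_of_tendsto' ((td.pow 2).add (tc.pow 2))
    ((((ta.pow 2).add (tb.pow 2)).add (tD.pow 2)).const_mul _) fun n =>
    korn_smooth hl (hφ n) (hψ n) (q0 n) rfl rfl rfl

/-! ## Functions of product form on the plate -/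

section product

variable {l ε : ℝ} {f g h : ℝ → ℝ}

lemma tsupport_slice_fst (φ : ℝ × ℝ → ℝ) (t : ℝ) :
    tsupport (fun s => φ (s, t)) ⊆ {s | (s, t) ∈ tsupport φ} :=
  closure_minimal (fun _ hs => subset_tsupport φ hs)
    ((isClosed_tsupport φ).preimage (by fun_prop))

lemma tsupport_slice_snd (φ : ℝ × ℝ → ℝ) (s : ℝ) :
    tsupport (fun t => φ (s, t)) ⊆ {t | (s, t) ∈ tsupport φ} :=
  closure_minimal (fun _ hs => subset_tsupport φ hs)
    ((isClosed_tsupport φ).preimage (by fun_prop))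

lemma hasCompactSupport_slice_fst {φ : ℝ × ℝ → ℝ} (hc : HasCompactSupport φ) (t : ℝ) :
    HasCompactSupport fun s => φ (s, t) :=
  HasCompactSupport.intro (hc.isCompact.image continuous_fst) fun _ hs =>
    image_eq_zero_of_notMem_tsupport fun h => hs ⟨_, h, rfl⟩

lemma hasCompactSupport_slice_snd {φ : ℝ × ℝ → ℝ} (hc : HasCompactSupport φ) (s : ℝ) :
    HasCompactSupport fun t => φ (s, t) :=
  HasCompactSupport.intro (hc.isCompact.image continuous_snd) fun _ hs =>
    image_eq_zero_of_notMem_tsupport fun h => hs ⟨_, h, rfl⟩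

lemma memL2_mul_prod (hf : MemL2 (interval l) f) (hh : Continuous h) :
    MemL2 (plate l ε) fun x => f x.1 * h x.2 := by
  have hh2 : MemLp h 2 (volume.restrict (Ioo (-ε / 2) (ε / 2))) :=
    memLp_of_continuous_interval ε hh 2
  rw [MemL2, restrict_plate]
  have hm : AEStronglyMeasurable (fun x : ℝ × ℝ => f x.1 * h x.2)
      ((volume.restrict (interval l)).prod (volume.restrict (Ioo (-ε / 2) (ε / 2)))) :=
    (hf.1.comp_fst).mul (hh2.1.comp_snd)
  rw [memLp_two_iff_integrable_sq hm]
  simp_rw [mul_pow]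
  exact hf.integrable_sq.mul_prod hh2.integrable_sq

lemma memL2_fst (hf : MemL2 (interval l) f) : MemL2 (plate l ε) fun x => f x.1 := by
  simpa using memL2_mul_prod (ε := ε) (h := fun _ => 1) hf continuous_const

/-- Fubini: every slice φ(·, t) of a test function on the plate is a test function on the interval.
-/
lemma HasWeakDeriv.mul_prod_fst (hw : HasWeakDeriv (interval l) 1 f g)
    (hf : MemL2 (interval l) f) (hg : MemL2 (interval l) g) (hh : Continuous h) :
    HasWeakDeriv (plate l ε) (dir 0) (fun x => f x.1 * h x.2) fun x => g x.1 * h x.2 := by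
  have mf : MemL2 (plate l ε) fun x => f x.1 * h x.2 := memL2_mul_prod hf hh
  have mg : MemL2 (plate l ε) fun x => g x.1 * h x.2 := memL2_mul_prod hg hh
  refine ⟨mf.locallyIntegrableOn, mg.locallyIntegrableOn, fun φ hφ hc hs => ?_⟩
  have i1 := integrableOn_mul_fderiv (measurableSet_plate l ε) mf.locallyIntegrableOn hφ hc hs (dir 0)
  have i2 := integrableOn_mul_of_tsupport (measurableSet_plate l ε) mg.locallyIntegrableOn
    hφ.continuous hc hs
  rw [IntegrableOn, restrict_plate] at i1 i2
  rw [restrict_plate, integral_prod_symm _ i1, integral_prod_symm _ i2, ← integral_neg]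
  refine integral_congr_ae (Eventually.of_forall fun t => ?_)
  have key := hw.2.2 (fun s => φ (s, t)) (hφ.comp (contDiff_prodMk_left t))
    (hasCompactSupport_slice_fst hc t)
    ((tsupport_slice_fst φ t).trans fun s hst => (hs hst).1)
  simp only [fderiv_apply_one_eq_deriv, deriv_slice_fst (hφ.of_le (by simp))] at key
  simp only [dir, Matrix.cons_val_zero]
  have e1 : ∀ a b : ℝ, a * h t * b = h t * (a * b) := fun a b => by ring
  simp_rw [e1]
  rw [integral_const_mul, integral_const_mul, key]; ring

lemma setIntegral_mul_deriv_eq {a b : ℝ} {φ : ℝ → ℝ} (hh : ContDiff ℝ ∞ h)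
    (hφ : ContDiff ℝ ∞ φ) (hc : HasCompactSupport φ) (hs : tsupport φ ⊆ Ioo a b) :
    ∫ t in Ioo a b, h t * deriv φ t = - ∫ t in Ioo a b, deriv h t * φ t := by
  have hφd : Continuous (deriv φ) := hφ.continuous_deriv (by simp)
  have hhd : Continuous (deriv h) := hh.continuous_deriv (by simp)
  rw [setIntegral_eq_integral_of_forall_compl_eq_zero,
    setIntegral_eq_integral_of_forall_compl_eq_zero]
  · refine integral_mul_deriv_eq_deriv_mul_of_integrable
      (fun x _ => (hh.differentiable (by simp) x).hasDerivAt)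
      (fun x _ => (hφ.differentiable (by simp) x).hasDerivAt) ?_ ?_ ?_
    · exact (hh.continuous.mul hφd).integrable_of_hasCompactSupport hc.deriv.mul_left
    · exact (hhd.mul hφ.continuous).integrable_of_hasCompactSupport hc.mul_left
    · exact (hh.continuous.mul hφ.continuous).integrable_of_hasCompactSupport hc.mul_left
  · intro x hx
    rw [image_eq_zero_of_notMem_tsupport fun hx' => hx (hs hx'), mul_zero]
  · intro x hx
    rw [image_eq_zero_of_notMem_tsupport fun hx' => hx (hs (tsupport_deriv_subset hx')), mul_zero]

/-- Only the smooth factor is differentiated, so square integrability of f suffices. -/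
lemma hasWeakDeriv_mul_prod_snd (hf : MemL2 (interval l) f) (hh : ContDiff ℝ ∞ h) :
    HasWeakDeriv (plate l ε) (dir 1) (fun x => f x.1 * h x.2) fun x => f x.1 * deriv h x.2 := by
  have mf : MemL2 (plate l ε) fun x => f x.1 * h x.2 := memL2_mul_prod hf hh.continuous
  have mg : MemL2 (plate l ε) fun x => f x.1 * deriv h x.2 :=
    memL2_mul_prod hf (hh.continuous_deriv (by simp))
  refine ⟨mf.locallyIntegrableOn, mg.locallyIntegrableOn, fun φ hφ hc hs => ?_⟩
  have i1 := integrableOn_mul_fderiv (measurableSet_plate l ε) mf.locallyIntegrableOn hφ hc hs (dir 1)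
  have i2 := integrableOn_mul_of_tsupport (measurableSet_plate l ε) mg.locallyIntegrableOn
    hφ.continuous hc hs
  rw [IntegrableOn, restrict_plate] at i1 i2
  rw [restrict_plate, integral_prod _ i1, integral_prod _ i2, ← integral_neg]
  refine integral_congr_ae (Eventually.of_forall fun s => ?_)
  have key := setIntegral_mul_deriv_eq (a := -ε / 2) (b := ε / 2) (φ := fun t => φ (s, t)) hh
    (hφ.comp (contDiff_prodMk_right s))
    (hasCompactSupport_slice_snd hc s)
    ((tsupport_slice_snd φ s).trans fun t hst => (hs hst).2)
  simp only [deriv_slice_snd (hφ.of_le (by simp))] at key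
  simp only [dir, Matrix.cons_val_one, mul_assoc, integral_const_mul]
  simp only [Matrix.cons_val_fin_one, key]; ring

lemma HasWeakDeriv.fst (hw : HasWeakDeriv (interval l) 1 f g)
    (hf : MemL2 (interval l) f) (hg : MemL2 (interval l) g) :
    HasWeakDeriv (plate l ε) (dir 0) (fun x => f x.1) fun x => g x.1 := by
  simpa using hw.mul_prod_fst (ε := ε) (h := fun _ => 1) hf hg continuous_const

lemma hasWeakDeriv_fst_snd (hf : MemL2 (interval l) f) :
    HasWeakDeriv (plate l ε) (dir 1) (fun x => f x.1) fun _ => 0 := by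
  simpa using hasWeakDeriv_mul_prod_snd (ε := ε) (h := fun _ => 1) hf contDiff_const

lemma MemW12I.hasWeakDeriv (hf : MemW12I l f) : HasWeakDeriv (interval l) 1 f (D1 l f) :=
  hasWeakDeriv_weakDeriv (hf.2.imp fun _ h => h.1)

lemma MemW12I.memL2_D1 (hf : MemW12I l f) : MemL2 (interval l) (D1 l f) := by
  obtain ⟨g, hg, hm⟩ := hf.2
  exact hm.ae_eq (hg.weakDeriv_ae_eq (isOpen_interval l)).symm

lemma memW12_of_hasWeakDeriv {Ω : Set (ℝ × ℝ)} {f g₀ g₁ : ℝ × ℝ → ℝ} (hf : MemL2 Ω f)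
    (h₀ : HasWeakDeriv Ω (dir 0) f g₀) (h₁ : HasWeakDeriv Ω (dir 1) f g₁)
    (m₀ : MemL2 Ω g₀) (m₁ : MemL2 Ω g₁) : MemW12 Ω f := by
  refine ⟨hf, fun i => ?_⟩
  fin_cases i
  exacts [⟨_, h₀, m₀⟩, ⟨_, h₁, m₁⟩]

lemma MemW12.hasWeakDeriv_pd {Ω : Set (ℝ × ℝ)} {f : ℝ × ℝ → ℝ} (hf : MemW12 Ω f) (i : Fin 2) :
    HasWeakDeriv Ω (dir i) f (pd Ω i f) :=
  hasWeakDeriv_weakDeriv ((hf.2 i).imp fun _ h => h.1)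

lemma MemW12.memL2_pd {Ω : Set (ℝ × ℝ)} {f : ℝ × ℝ → ℝ} (hΩ : IsOpen Ω) (hf : MemW12 Ω f)
    (i : Fin 2) : MemL2 Ω (pd Ω i f) := by
  obtain ⟨g, hg, hm⟩ := hf.2 i
  exact hm.ae_eq (hg.weakDeriv_ae_eq hΩ).symm

end product

/-! ## Rescaling -/

section rescale

variable {l ε : ℝ} {f g : ℝ × ℝ → ℝ}

/-- The scaling `(x₁, x₂) ↦ (x₁, ε x₂)` of the plane. -/
def scaling (hε : ε ≠ 0) : ℝ × ℝ ≃ₜ ℝ × ℝ :=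
  (Homeomorph.refl ℝ).prodCongr (Homeomorph.mulLeft₀ ε hε)

lemma preimage_plate (hε : 0 < ε) : scaling hε.ne' ⁻¹' plate l ε = plate l 1 := by
  ext x
  have : ∀ t : ℝ, (-ε / 2 < ε * t ∧ ε * t < ε / 2) ↔ (-1 / 2 < t ∧ t < 1 / 2) := fun t => by
    constructor <;> rintro ⟨h1, h2⟩ <;> constructor <;> nlinarith
  simp [scaling, plate, this]

lemma map_scaling (hε : 0 < ε) : Measure.map (scaling hε.ne') (volume.restrict (plate l 1)) =
    ENNReal.ofReal ε⁻¹ • volume.restrict (plate l ε) := by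
  have h : Measure.map (scaling hε.ne') (volume : Measure (ℝ × ℝ)) = ENNReal.ofReal ε⁻¹ • volume := by
    have := map_volume_scale (a := 1) (b := ε) one_ne_zero hε.ne'
    simp only [one_mul, inv_one, abs_one, ENNReal.ofReal_one, one_smul,
      abs_of_pos (inv_pos.2 hε)] at this
    exact this
  rw [← preimage_plate hε, ← (scaling hε.ne').measurableEmbedding.restrict_map, h,
    Measure.restrict_smul]

lemma memL2_rescale (hε : 0 < ε) (hf : MemL2 (plate l ε) f) : MemL2 (plate l 1) (rescale ε f) := by
  have : MemLp f 2 (Measure.map (scaling hε.ne') (volume.restrict (plate l 1))) := by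
    rw [map_scaling hε]; exact hf.smul_measure ENNReal.ofReal_ne_top
  exact ((scaling hε.ne').measurableEmbedding.memLp_map_measure_iff).1 this

lemma ae_rescale (hε : 0 < ε) {p : ℝ × ℝ → Prop} (h : ∀ᵐ x ∂volume.restrict (plate l ε), p x) :
    ∀ᵐ x ∂volume.restrict (plate l 1), p (x.1, ε * x.2) := by
  have : ∀ᵐ x ∂Measure.map (scaling hε.ne') (volume.restrict (plate l 1)), p x := by
    rw [map_scaling hε]; exact Measure.ae_smul_measure h _
  exact (scaling hε.ne').measurableEmbedding.ae_map_iff.1 this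

lemma integral_rescale (hε : 0 < ε) (f : ℝ × ℝ → ℝ) :
    ∫ x in plate l 1, f (x.1, ε * x.2) = 1 / ε * ∫ x in plate l ε, f x := by
  have := (scaling hε.ne').measurableEmbedding.integral_map (μ := volume.restrict (plate l 1)) f
  rw [map_scaling hε, integral_smul_measure, ENNReal.toReal_ofReal (inv_pos.2 hε).le] at this
  rw [one_div]
  exact this.symm

lemma contDiff_unscale {φ : ℝ × ℝ → ℝ} (hφ : ContDiff ℝ ∞ φ) (ε : ℝ) :
    ContDiff ℝ ∞ fun x : ℝ × ℝ => φ (x.1, ε⁻¹ * x.2) :=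
  hφ.comp (contDiff_fst.prodMk (contDiff_const.mul contDiff_snd))

lemma fderiv_unscale {φ : ℝ × ℝ → ℝ} (hφ : ContDiff ℝ ∞ φ) (ε : ℝ) (x v : ℝ × ℝ) :
    fderiv ℝ (fun x : ℝ × ℝ => φ (x.1, ε⁻¹ * x.2)) x v =
      fderiv ℝ φ (x.1, ε⁻¹ * x.2) (v.1, ε⁻¹ * v.2) := by
  have h2 : HasFDerivAt (fun x : ℝ × ℝ => x.2) (ContinuousLinearMap.snd ℝ ℝ ℝ) x := hasFDerivAt_snd
  have h : HasFDerivAt (fun x : ℝ × ℝ => (x.1, ε⁻¹ * x.2)) _ x :=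
    hasFDerivAt_fst.prodMk (h2.const_mul ε⁻¹)
  have := ((hφ.differentiable (by simp) (x.1, ε⁻¹ * x.2)).hasFDerivAt.comp x h).fderiv
  have h2 : (fun x : ℝ × ℝ => φ (x.1, ε⁻¹ * x.2)) = φ ∘ fun x : ℝ × ℝ => (x.1, ε⁻¹ * x.2) := rfl
  rw [h2, this]; simp

/-- Change of variables for a single test function. No support condition appears, so the same
identity serves both compactly supported test functions (`hasWeakDeriv_rescale`) and the arbitrary
ones of the trace condition (`hasLat_rescale`). -/
lemma integral_rescale_mul_fderiv (hε : 0 < ε) {φ : ℝ × ℝ → ℝ} (hφ : ContDiff ℝ ∞ φ) (i : Fin 2)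
    (h : ∫ x in plate l ε, f x * fderiv ℝ (fun x : ℝ × ℝ => φ (x.1, ε⁻¹ * x.2)) x (dir i) =
      - ∫ x in plate l ε, g x * φ (x.1, ε⁻¹ * x.2)) :
    ∫ x in plate l 1, rescale ε f x * fderiv ℝ φ x (dir i) =
      - ∫ x in plate l 1, (![1, ε] i * rescale ε g x) * φ x := by
  have e1 := integral_rescale (l := l) hε
    fun x => f x * fderiv ℝ (fun x : ℝ × ℝ => φ (x.1, ε⁻¹ * x.2)) x (dir i)
  have e2 := integral_rescale (l := l) hε fun x => g x * φ (x.1, ε⁻¹ * x.2)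
  rw [h, mul_neg, ← e2] at e1
  simp only [fderiv_unscale hφ, inv_mul_cancel_left₀ hε.ne', Prod.mk.eta] at e1
  have e3 : ∀ x : ℝ × ℝ, fderiv ℝ φ x (dir i) =
      ![1, ε] i * fderiv ℝ φ x ((dir i).1, ε⁻¹ * (dir i).2) := fun x => by
    fin_cases i
    · simp [dir]
    · have : ((0, ε⁻¹ * 1) : ℝ × ℝ) = ε⁻¹ • (0, 1) := by simp
      simp only [dir, Fin.mk_one, Matrix.cons_val_one, Matrix.cons_val_fin_one]
      rw [this, map_smul, smul_eq_mul, mul_inv_cancel_left₀ hε.ne']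
  simp_rw [e3, mul_left_comm _ (![1, ε] i), mul_assoc (![1, ε] i)]
  rw [integral_const_mul, integral_const_mul]
  simp only [rescale]
  rw [e1, mul_neg]

lemma hasWeakDeriv_rescale (hε : 0 < ε) {i : Fin 2} (h : HasWeakDeriv (plate l ε) (dir i) f g)
    (hf : MemL2 (plate l ε) f) (hg : MemL2 (plate l ε) g) :
    HasWeakDeriv (plate l 1) (dir i) (rescale ε f) fun x => ![1, ε] i * rescale ε g x := by
  refine ⟨(memL2_rescale hε hf).locallyIntegrableOn,
    MemL2.locallyIntegrableOn ((memL2_rescale hε hg).const_mul _),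
    fun φ hφ hc hs => integral_rescale_mul_fderiv hε hφ i (h.2.2 _ (contDiff_unscale hφ ε) ?_ ?_)⟩
  · have : (fun x : ℝ × ℝ => φ (x.1, ε⁻¹ * x.2)) = φ ∘ (scaling (inv_ne_zero hε.ne')) := rfl
    rw [this]
    exact hc.comp_homeomorph _
  · refine (closure_minimal (t := (scaling (inv_ne_zero hε.ne')) ⁻¹' tsupport φ)
      (fun _ hx => subset_tsupport φ hx)
      ((isClosed_tsupport φ).preimage (Homeomorph.continuous _))).trans fun x hx => ?_
    have h1 := hs hx
    rw [← preimage_plate hε] at h1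
    have h2 : scaling hε.ne' (scaling (inv_ne_zero hε.ne') x) = x := by
      rcases x with ⟨s, t⟩
      simp [scaling, hε.ne']
    rwa [mem_preimage, h2] at h1

lemma HasWeakDeriv.congr_memL2 {e : ℝ × ℝ} {f' g' : ℝ × ℝ → ℝ}
    (h : HasWeakDeriv (plate l ε) e f g) (hf : f =ᵐ[volume.restrict (plate l ε)] f')
    (hg : g =ᵐ[volume.restrict (plate l ε)] g') (mf : MemL2 (plate l ε) f)
    (mg : MemL2 (plate l ε) g) : HasWeakDeriv (plate l ε) e f' g' :=
  h.congr hf hg (MemL2.locallyIntegrableOn (MemLp.ae_eq hf mf))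
    (MemL2.locallyIntegrableOn (MemLp.ae_eq hg mg))

lemma HasLat.congr {f₀ f₁ f' f₀' f₁' : ℝ × ℝ → ℝ} (h : HasLat l f f₀ f₁)
    (e : f =ᵐ[volume.restrict (plate l 1)] f') (e₀ : f₀ =ᵐ[volume.restrict (plate l 1)] f₀')
    (e₁ : f₁ =ᵐ[volume.restrict (plate l 1)] f₁') : HasLat l f' f₀' f₁' where
  mem := MemLp.ae_eq e h.mem
  mem₀ := MemLp.ae_eq e₀ h.mem₀
  mem₁ := MemLp.ae_eq e₁ h.mem₁
  deriv₀ φ hφ := by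
    have a1 : ∫ x in plate l 1, f' x * fderiv ℝ φ x (1, 0) =
        ∫ x in plate l 1, f x * fderiv ℝ φ x (1, 0) :=
      integral_congr_ae (by filter_upwards [e] with x hx; rw [hx])
    have a2 : ∫ x in plate l 1, f₀' x * φ x = ∫ x in plate l 1, f₀ x * φ x :=
      integral_congr_ae (by filter_upwards [e₀] with x hx; rw [hx])
    rw [a1, a2, h.deriv₀ φ hφ]
  deriv₁ := h.deriv₁.congr_memL2 e e₁ h.mem h.mem₁

lemma HasLat.const_mul {f₀ f₁ : ℝ × ℝ → ℝ} (c : ℝ) (h : HasLat l f f₀ f₁) :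
    HasLat l (fun x => c * f x) (fun x => c * f₀ x) (fun x => c * f₁ x) where
  mem := h.mem.const_mul c
  mem₀ := h.mem₀.const_mul c
  mem₁ := h.mem₁.const_mul c
  deriv₀ φ hφ := by
    simp_rw [mul_assoc]
    rw [integral_const_mul, integral_const_mul, h.deriv₀ φ hφ]; ring
  deriv₁ := h.deriv₁.const_mul c

lemma hasLat_rescale (hl : 0 < l) (hε : 0 < ε) (hf : MemW12 (plate l ε) f)
    (ht : ZeroLateralTrace l ε f) :
    HasLat l (rescale ε f) (rescale ε (pd (plate l ε) 0 f))
      (fun x => ε * rescale ε (pd (plate l ε) 1 f) x) where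
  mem := memL2_rescale hε hf.1
  mem₀ := memL2_rescale hε (hf.memL2_pd (isOpen_plate l ε) 0)
  mem₁ := (memL2_rescale hε (hf.memL2_pd (isOpen_plate l ε) 1)).const_mul ε
  deriv₀ φ hφ := by
    simpa [dir] using integral_rescale_mul_fderiv hε hφ 0
      (ht.integral_mul_fderiv hl hε hf (contDiff_unscale hφ ε))
  deriv₁ := hasWeakDeriv_rescale hε (hf.hasWeakDeriv_pd 1) hf.1 (hf.memL2_pd (isOpen_plate l ε) 1)

end rescale

/-! ## The lateral trace of `∂₂ z` -/

section lateral

variable {l : ℝ} {z z₀ z₁ z₀₀ z₀₁ z₁₁ : ℝ × ℝ → ℝ}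

/-- With ψ equal to φ times a cutoff in x₂, integrate by parts as follows: ∫ z₁∂₁ψ = −∫ z∂₂∂₁ψ = −∫
z∂₁∂₂ψ = ∫ z₀∂₂ψ = −∫ z₀₁ψ. The third equality uses the trace identity of z with the test function
∂₂ψ, which need not vanish laterally. Removing the cutoff shows that ∂₂z inherits the zero lateral
trace, and that its x₁-derivative is ∂₂∂₁z. This is the source of the boundary condition for θ. -/
lemma HasLat.integral_deriv₁_mul_fderiv (hl : 0 < l) (h : HasLat l z z₀ z₁)
    (h₀ : HasLat l z₀ z₀₀ z₀₁) {φ : ℝ × ℝ → ℝ} (hφ : ContDiff ℝ ∞ φ) :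
    ∫ x in plate l 1, z₁ x * fderiv ℝ φ x (1, 0) = - ∫ x in plate l 1, z₀₁ x * φ x := by
  obtain ⟨χ, hχ, hχc, hχs, hχb, hχ1⟩ := exists_cutoff one_pos
  have hχ' : ∀ n, ContDiff ℝ ∞ fun x : ℝ × ℝ => χ n x.2 := fun n => (hχ n).comp contDiff_snd
  have hae : ∀ᵐ x ∂(volume.restrict (plate l 1)), ∀ᶠ n in atTop, χ n x.2 = 1 := by
    rw [ae_restrict_iff' (measurableSet_plate l 1)]
    exact Eventually.of_forall fun x hx => hχ1 x.2 hx.2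
  have h1 := tendsto_integral_cutoff (integrable_mul_of_memLp h.mem₁
    (memLp_of_continuous l 1 (continuous_fderivApply hφ (1, 0)) 2))
    (fun n => (hχ' n).continuous.aestronglyMeasurable) (fun n x => hχb n x.2) hae
  have h2 := tendsto_integral_cutoff (integrable_mul_of_memLp h₀.mem₁
    (memLp_of_continuous l 1 hφ.continuous 2))
    (fun n => (hχ' n).continuous.aestronglyMeasurable) (fun n x => hχb n x.2) hae
  refine tendsto_nhds_unique h1 (h2.neg.congr fun n => ?_)
  set ψ : ℝ × ℝ → ℝ := fun x => φ x * χ n x.2 with hψd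
  have hψ : ContDiff ℝ ∞ ψ := hφ.mul (hχ' n)
  have hs : tsupport ψ ⊆ univ ×ˢ Ioo (-1 / 2) (1 / 2) := fun x hx =>
    ⟨mem_univ _, hχs n (tsupport_comp_subset_preimage (χ n) continuous_snd
      (tsupport_mul_subset_right (f := φ) (g := fun x : ℝ × ℝ => χ n x.2) hx))⟩
  have e1 := integral_deriv_snd hl h.mem h.mem₁ h.deriv₁ (contDiff_fderivApply hψ (1, 0))
    ((tsupport_fderiv_apply_subset ℝ _).trans hs)
  have e2 := h.deriv₀ _ (contDiff_fderivApply hψ (0, 1))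
  have e3 := integral_deriv_snd hl h₀.mem h₀.mem₁ h₀.deriv₁ hψ hs
  simp only [fderiv_fderiv_comm hψ _ (1, 0) (0, 1)] at e1
  have e4 : ∀ x, fderiv ℝ ψ x (1, 0) = fderiv ℝ φ x (1, 0) * χ n x.2 := fun x => by
    rw [hψd, fderiv_mul_apply hφ (hχ' n), fderiv_snd_comp (hχ n)]; simp
  simp only [e4] at e1
  simp only [mul_assoc]
  linarith

lemma HasLat.deriv₁_hasLat (hl : 0 < l) (h : HasLat l z z₀ z₁) (h₀ : HasLat l z₀ z₀₀ z₀₁)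
    (h₁ : HasWeakDeriv (plate l 1) (dir 1) z₁ z₁₁) (m₁ : MemL2 (plate l 1) z₁₁) :
    HasLat l z₁ z₀₁ z₁₁ where
  mem := h.mem₁
  mem₀ := h₀.mem₁
  mem₁ := m₁
  deriv₀ _ hφ := h.integral_deriv₁_mul_fderiv hl h₀ hφ
  deriv₁ := h₁

end lateral

/-! ## Averages over the cross section and functions of one variable -/

section average

variable {l : ℝ} {f g z z₀ z₁ : ℝ × ℝ → ℝ}

/-- The average of `f (s, ·)` over the cross section. -/
def avg (f : ℝ × ℝ → ℝ) (s : ℝ) : ℝ := ∫ t in Ioo (-1 / 2 : ℝ) (1 / 2), f (s, t)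

instance : IsProbabilityMeasure (volume.restrict (Ioo (-1 / 2 : ℝ) (1 / 2))) :=
  ⟨by simp; norm_num⟩

lemma sq_integral_le {X : Type*} [MeasurableSpace X] {ν : Measure X} [IsProbabilityMeasure ν]
    {f : X → ℝ} (hf : MemLp f 2 ν) : (∫ x, f x ∂ν) ^ 2 ≤ ∫ x, f x ^ 2 ∂ν := by
  have h := abs_integral_mul_le hf (memLp_const (μ := ν) (p := 2) (1 : ℝ))
  have h1 := nrm_sq (memLp_const (μ := ν) (p := 2) (1 : ℝ))
  simp only [one_pow, integral_const, probReal_univ, smul_eq_mul, mul_one] at h h1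
  rw [← nrm_sq hf, ← sq_abs]
  calc _ ≤ (nrm ν f * nrm ν fun _ => 1) ^ 2 := pow_le_pow_left₀ (abs_nonneg _) h 2
    _ = _ := by rw [mul_pow, h1, mul_one]

lemma ae_memLp_slice (hf : MemL2 (plate l 1) f) : ∀ᵐ s ∂volume.restrict (interval l),
    MemLp (fun t => f (s, t)) 2 (volume.restrict (Ioo (-1 / 2 : ℝ) (1 / 2))) := by
  have h1 := hf.1
  have h2 := hf.integrable_sq
  rw [restrict_plate] at h1 h2
  filter_upwards [h1.prodMk_left, h2.prod_right_ae] with s a1 a2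
  exact (memLp_two_iff_integrable_sq a1).2 a2

lemma memL2_avg (hf : MemL2 (plate l 1) f) : MemL2 (interval l) (avg f) := by
  have h1 := hf.1
  have h2 := hf.integrable_sq
  rw [restrict_plate] at h1 h2
  have hm : AEStronglyMeasurable (avg f) (volume.restrict (interval l)) := h1.integral_prod_right'
  rw [MemL2, memLp_two_iff_integrable_sq hm]
  refine h2.integral_prod_left.mono' (hm.pow 2) ?_
  filter_upwards [ae_memLp_slice hf] with s hs
  rw [Real.norm_eq_abs, abs_of_nonneg (sq_nonneg _)]
  exact sq_integral_le hs

lemma nrm_avg_le (hf : MemL2 (plate l 1) f) :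
    nrm (volume.restrict (plate l 1)) (fun x => avg f x.1) ≤ nrm (volume.restrict (plate l 1)) f := by
  have h2 := hf.integrable_sq
  have m := memL2_fst (ε := 1) (memL2_avg hf)
  have m2 := m.integrable_sq
  refine nrm_le_of_sq_le m (nrm_nonneg _ _) ?_
  rw [nrm_sq hf]
  rw [restrict_plate] at h2 m2 ⊢
  rw [integral_prod _ h2, integral_prod _ m2]
  refine integral_mono_ae m2.integral_prod_left h2.integral_prod_left ?_
  filter_upwards [ae_memLp_slice hf] with s hs
  simp only [integral_const, probReal_univ, smul_eq_mul, one_mul]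
  exact sq_integral_le hs

lemma integral_avg_mul (hf : MemL2 (plate l 1) f) {a : ℝ → ℝ} (ha : Continuous a) :
    ∫ s in interval l, avg f s * a s = ∫ x in plate l 1, f x * a x.1 := by
  have h : Integrable (fun x => f x * a x.1) (volume.restrict (plate l 1)) :=
    integrable_mul_of_memLp hf (memLp_of_continuous l 1 (ha.comp continuous_fst) 2)
  rw [restrict_plate] at h ⊢
  rw [integral_prod _ h]
  simp only [integral_mul_const, avg]

lemma avg_sub_ae (hf : MemL2 (plate l 1) f) (hg : MemL2 (plate l 1) g) :
    (fun x : ℝ × ℝ => avg (fun x => f x - g x) x.1) =ᵐ[volume.restrict (plate l 1)]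
      fun x => avg f x.1 - avg g x.1 := by
  have : ∀ᵐ s ∂volume.restrict (interval l), avg (fun x => f x - g x) s = avg f s - avg g s := by
    filter_upwards [ae_memLp_slice hf, ae_memLp_slice hg] with s h1 h2
    exact integral_sub (h1.integrable (by norm_num)) (h2.integrable (by norm_num))
  rw [restrict_plate]
  exact Measure.quasiMeasurePreserving_fst.ae this

/-- On a cross section of length one, a value differs from the mean by at most the integral of
|∂₂ψ|; Jensen's inequality does the rest. -/
lemma nrm_sub_avg_le_smooth {ψ : ℝ × ℝ → ℝ} (hψ : ContDiff ℝ ∞ ψ) :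
    nrm (volume.restrict (plate l 1)) (fun x => ψ x - avg ψ x.1) ≤
      nrm (volume.restrict (plate l 1)) (fun x => fderiv ℝ ψ x (0, 1)) := by
  have mψ : MemL2 (plate l 1) ψ := memLp_of_continuous l 1 hψ.continuous 2
  have md : MemL2 (plate l 1) fun x => |fderiv ℝ ψ x (0, 1)| :=
    memLp_of_continuous l 1 (continuous_fderivApply hψ (0, 1)).abs 2
  have e : nrm (volume.restrict (plate l 1)) (fun x => fderiv ℝ ψ x (0, 1)) =
      nrm (volume.restrict (plate l 1)) (fun x => |fderiv ℝ ψ x (0, 1)|) := by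
    simp only [nrm]
    rw [← eLpNorm_norm]; rfl
  rw [e]
  refine le_trans ?_ (nrm_avg_le md)
  have m1 : MemL2 (plate l 1) fun x => avg (fun x => |fderiv ℝ ψ x (0, 1)|) x.1 :=
    memL2_fst (memL2_avg md)
  have m2 : MemL2 (plate l 1) fun x => ψ x - avg ψ x.1 := mψ.sub (memL2_fst (memL2_avg mψ))
  refine nrm_le_of_sq_le m2 (nrm_nonneg _ _) ?_
  rw [nrm_sq m1]
  refine integral_mono_ae m2.integrable_sq m1.integrable_sq ?_
  filter_upwards [ae_restrict_mem (measurableSet_plate l 1)] with x hx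
  rw [← sq_abs]
  refine pow_le_pow_left₀ (abs_nonneg _) ?_ 2
  obtain ⟨s, t⟩ := x
  have i1 : Integrable (fun t => ψ (s, t)) (volume.restrict (Ioo (-1 / 2 : ℝ) (1 / 2))) :=
    (memLp_slice hψ.continuous s 1).integrable (by norm_num)
  have e1 : ψ (s, t) - avg ψ s = ∫ t' in Ioo (-1 / 2 : ℝ) (1 / 2), (ψ (s, t) - ψ (s, t')) := by
    rw [integral_sub (integrable_const _) i1]
    simp only [integral_const, probReal_univ, smul_eq_mul, one_mul, avg]
  have e2 : ∀ t' ∈ Ioo (-1 / 2 : ℝ) (1 / 2),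
      ‖ψ (s, t) - ψ (s, t')‖ ≤ avg (fun x => |fderiv ℝ ψ x (0, 1)|) s := fun t' ht' => by
    have := abs_sub_le_integral_deriv (g := fun t => ψ (s, t))
      ((hψ.of_le (by simp)).comp (contDiff_prodMk_right s)) (Ioo_subset_Icc_self hx.2)
      (Ioo_subset_Icc_self ht')
    simp only [deriv_slice_snd (hψ.of_le (by simp))] at this
    exact this
  simp only
  rw [e1, ← Real.norm_eq_abs]
  have := norm_setIntegral_le_of_norm_le_const (μ := volume) (by simp) e2
  rw [← measureReal_restrict_apply_univ, probReal_univ, mul_one] at this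
  exact this

/-- `ζ ∈ W^{1,2}(I)` with weak derivative `ζ₁` and zero boundary values, in integrated form. -/
structure HasZeroBdry (l : ℝ) (ζ ζ₁ : ℝ → ℝ) : Prop where
  mem : MemL2 (interval l) ζ
  mem₁ : MemL2 (interval l) ζ₁
  ibp : ∀ a : ℝ → ℝ, ContDiff ℝ ∞ a →
    ∫ s in interval l, ζ s * deriv a s = - ∫ s in interval l, ζ₁ s * a s

lemma HasZeroBdry.hasWeakDeriv {ζ ζ₁ : ℝ → ℝ} (h : HasZeroBdry l ζ ζ₁) :
    HasWeakDeriv (interval l) 1 ζ ζ₁ :=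
  ⟨h.mem.locallyIntegrableOn, h.mem₁.locallyIntegrableOn, fun φ hφ _ _ => by
    simpa only [fderiv_apply_one_eq_deriv] using h.ibp φ hφ⟩

lemma HasZeroBdry.D1_ae_eq {ζ ζ₁ : ℝ → ℝ} (h : HasZeroBdry l ζ ζ₁) :
    D1 l ζ =ᵐ[volume.restrict (interval l)] ζ₁ :=
  h.hasWeakDeriv.weakDeriv_ae_eq (isOpen_interval l)

/-- For smooth approximants the distance to the cross-sectional average is bounded by ∂₂, which
tends to zero here, so z equals its average. Testing with functions of x₁ alone gives the
one-dimensional boundary identity, and uniqueness of weak derivatives then identifies z₀. -/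
lemma HasLat.exists_avg (hl : 0 < l) (h : HasLat l z z₀ z₁)
    (h₁ : z₁ =ᵐ[volume.restrict (plate l 1)] 0) :
    HasZeroBdry l (avg z) (avg z₀) ∧
      z =ᵐ[volume.restrict (plate l 1)] (fun x => avg z x.1) ∧
      z₀ =ᵐ[volume.restrict (plate l 1)] (fun x => avg z₀ x.1) := by
  have hb : HasZeroBdry l (avg z) (avg z₀) := by
    refine ⟨memL2_avg h.mem, memL2_avg h.mem₀, fun a ha => ?_⟩
    rw [integral_avg_mul h.mem (ha.continuous_deriv (by simp)),
      integral_avg_mul h.mem₀ ha.continuous]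
    refine Eq.trans ?_ (h.deriv₀ (fun x => a x.1) (ha.comp contDiff_fst))
    refine integral_congr_ae (Eventually.of_forall fun x => ?_)
    have := fderiv_fst_comp ha x (1, 0)
    simp only [mul_one] at this
    simp only [this]
  have hz : z =ᵐ[volume.restrict (plate l 1)] (fun x => avg z x.1) := by
    obtain ⟨ψ, hψ, -, c, -, c1⟩ := h.exists_approx hl
    have mψ : ∀ n, MemL2 (plate l 1) (ψ n) := fun n => memLp_of_continuous l 1 (hψ n).continuous 2
    have md : ∀ n, MemL2 (plate l 1) fun x => fderiv ℝ (ψ n) x (0, 1) := fun n =>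
      memLp_of_continuous l 1 (continuous_fderivApply (hψ n) (0, 1)) 2
    have ma : ∀ {f}, MemL2 (plate l 1) f → MemL2 (plate l 1) fun x => avg f x.1 := fun hf =>
      memL2_fst (memL2_avg hf)
    set μ := volume.restrict (plate l 1) with hμ
    have t1 : Tendsto (fun n => nrm μ fun x => fderiv ℝ (ψ n) x (0, 1)) atTop (𝓝 0) := by
      have := tendsto_nrm md h.mem₁ c1
      rwa [(nrm_eq_zero h.mem₁).2 h₁] at this
    -- Split z − avg z into ψ − avg ψ, avg(ψ − z) and ψ − z; averaging does not increase the norm.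
    have bound : ∀ n, nrm μ (fun x => z x - avg z x.1) ≤
        nrm μ (fun x => ψ n x - z x) + nrm μ (fun x => fderiv ℝ (ψ n) x (0, 1)) +
          nrm μ (fun x => ψ n x - z x) := fun n => by
      have m1 : MemLp (fun x => ψ n x - z x) 2 μ := (mψ n).sub h.mem
      have m2 : MemLp (fun x => ψ n x - avg (ψ n) x.1) 2 μ := (mψ n).sub (ma (mψ n))
      have m3 : MemLp (fun x => avg (ψ n) x.1 - avg z x.1) 2 μ := (ma (mψ n)).sub (ma h.mem)
      have b1 : nrm μ (fun x => avg (ψ n) x.1 - avg z x.1) ≤ nrm μ (fun x => ψ n x - z x) := by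
        rw [nrm_congr (avg_sub_ae (mψ n) h.mem).symm]
        exact nrm_avg_le m1
      have e : (fun x => z x - avg z x.1) = fun x => ((ψ n x - avg (ψ n) x.1) +
          (avg (ψ n) x.1 - avg z x.1)) - (ψ n x - z x) := by ext; ring
      have b2 : nrm μ (fun x => z x - avg z x.1) ≤ nrm μ (fun x => (ψ n x - avg (ψ n) x.1) +
          (avg (ψ n) x.1 - avg z x.1)) + nrm μ (fun x => ψ n x - z x) := by
        rw [e]
        exact nrm_sub_le (m2.add m3) m1
      have b3 := nrm_add_le m2 m3
      have b4 := nrm_sub_avg_le_smooth (l := l) (hψ n)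
      linarith
    have t2 := (c.add t1).add c
    simp only [add_zero] at t2
    have h0 := le_antisymm (ge_of_tendsto' t2 bound) (nrm_nonneg _ _)
    filter_upwards [(nrm_eq_zero (h.mem.sub (ma h.mem))).1 h0] with x hx
    exact sub_eq_zero.1 hx
  refine ⟨hb, hz, ?_⟩
  have w := hb.hasWeakDeriv.fst (ε := 1) hb.mem hb.mem₁
  have w' := w.congr_memL2 hz.symm (EventuallyEq.refl _ _) (memL2_fst hb.mem) (memL2_fst hb.mem₁)
  exact h.hasWeakDeriv₀.ae_eq (isOpen_plate l 1) w'

lemma exists_contDiff_primitive {b : ℝ → ℝ} (hb : ContDiff ℝ ∞ b) :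
    ∃ a : ℝ → ℝ, ContDiff ℝ ∞ a ∧ deriv a = b := by
  have hd : ∀ x, HasDerivAt (fun x => ∫ t in (0 : ℝ)..x, b t) (b x) x := fun x =>
    intervalIntegral.integral_hasDerivAt_right (hb.continuous.intervalIntegrable _ _)
      (hb.continuous.stronglyMeasurableAtFilter _ _) hb.continuous.continuousAt
  have he : deriv (fun x => ∫ t in (0 : ℝ)..x, b t) = b := funext fun x => (hd x).deriv
  exact ⟨_, contDiff_infty_iff_deriv.2 ⟨fun x => (hd x).differentiableAt, he.symm ▸ hb⟩, he⟩

/-- The continuous representative is the primitive G of ζ₁ from the left end point. Testing with the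
constant 1 gives G(l/2) = 0, so G satisfies the same integration by parts formula as ζ, and the two
agree almost everywhere. -/
lemma HasZeroBdry.zeroTraceI (hl : 0 < l) {ζ ζ₁ : ℝ → ℝ} (h : HasZeroBdry l ζ ζ₁) :
    ZeroTraceI l ζ := by
  have hle : -l / 2 ≤ l / 2 := by linarith
  have hi : IntervalIntegrable ζ₁ volume (-l / 2) (l / 2) := by
    rw [intervalIntegrable_iff_integrableOn_Ioo_of_le hle]
    exact h.mem₁.integrableOn
  set G : ℝ → ℝ := fun x => ∫ t in (-l / 2)..x, ζ₁ t with hG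
  have conv : ∀ F : ℝ → ℝ, ∫ x in interval l, F x = ∫ x in (-l / 2)..(l / 2), F x := fun F => by
    rw [intervalIntegral.integral_of_le hle, interval, integral_Ioc_eq_integral_Ioo]
  have hac : AbsolutelyContinuousOnInterval G (-l / 2) (l / 2) :=
    hi.absolutelyContinuousOnInterval_intervalIntegral left_mem_uIcc
  have hGc : ContinuousOn G (Icc (-l / 2) (l / 2)) := by
    have := hac.continuousOn
    rwa [uIcc_of_le hle] at this
  have G0 : G (-l / 2) = 0 := by simp [hG]
  have G1 : G (l / 2) = 0 := by
    have := h.ibp (fun _ => 1) contDiff_const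
    simp only [deriv_const', mul_zero, integral_zero, mul_one] at this
    simp only [hG]
    rw [← conv]; linarith
  refine ⟨G, hGc, ?_, G0, G1⟩
  have mG : LocallyIntegrableOn G (interval l) :=
    ((hGc.integrableOn_Icc).mono_set Ioo_subset_Icc_self).locallyIntegrableOn
  have := (isOpen_interval l).ae_eq_zero_of_integral_contDiff_smul_eq_zero (μ := volume)
    (f := fun x => G x - ζ x) (mG.sub h.mem.locallyIntegrableOn) (fun b hb hbc hbs => by
      -- Any primitive of the test function will do: both identities hold for functions a that are
      -- not compactly supported.
      obtain ⟨a, ha, rfl⟩ := exists_contDiff_primitive hb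
      have haac : AbsolutelyContinuousOnInterval a (-l / 2) (l / 2) :=
        (ha.of_le (by simp)).contDiffOn.absolutelyContinuousOnInterval
      have ibp := hac.integral_mul_deriv_eq_deriv_mul haac
      rw [G0, G1, zero_mul, zero_mul, sub_zero, zero_sub] at ibp
      have hd : ∫ x in (-l / 2)..(l / 2), deriv G x * a x = ∫ x in (-l / 2)..(l / 2), ζ₁ x * a x := by
        refine intervalIntegral.integral_congr_ae ?_
        filter_upwards [hi.ae_hasDerivAt_integral] with x hx hx'
        rw [(hx (uIoc_subset_uIcc hx') _ left_mem_uIcc).deriv]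
      rw [hd, ← conv, ← conv, ← h.ibp a ha] at ibp
      have i1 : IntegrableOn (fun x => G x * deriv a x) (interval l) :=
        integrableOn_mul_of_tsupport (measurableSet_interval l) mG hb.continuous hbc hbs
      have i2 : IntegrableOn (fun x => ζ x * deriv a x) (interval l) :=
        integrableOn_mul_of_tsupport (measurableSet_interval l) h.mem.locallyIntegrableOn
          hb.continuous hbc hbs
      rw [← setIntegral_eq_integral_of_forall_compl_eq_zero (s := interval l)]
      · simp only [smul_eq_mul, mul_comm (deriv a _), sub_mul]
        rw [integral_sub i1 i2, ibp, sub_self]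
      · intro x hx
        rw [image_eq_zero_of_notMem_tsupport fun hx' => hx (hbs hx'), zero_smul])
  rw [EventuallyEq, ae_restrict_iff' (measurableSet_interval l)]
  filter_upwards [this] with x hx hxI
  exact sub_eq_zero.1 (hx hxI)

end average

/-! ## Quadratic forms depending on the symmetric part -/

section quadratic

variable {Q : QuadraticForm ℝ (Matrix (Fin 2) (Fin 2) ℝ)}

/-- On symmetric matrices Q is a polynomial in three coordinates, expanded by polarisation in the
basis X, Y, Z. Continuity and integrability then need no topology on matrices. -/
lemma exists_quadratic_coeff (hQsym : ∀ A, Q A = Q ((1 / 2 : ℝ) • (A + A.transpose))) :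
    ∃ p : Fin 6 → ℝ, ∀ A, Q A = p 0 * A 0 0 ^ 2 + p 1 * ((A 0 1 + A 1 0) / 2) ^ 2 +
      p 2 * A 1 1 ^ 2 + p 3 * (A 0 0 * ((A 0 1 + A 1 0) / 2)) + p 4 * (A 0 0 * A 1 1) +
      p 5 * (((A 0 1 + A 1 0) / 2) * A 1 1) := by
  let X : Matrix (Fin 2) (Fin 2) ℝ := !![1, 0; 0, 0]
  let Y : Matrix (Fin 2) (Fin 2) ℝ := !![0, 1; 1, 0]
  let Z : Matrix (Fin 2) (Fin 2) ℝ := !![0, 0; 0, 1]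
  refine ⟨![Q X, Q Y, Q Z, QuadraticMap.polar Q X Y, QuadraticMap.polar Q X Z,
    QuadraticMap.polar Q Y Z], fun A => ?_⟩
  have e : (1 / 2 : ℝ) • (A + A.transpose) =
      A 0 0 • X + ((A 0 1 + A 1 0) / 2) • Y + A 1 1 • Z := by
    ext i j
    fin_cases i <;> fin_cases j <;> simp [X, Y, Z] <;> ring
  have h1 : ∀ B C, Q (B + C) = Q B + Q C + QuadraticMap.polar Q B C := fun B C => by
    rw [QuadraticMap.polar]; ring
  rw [hQsym, e]
  simp only [h1, QuadraticMap.map_smul, QuadraticMap.polar_add_left, QuadraticMap.polar_smul_left,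
    QuadraticMap.polar_smul_right, smul_eq_mul]
  simp
  ring

/-- The minimum over the unit sphere of the three symmetric coordinates is positive by compactness;
homogeneity extends the bound to all matrices. -/
lemma exists_coercive (hQsym : ∀ A, Q A = Q ((1 / 2 : ℝ) • (A + A.transpose)))
    (hQpos : ∀ A : Matrix (Fin 2) (Fin 2) ℝ, A.IsSymm → A ≠ 0 → 0 < Q A) :
    ∃ c : ℝ, 0 < c ∧ ∀ A, c * (A 0 0 ^ 2 + ((A 0 1 + A 1 0) / 2) ^ 2 + A 1 1 ^ 2) ≤ Q A := by
  obtain ⟨p, hp⟩ := exists_quadratic_coeff hQsym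
  let q : ℝ × ℝ × ℝ → ℝ := fun v => p 0 * v.1 ^ 2 + p 1 * v.2.1 ^ 2 + p 2 * v.2.2 ^ 2 +
    p 3 * (v.1 * v.2.1) + p 4 * (v.1 * v.2.2) + p 5 * (v.2.1 * v.2.2)
  have hq : Continuous q := by fun_prop
  let K : Set (ℝ × ℝ × ℝ) := {v | v.1 ^ 2 + v.2.1 ^ 2 + v.2.2 ^ 2 = 1}
  have hK : IsCompact K := by
    refine (isCompact_Icc (a := ((-1, -1, -1) : ℝ × ℝ × ℝ)) (b := (1, 1, 1))).of_isClosed_subset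
      (isClosed_eq (by fun_prop) continuous_const) fun v hv => ?_
    have hv : v.1 ^ 2 + v.2.1 ^ 2 + v.2.2 ^ 2 = 1 := hv
    refine ⟨⟨?_, ?_, ?_⟩, ?_, ?_, ?_⟩ <;>
    nlinarith [sq_nonneg v.1, sq_nonneg v.2.1, sq_nonneg v.2.2]
  have hK0 : K.Nonempty := ⟨(1, 0, 0), by simp [K]⟩
  have hqpos : ∀ v ∈ K, 0 < q v := fun v hv => by
    have hv : v.1 ^ 2 + v.2.1 ^ 2 + v.2.2 ^ 2 = 1 := hv
    have h := hQpos !![v.1, v.2.1; v.2.1, v.2.2]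
      (by ext i j; fin_cases i <;> fin_cases j <;> rfl) (fun h0 => by
        have a := congrFun (congrFun h0 0) 0
        have b := congrFun (congrFun h0 0) 1
        have c := congrFun (congrFun h0 1) 1
        simp at a b c
        rw [a, b, c] at hv
        norm_num at hv)
    rw [hp] at h
    simpa [q] using h
  obtain ⟨v₀, hv₀, hmin⟩ := hK.exists_isMinOn hK0 hq.continuousOn
  refine ⟨q v₀, hqpos v₀ hv₀, fun A => ?_⟩
  rw [hp]
  generalize A 0 0 = a
  generalize (A 0 1 + A 1 0) / 2 = b
  generalize A 1 1 = d
  rcases (by positivity : 0 ≤ a ^ 2 + b ^ 2 + d ^ 2).eq_or_lt with h0 | h0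
  · have ha : a = 0 := by nlinarith [sq_nonneg a, sq_nonneg b, sq_nonneg d]
    have hb : b = 0 := by nlinarith [sq_nonneg a, sq_nonneg b, sq_nonneg d]
    have hd : d = 0 := by nlinarith [sq_nonneg a, sq_nonneg b, sq_nonneg d]
    simp [ha, hb, hd]
  · set s := √(a ^ 2 + b ^ 2 + d ^ 2) with hs
    have hs0 : 0 < s := Real.sqrt_pos.2 h0
    have hs2 : s ^ 2 = a ^ 2 + b ^ 2 + d ^ 2 := Real.sq_sqrt h0.le
    have h1 : q v₀ ≤ q (a / s, b / s, d / s) := hmin (by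
      change (a / s) ^ 2 + (b / s) ^ 2 + (d / s) ^ 2 = 1
      field_simp
      exact hs2.symm)
    rw [← hs2]
    have h2 : q (a / s, b / s, d / s) * s ^ 2 = p 0 * a ^ 2 + p 1 * b ^ 2 + p 2 * d ^ 2 +
        p 3 * (a * b) + p 4 * (a * d) + p 5 * (b * d) := by
      simp only [q]; field_simp
    rw [← h2]
    exact mul_le_mul_of_nonneg_right h1 (sq_nonneg s)

lemma integrable_quadratic {X : Type*} [MeasurableSpace X] {μ : Measure X}
    (hQsym : ∀ A, Q A = Q ((1 / 2 : ℝ) • (A + A.transpose)))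
    {F : X → Matrix (Fin 2) (Fin 2) ℝ} (hF : ∀ i j, MemLp (fun x => F x i j) 2 μ) :
    Integrable (fun x => Q (F x)) μ := by
  obtain ⟨p, hp⟩ := exists_quadratic_coeff hQsym
  have ho : MemLp (fun x => (F x 0 1 + F x 1 0) / 2) 2 μ := by
    simpa [div_eq_inv_mul] using ((hF 0 1).add (hF 1 0)).const_mul (2⁻¹ : ℝ)
  simp_rw [hp]
  exact ((((((hF 0 0).integrable_sq.const_mul _).add (ho.integrable_sq.const_mul _)).add
    ((hF 1 1).integrable_sq.const_mul _)).add ((integrable_mul_of_memLp (hF 0 0) ho).const_mul _)).add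
    ((integrable_mul_of_memLp (hF 0 0) (hF 1 1)).const_mul _)).add
    ((integrable_mul_of_memLp ho (hF 1 1)).const_mul _)

end quadratic

/-! ## Boundedness of functions in `W^{1,2}(I)` -/

section bounded

variable {l : ℝ} {f g : ℝ → ℝ}

/-- A primitive is constant on each side of the hull [α, β] of the support. The vanishing mean makes
the two constants equal, and subtracting them leaves a compactly supported primitive. -/
lemma exists_contDiff_primitive_of_integral_eq_zero {b : ℝ → ℝ} (hb : ContDiff ℝ ∞ b)
    (hc : HasCompactSupport b) (hs : tsupport b ⊆ interval l)
    (h0 : ∫ x in interval l, b x = 0) :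
    ∃ a : ℝ → ℝ, ContDiff ℝ ∞ a ∧ HasCompactSupport a ∧ tsupport a ⊆ interval l ∧ deriv a = b := by
  rcases (tsupport b).eq_empty_or_nonempty with he | hne
  · have : b = 0 := tsupport_eq_empty_iff.1 he
    exact ⟨0, contDiff_const, HasCompactSupport.zero, by simp, by rw [this]; ext; simp⟩
  obtain ⟨α, hα, hαm⟩ := hc.isCompact.exists_isLeast hne
  obtain ⟨β, hβ, hβm⟩ := hc.isCompact.exists_isGreatest hne
  have hαβ : α ≤ β := hαm hβ
  obtain ⟨a, ha, rfl⟩ := exists_contDiff_primitive hb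
  have hd : ∀ s t, ∫ x in s..t, deriv a x = a t - a s := fun s t =>
    intervalIntegral.integral_deriv_eq_sub (fun x _ => ha.differentiable (by simp) x)
      (hb.continuous.intervalIntegrable _ _)
  have hz : ∀ x, x ∉ Icc α β → deriv a x = 0 := fun x hx =>
    image_eq_zero_of_notMem_tsupport fun h => hx ⟨hαm h, hβm h⟩
  have h1 : ∀ x, x < α → a x = a α := fun x hx => by
    have : ∫ t in x..α, deriv a t = 0 := by
      rw [intervalIntegral.integral_of_le hx.le, integral_Ioc_eq_integral_Ioo]
      exact setIntegral_eq_zero_of_forall_eq_zero fun t ht => hz t fun h => absurd ht.2 (not_lt.2 h.1)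
    linarith [hd x α]
  have h2 : ∀ x, β < x → a x = a β := fun x hx => by
    have : ∫ t in β..x, deriv a t = 0 := by
      rw [intervalIntegral.integral_of_le hx.le]
      exact setIntegral_eq_zero_of_forall_eq_zero fun t ht => hz t fun h => absurd ht.1 (not_lt.2 h.2)
    linarith [hd β x]
  have h3 : a β = a α := by
    have e : ∫ x in interval l, deriv a x = ∫ x in α..β, deriv a x := by
      rw [intervalIntegral.integral_of_le hαβ, ← integral_Icc_eq_integral_Ioc,
        setIntegral_eq_integral_of_forall_compl_eq_zero,
        setIntegral_eq_integral_of_forall_compl_eq_zero (fun x hx => hz x hx)]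
      exact fun x hx => image_eq_zero_of_notMem_tsupport fun h => hx (hs h)
    rw [h0, hd] at e
    linarith
  have hsup : tsupport (fun x => a x - a α) ⊆ Icc α β := by
    refine closure_minimal (fun x hx => ?_) isClosed_Icc
    by_contra hx'
    rw [mem_Icc, not_and_or, not_le, not_le] at hx'
    refine hx ?_
    rcases hx' with h | h
    · simp [h1 x h]
    · simp [h2 x h, h3]
  refine ⟨fun x => a x - a α, ha.sub contDiff_const,
    isCompact_Icc.of_isClosed_subset (isClosed_tsupport _) hsup, hsup.trans ?_, ?_⟩
  · exact (ordConnected_Ioo (a := -l / 2) (b := l / 2)).out (hs hα) (hs hβ)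
  · ext x; simp

/-- The one-dimensional Sobolev embedding into L^∞: f minus the continuous primitive G of g has zero
weak derivative and is therefore constant. It is needed for the square of v̂′ to lie in L². -/
lemma HasWeakDeriv.exists_bound (hl : 0 < l) (h : HasWeakDeriv (interval l) 1 f g)
    (hg : MemL2 (interval l) g) : ∃ C, ∀ᵐ x ∂volume.restrict (interval l), |f x| ≤ C := by
  have hle : -l / 2 ≤ l / 2 := by linarith
  have hi : IntervalIntegrable g volume (-l / 2) (l / 2) := by
    rw [intervalIntegrable_iff_integrableOn_Ioo_of_le hle]
    exact hg.integrableOn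
  set G : ℝ → ℝ := fun x => ∫ t in (-l / 2)..x, g t with hG
  have conv : ∀ F : ℝ → ℝ, ∫ x in interval l, F x = ∫ x in (-l / 2)..(l / 2), F x := fun F => by
    rw [intervalIntegral.integral_of_le hle, interval, integral_Ioc_eq_integral_Ioo]
  have hac : AbsolutelyContinuousOnInterval G (-l / 2) (l / 2) :=
    hi.absolutelyContinuousOnInterval_intervalIntegral left_mem_uIcc
  have hGc : ContinuousOn G (Icc (-l / 2) (l / 2)) := by
    have := hac.continuousOn
    rwa [uIcc_of_le hle] at this
  have mG : LocallyIntegrableOn G (interval l) :=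
    ((hGc.integrableOn_Icc).mono_set Ioo_subset_Icc_self).locallyIntegrableOn
  have mfG : LocallyIntegrableOn (fun x => f x - G x) (interval l) := h.1.sub mG
  have hbase : ∀ a : ℝ → ℝ, ContDiff ℝ ∞ a → HasCompactSupport a → tsupport a ⊆ interval l →
      ∫ x in interval l, (f x - G x) * deriv a x = 0 := fun a ha hac' has => by
    have haac : AbsolutelyContinuousOnInterval a (-l / 2) (l / 2) :=
      (ha.of_le (by simp)).contDiffOn.absolutelyContinuousOnInterval
    have z : ∀ x, x ∉ interval l → a x = 0 := fun x hx =>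
      image_eq_zero_of_notMem_tsupport fun hx' => hx (has hx')
    have ibp := hac.integral_mul_deriv_eq_deriv_mul haac
    rw [z (-l / 2) (by simp [interval]), z (l / 2) (by simp [interval]), mul_zero, mul_zero, sub_zero,
      zero_sub] at ibp
    have hd : ∫ x in (-l / 2)..(l / 2), deriv G x * a x = ∫ x in (-l / 2)..(l / 2), g x * a x := by
      refine intervalIntegral.integral_congr_ae ?_
      filter_upwards [hi.ae_hasDerivAt_integral] with x hx hx'
      rw [(hx (uIoc_subset_uIcc hx') _ left_mem_uIcc).deriv]
    have e := h.2.2 a ha hac' has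
    simp only [fderiv_apply_one_eq_deriv] at e
    rw [hd, ← conv, ← conv, ← e] at ibp
    have hdc : Continuous (deriv a) := ha.continuous_deriv (by simp)
    have hds : tsupport (deriv a) ⊆ interval l := fun x hx => has (tsupport_deriv_subset hx)
    simp only [sub_mul]
    rw [integral_sub (integrableOn_mul_of_tsupport (measurableSet_interval l) h.1 hdc hac'.deriv hds)
      (integrableOn_mul_of_tsupport (measurableSet_interval l) mG hdc hac'.deriv hds), ibp, sub_self]
  obtain ⟨η, hη, hηc, hηs, hη1⟩ : ∃ η : ℝ → ℝ, ContDiff ℝ ∞ η ∧ HasCompactSupport η ∧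
      tsupport η ⊆ interval l ∧ ∫ x in interval l, η x = 1 := by
    let b : ContDiffBump (0 : ℝ) := ⟨l / 8, l / 4, by positivity, by linarith⟩
    have hs : tsupport (b.normed volume) ⊆ interval l := by
      rw [b.tsupport_normed_eq, Real.closedBall_eq_Icc]
      intro x hx
      exact ⟨by have := hx.1; simp [b] at this; linarith, by have := hx.2; simp [b] at this; linarith⟩
    refine ⟨b.normed volume, b.contDiff_normed, b.hasCompactSupport_normed, hs, ?_⟩
    rw [setIntegral_eq_integral_of_forall_compl_eq_zero fun x hx =>
      image_eq_zero_of_notMem_tsupport fun h => hx (hs h)]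
    exact b.integral_normed
  set k := ∫ x in interval l, (f x - G x) * η x with hk
  have hfk := (isOpen_interval l).ae_eq_zero_of_integral_contDiff_smul_eq_zero (μ := volume)
    (f := fun x => f x - G x - k) (mfG.sub ((locallyIntegrable_const k).locallyIntegrableOn _))
    (fun b hb hbc hbs => by
      have ib : IntegrableOn b (interval l) := (hb.continuous.integrable_of_hasCompactSupport hbc).integrableOn
      have iη : IntegrableOn η (interval l) := (hη.continuous.integrable_of_hasCompactSupport hηc).integrableOn
      have i1 := integrableOn_mul_of_tsupport (measurableSet_interval l) mfG hb.continuous hbc hbs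
      have i2 := integrableOn_mul_of_tsupport (measurableSet_interval l) mfG hη.continuous hηc hηs
      -- Du Bois-Reymond's device: b − mη has mean zero, hence is the derivative of a test function;
      -- k is the constant that results.
      set m := ∫ x in interval l, b x with hm
      obtain ⟨a, ha, hac', has, had⟩ := exists_contDiff_primitive_of_integral_eq_zero (l := l)
        (b := fun x => b x - m * η x) (hb.sub (contDiff_const.mul hη)) (hbc.sub hηc.mul_left)
        ((tsupport_sub b fun x => m * η x).trans
          (union_subset hbs ((tsupport_mul_subset_right (f := fun _ => m)).trans hηs)))
        (by rw [integral_sub ib (iη.const_mul m), integral_const_mul, hη1]; ring)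
      have h1 := hbase a ha hac' has
      have e1 : ∫ x in interval l, (f x - G x) * deriv a x =
          (∫ x in interval l, (f x - G x) * b x) - m * k := by
        rw [hk, ← integral_const_mul, ← integral_sub i1 (i2.const_mul m), had]
        refine integral_congr_ae (Eventually.of_forall fun x => ?_)
        simp only; ring
      rw [← setIntegral_eq_integral_of_forall_compl_eq_zero (s := interval l)]
      · have e2 : ∫ x in interval l, b x • (f x - G x - k) =
            (∫ x in interval l, (f x - G x) * b x) - k * m := by
          rw [hm, ← integral_const_mul, ← integral_sub i1 (ib.const_mul k)]
          refine integral_congr_ae (Eventually.of_forall fun x => ?_)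
          simp only [smul_eq_mul]; ring
        rw [e2]; linarith
      · intro x hx
        rw [image_eq_zero_of_notMem_tsupport fun hx' => hx (hbs hx'), zero_smul])
  obtain ⟨C, hC⟩ := isCompact_Icc.exists_bound_of_continuousOn hGc
  refine ⟨C + |k|, ?_⟩
  rw [ae_restrict_iff' (measurableSet_interval l)]
  filter_upwards [hfk] with x hx hxI
  have e : f x = G x + k := by linarith [hx hxI]
  rw [e]
  exact (abs_add_le _ _).trans (add_le_add (hC x (Ioo_subset_Icc_self hxI)) le_rfl)

lemma memLp_sq_of_bound {X : Type*} [MeasurableSpace X] {μ : Measure X} {f : X → ℝ} {C : ℝ}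
    (hf : MemLp f 2 μ) (hC : ∀ᵐ x ∂μ, |f x| ≤ C) : MemLp (fun x => f x ^ 2) 2 μ := by
  refine (hf.const_mul C).mono (hf.1.pow 2) ?_
  filter_upwards [hC] with x hx
  rw [Real.norm_eq_abs, Real.norm_eq_abs, abs_mul, abs_pow, pow_two]
  exact mul_le_mul_of_nonneg_right (hx.trans (le_abs_self C)) (abs_nonneg _)

end bounded

/-! ## A priori estimates for scaled displacements -/

/-- The scaled displacements of a thin plate together with their derivatives: `q` is the scaled
gradient and `h` the scaled Hessian of the deflection `w`, and `yᵢⱼ = ∂ⱼ yᵢ`. -/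
structure Fields where
  (w q₁ q₂ h₁₁ h₁₂ h₂₂ y₁ y₂ y₁₁ y₁₂ y₂₁ y₂₂ : ℝ × ℝ → ℝ)

/-- Boundary data `v` for the deflection and `a`, `b` for the in-plane displacement, with their
derivatives. -/
structure BdryData where
  (v v₁ v₂ a a₁ a₂ b b₁ : ℝ × ℝ → ℝ)

/-- The differential relations and the boundary conditions satisfied by scaled displacements. -/
structure IsScaled (l ε : ℝ) (B : BdryData) (F : Fields) : Prop where
  w : HasLat l (fun x => F.w x - B.v x) (fun x => F.q₁ x - B.v₁ x) (fun x => ε * F.q₂ x)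
  q₁ : HasLat l (fun x => F.q₁ x - B.v₁ x) (fun x => F.h₁₁ x - B.v₂ x) (fun x => ε * F.h₁₂ x)
  q₂ : HasLat l F.q₂ F.h₁₂ (fun x => ε * F.h₂₂ x)
  y₁ : HasLat l (fun x => F.y₁ x - B.a x) (fun x => F.y₁₁ x - B.a₁ x) (fun x => F.y₁₂ x - B.a₂ x)
  y₂ : HasLat l (fun x => F.y₂ x - B.b x) (fun x => F.y₂₁ x - B.b₁ x) F.y₂₂
  h₂₂ : MemL2 (plate l 1) F.h₂₂

/-- The `L²` norm on the reference plate. -/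
abbrev pnrm (l : ℝ) (f : ℝ × ℝ → ℝ) : ℝ := nrm (volume.restrict (plate l 1)) f

/-- Quantitative bounds for the boundary data. -/
structure BdryData.Bounded (l D : ℝ) (B : BdryData) : Prop where
  one_le : 1 ≤ D
  l_le : l ≤ D
  one : pnrm l (fun _ => 1) ≤ D
  korn : 1026 + 147456 * l ^ 2 ≤ D ^ 2
  v : MemL2 (plate l 1) B.v ∧ pnrm l B.v ≤ D
  v₁ : MemL2 (plate l 1) B.v₁ ∧ pnrm l B.v₁ ≤ D
  v₁sq : MemL2 (plate l 1) (fun x => B.v₁ x ^ 2) ∧ pnrm l (fun x => B.v₁ x ^ 2) ≤ D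
  v₂ : MemL2 (plate l 1) B.v₂ ∧ pnrm l B.v₂ ≤ D
  a : MemL2 (plate l 1) B.a ∧ pnrm l B.a ≤ D
  a₁ : MemL2 (plate l 1) B.a₁ ∧ pnrm l B.a₁ ≤ D
  a₂ : MemL2 (plate l 1) B.a₂ ∧ pnrm l B.a₂ ≤ D
  b : MemL2 (plate l 1) B.b ∧ pnrm l B.b ≤ D
  b₁ : MemL2 (plate l 1) B.b₁ ∧ pnrm l B.b₁ ≤ D

section apriori

variable {l ε D : ℝ} {B : BdryData} {F : Fields}

/-- The entries of the scaled nonlinear strain `E + ½ q ⊗ q`. -/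
def Fields.p₁₁ (F : Fields) (x : ℝ × ℝ) : ℝ := F.y₁₁ x + F.q₁ x ^ 2 / 2

/-- The off-diagonal entry of the scaled linear strain. -/
def Fields.e₁₂ (F : Fields) (ε : ℝ) (x : ℝ × ℝ) : ℝ := 1 / (2 * ε) * (F.y₂₁ x + F.y₁₂ x)

/-- The entries of the scaled nonlinear strain `E + ½ q ⊗ q`. -/
def Fields.p₁₂ (F : Fields) (ε : ℝ) (x : ℝ × ℝ) : ℝ := F.e₁₂ ε x + F.q₁ x * F.q₂ x / 2

/-- The transversal entry of the scaled linear strain. -/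
def Fields.e₂₂ (F : Fields) (ε : ℝ) (x : ℝ × ℝ) : ℝ := 1 / ε ^ 2 * F.y₂₂ x

/-- The entries of the scaled nonlinear strain `E + ½ q ⊗ q`. -/
def Fields.p₂₂ (F : Fields) (ε : ℝ) (x : ℝ × ℝ) : ℝ := F.e₂₂ ε x + F.q₂ x ^ 2 / 2

/-- All fields are square integrable. -/
structure Fields.MemL2 (l : ℝ) (F : Fields) : Prop where
  w : Ribbon.MemL2 (plate l 1) F.w
  q₁ : Ribbon.MemL2 (plate l 1) F.q₁
  q₂ : Ribbon.MemL2 (plate l 1) F.q₂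
  h₁₁ : Ribbon.MemL2 (plate l 1) F.h₁₁
  h₁₂ : Ribbon.MemL2 (plate l 1) F.h₁₂
  h₂₂ : Ribbon.MemL2 (plate l 1) F.h₂₂
  y₁ : Ribbon.MemL2 (plate l 1) F.y₁
  y₂ : Ribbon.MemL2 (plate l 1) F.y₂
  y₁₁ : Ribbon.MemL2 (plate l 1) F.y₁₁
  y₁₂ : Ribbon.MemL2 (plate l 1) F.y₁₂
  y₂₁ : Ribbon.MemL2 (plate l 1) F.y₂₁
  y₂₂ : Ribbon.MemL2 (plate l 1) F.y₂₂

lemma memL2_of_sub {f g : ℝ × ℝ → ℝ} (h : MemL2 (plate l 1) fun x => f x - g x)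
    (hg : MemL2 (plate l 1) g) : MemL2 (plate l 1) f := by
  have := MemLp.add h hg
  refine MemLp.ae_eq (Eventually.of_forall fun x => ?_) this
  simp

lemma IsScaled.memL2 (hB : B.Bounded l D) (hF : IsScaled l ε B F) : F.MemL2 l where
  w := memL2_of_sub hF.w.mem hB.v.1
  q₁ := memL2_of_sub hF.w.mem₀ hB.v₁.1
  q₂ := hF.q₂.mem
  h₁₁ := memL2_of_sub hF.q₁.mem₀ hB.v₂.1
  h₁₂ := hF.q₂.mem₀
  h₂₂ := hF.h₂₂
  y₁ := memL2_of_sub hF.y₁.mem hB.a.1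
  y₂ := memL2_of_sub hF.y₂.mem hB.b.1
  y₁₁ := memL2_of_sub hF.y₁.mem₀ hB.a₁.1
  y₁₂ := memL2_of_sub hF.y₁.mem₁ hB.a₂.1
  y₂₁ := memL2_of_sub hF.y₂.mem₀ hB.b₁.1
  y₂₂ := hF.y₂.mem₁

/-- Ladyzhenskaya's inequality applies only to q₁ − v₁, which has zero trace; the boundary datum
enters through its own square. -/
lemma IsScaled.memL2_sq₁ (hl : 0 < l) (hB : B.Bounded l D) (hF : IsScaled l ε B F) :
    MemL2 (plate l 1) (fun x => F.q₁ x ^ 2) ∧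
      pnrm l (fun x => F.q₁ x ^ 2) ≤ 2 * pnrm l (fun x => (F.q₁ x - B.v₁ x) ^ 2) + 2 * D := by
  have m := (hF.memL2 hB).q₁
  have h1 := (hF.q₁.memL2_sq hl rfl rfl rfl).1
  have h2 : MemL2 (plate l 1) fun x => 2 * (F.q₁ x - B.v₁ x) ^ 2 + 2 * B.v₁ x ^ 2 :=
    (h1.const_mul 2).add (hB.v₁sq.1.const_mul 2)
  have h3 : ∀ x, |F.q₁ x ^ 2| ≤ |2 * (F.q₁ x - B.v₁ x) ^ 2 + 2 * B.v₁ x ^ 2| := fun x => by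
    rw [abs_of_nonneg (by positivity), abs_of_nonneg (by positivity)]
    nlinarith [sq_nonneg (F.q₁ x - 2 * B.v₁ x)]
  refine ⟨MemLp.mono h2 (m.1.pow 2) (Eventually.of_forall h3),
    (nrm_mono h2 (Eventually.of_forall h3)).trans ?_⟩
  refine (nrm_add_le (h1.const_mul 2) (hB.v₁sq.1.const_mul 2)).trans ?_
  rw [nrm_const_mul, nrm_const_mul, abs_two]
  linarith [hB.v₁sq.2]

lemma memL2_mul_of_sq {f g : ℝ × ℝ → ℝ} (hf : MemL2 (plate l 1) f) (hg : MemL2 (plate l 1) g)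
    (hf2 : MemL2 (plate l 1) fun x => f x ^ 2) (hg2 : MemL2 (plate l 1) fun x => g x ^ 2) :
    MemL2 (plate l 1) (fun x => f x * g x) ∧ pnrm l (fun x => f x * g x) ≤
      (pnrm l (fun x => f x ^ 2) + pnrm l (fun x => g x ^ 2)) / 2 := by
  have h2 : MemL2 (plate l 1) fun x => (1 / 2 : ℝ) * (f x ^ 2 + g x ^ 2) :=
    (hf2.add hg2).const_mul _
  have h3 : ∀ x, |f x * g x| ≤ |(1 / 2 : ℝ) * (f x ^ 2 + g x ^ 2)| := fun x => by
    rw [abs_of_nonneg (by positivity : 0 ≤ (1 / 2 : ℝ) * (f x ^ 2 + g x ^ 2)), abs_le]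
    constructor <;> nlinarith [sq_nonneg (f x + g x), sq_nonneg (f x - g x)]
  refine ⟨MemLp.mono h2 (hf.1.mul hg.1) (Eventually.of_forall h3),
    (nrm_mono h2 (Eventually.of_forall h3)).trans ?_⟩
  rw [nrm_const_mul, abs_of_pos (by norm_num : (0 : ℝ) < 1 / 2)]
  linarith [nrm_add_le hf2 hg2]

lemma IsScaled.memL2_e₁₂ (hB : B.Bounded l D) (hF : IsScaled l ε B F) :
    MemL2 (plate l 1) (F.e₁₂ ε) :=
  ((hF.memL2 hB).y₂₁.add (hF.memL2 hB).y₁₂).const_mul _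

lemma memL2_div_two {f : ℝ × ℝ → ℝ} (hf : MemL2 (plate l 1) f) :
    MemL2 (plate l 1) fun x => f x / 2 := by
  simp only [div_eq_inv_mul]
  exact hf.const_mul (2⁻¹ : ℝ)

lemma nrm_div_two {X : Type*} [MeasurableSpace X] {μ : Measure X} (f : X → ℝ) :
    nrm μ (fun x => f x / 2) = nrm μ f / 2 := by
  have := nrm_const_mul (μ := μ) (1 / 2) f
  rw [abs_of_pos (by norm_num : (0 : ℝ) < 1 / 2)] at this
  rw [div_eq_inv_mul, ← one_div, ← this]
  congr 1; ext x; ring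

lemma IsScaled.memL2_strain (hl : 0 < l) (hB : B.Bounded l D) (hF : IsScaled l ε B F) :
    MemL2 (plate l 1) F.p₁₁ ∧ MemL2 (plate l 1) (F.p₁₂ ε) ∧ MemL2 (plate l 1) (F.p₂₂ ε) := by
  have m := hF.memL2 hB
  have s₁ := (hF.memL2_sq₁ hl hB).1
  have s₂ := (hF.q₂.memL2_sq hl rfl rfl rfl).1
  exact ⟨m.y₁₁.add (memL2_div_two s₁),
    (hF.memL2_e₁₂ hB).add (memL2_div_two (memL2_mul_of_sq m.q₁ m.q₂ s₁ s₂).1),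
    (m.y₂₂.const_mul _).add (memL2_div_two s₂)⟩

/-- The sum of the norms of the entries of the scaled nonlinear strain. -/
def Fields.P (F : Fields) (l ε : ℝ) : ℝ := pnrm l F.p₁₁ + pnrm l (F.p₁₂ ε) + pnrm l (F.p₂₂ ε)

/-- The sum of the norms of the entries of the scaled Hessian. -/
def Fields.H (F : Fields) (l : ℝ) : ℝ := pnrm l F.h₁₁ + pnrm l F.h₁₂ + pnrm l F.h₂₂

lemma nrm_le_sub_add {X : Type*} [MeasurableSpace X] {μ : Measure X} {f g : X → ℝ}
    (hf : MemLp (fun x => f x - g x) 2 μ) (hg : MemLp g 2 μ) :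
    nrm μ f ≤ nrm μ (fun x => f x - g x) + nrm μ g := by
  refine le_trans (le_of_eq ?_) (nrm_add_le hf hg)
  congr 1; ext x; ring

/-- Poincaré along the chain w, q₁, h₁₁ and along q₂, h₁₂ gives bounds linear in H. Ladyzhenskaya
for q₂ gives the quadratic one, where ε ≤ 1 tames the derivative ε h₂₂. -/
lemma IsScaled.bending (hl : 0 < l) (hε : 0 < ε) (hε1 : ε ≤ 1) (hB : B.Bounded l D)
    (hF : IsScaled l ε B F) :
    pnrm l (fun x => F.h₁₁ x - B.v₂ x) ≤ D * (1 + F.H l) ∧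
    pnrm l (fun x => F.q₁ x - B.v₁ x) ≤ D ^ 2 * (1 + F.H l) ∧
    pnrm l F.q₁ ≤ 2 * D ^ 2 * (1 + F.H l) ∧ pnrm l F.w ≤ 2 * D ^ 3 * (1 + F.H l) ∧
    pnrm l F.q₂ ≤ D * (1 + F.H l) ∧ pnrm l (fun x => F.q₂ x ^ 2) ≤ 3 * D ^ 2 * (1 + F.H l) ^ 2 := by
  have m := hF.memL2 hB
  have hD := hB.one_le
  have hH₁ := nrm_nonneg (volume.restrict (plate l 1)) F.h₁₁
  have hH₂ := nrm_nonneg (volume.restrict (plate l 1)) F.h₁₂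
  have hH₃ := nrm_nonneg (volume.restrict (plate l 1)) F.h₂₂
  have hHd : F.H l = pnrm l F.h₁₁ + pnrm l F.h₁₂ + pnrm l F.h₂₂ := rfl
  set H := F.H l
  have hH : 0 ≤ H := by rw [hHd]; positivity
  have i1 : pnrm l (fun x => F.h₁₁ x - B.v₂ x) ≤ D * (1 + H) := by
    have := nrm_sub_le m.h₁₁ hB.v₂.1
    have := hB.v₂.2
    nlinarith
  have i2 : pnrm l (fun x => F.q₁ x - B.v₁ x) ≤ D ^ 2 * (1 + H) := by
    refine (hF.q₁.nrm_le hl).trans ?_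
    calc l * _ ≤ D * (D * (1 + H)) := mul_le_mul hB.l_le i1 (nrm_nonneg _ _) (by linarith)
      _ = _ := by ring
  have hD2 : D ≤ D ^ 2 * (1 + H) := by nlinarith [mul_nonneg (sq_nonneg D) hH]
  have i3 : pnrm l F.q₁ ≤ 2 * D ^ 2 * (1 + H) := by
    have := nrm_le_sub_add hF.w.mem₀ hB.v₁.1
    have := hB.v₁.2
    linarith
  have i4 : pnrm l F.w ≤ 2 * D ^ 3 * (1 + H) := by
    have h1 := nrm_le_sub_add hF.w.mem hB.v.1
    have h2 := hB.v.2
    have h3 : pnrm l (fun x => F.w x - B.v x) ≤ D ^ 3 * (1 + H) := by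
      refine (hF.w.nrm_le hl).trans ?_
      calc l * _ ≤ D * (D ^ 2 * (1 + H)) := mul_le_mul hB.l_le i2 (nrm_nonneg _ _) (by linarith)
        _ = _ := by ring
    have h4 : D ≤ D ^ 3 * (1 + H) := by
      calc D ≤ D ^ 2 * (1 + H) := hD2
        _ ≤ D ^ 3 * (1 + H) := by gcongr; norm_num
    linarith
  have i5 : pnrm l F.q₂ ≤ D * (1 + H) := by
    refine (hF.q₂.nrm_le hl).trans ?_
    exact mul_le_mul hB.l_le (by linarith) (nrm_nonneg _ _) (by linarith)
  refine ⟨i1, i2, i3, i4, i5, ?_⟩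
  have h := (hF.q₂.memL2_sq hl rfl rfl rfl).2
  rw [nrm_const_mul, abs_of_pos hε] at h
  refine abs_le_of_sq_le_sq' (h.trans ?_) (by positivity) |>.2
  have e1 : ε * pnrm l F.h₂₂ ≤ 1 + H := by nlinarith
  have e2 : pnrm l F.h₁₂ ≤ 1 + H := by linarith
  have n2 := nrm_nonneg (volume.restrict (plate l 1)) F.q₂
  have hp : (0 : ℝ) ≤ 1 + H := by linarith
  calc _ ≤ ((D * (1 + H)) ^ 2 + 2 * ((D * (1 + H)) * (1 + H))) *
        (2 * ((D * (1 + H)) * (1 + H))) := by gcongr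
    _ = (2 * D ^ 3 + 4 * D ^ 2) * (1 + H) ^ 4 := by ring
    _ ≤ (9 * D ^ 4) * (1 + H) ^ 4 := by
      gcongr
      nlinarith [mul_nonneg (sq_nonneg D) (sub_nonneg.2 hD),
        mul_nonneg (mul_nonneg (sq_nonneg D) (by linarith : (0 : ℝ) ≤ D)) (sub_nonneg.2 hD)]
    _ = _ := by ring

/-- The key gain. The squared L² norm of q₁ is of order P because the mean of ∂₁y₁ is fixed by the
boundary data, so of the four factors in Ladyzhenskaya's inequality only two cost a power of H. Thus
‖(q₁ − v₁)²‖ is of order P^{1/2} H, total degree 3/2, below the degree 2 of the energy. -/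
lemma IsScaled.gradient (hl : 0 < l) (hε : 0 < ε) (hε1 : ε ≤ 1) (hB : B.Bounded l D)
    (hF : IsScaled l ε B F) :
    pnrm l (fun x => (F.q₁ x - B.v₁ x) ^ 2) ^ 2 ≤
      36 * D ^ 5 * (1 + F.P l ε) * (1 + F.H l) ^ 2 := by
  have m := hF.memL2 hB
  have hD := hB.one_le
  obtain ⟨i1, i2, -⟩ := hF.bending hl hε hε1 hB
  have hH₁ := nrm_nonneg (volume.restrict (plate l 1)) F.h₁₁
  have hH₂ := nrm_nonneg (volume.restrict (plate l 1)) F.h₁₂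
  have hH₃ := nrm_nonneg (volume.restrict (plate l 1)) F.h₂₂
  have hHd : F.H l = pnrm l F.h₁₁ + pnrm l F.h₁₂ + pnrm l F.h₂₂ := rfl
  set H := F.H l
  have hH : 0 ≤ H := by rw [hHd]; positivity
  have hP₁ := nrm_nonneg (volume.restrict (plate l 1)) F.p₁₁
  have hP₂ := nrm_nonneg (volume.restrict (plate l 1)) (F.p₁₂ ε)
  have hP₃ := nrm_nonneg (volume.restrict (plate l 1)) (F.p₂₂ ε)
  have hPd : F.P l ε = pnrm l F.p₁₁ + pnrm l (F.p₁₂ ε) + pnrm l (F.p₂₂ ε) := rfl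
  set P := F.P l ε
  have hP : 0 ≤ P := by rw [hPd]; positivity
  have m1 : MemL2 (plate l 1) fun _ => (1 : ℝ) := memLp_const 1
  -- The trace identity of y₁ with constant test function gives ∫ y₁₁ = ∫ a₁, and q₁² = 2 (p₁₁ −
  -- y₁₁).
  have e1 : pnrm l F.q₁ ^ 2 = 2 * (∫ x in plate l 1, F.p₁₁ x * 1) - 2 * ∫ x in plate l 1, B.a₁ x * 1 := by
    have h0 := hF.y₁.deriv₀ (fun _ => 1) contDiff_const
    simp only [fderiv_fun_const, Pi.zero_apply, zero_apply, mul_zero,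
      integral_zero, mul_one] at h0
    have h1 : ∫ x in plate l 1, F.y₁₁ x = ∫ x in plate l 1, B.a₁ x := by
      rw [integral_sub m.y₁₁.integrableOn hB.a₁.1.integrableOn] at h0
      linarith
    have h2 : ∫ x in plate l 1, F.p₁₁ x =
        (∫ x in plate l 1, F.y₁₁ x) + ∫ x in plate l 1, F.q₁ x ^ 2 / 2 := by
      simp only [Fields.p₁₁]
      exact integral_add m.y₁₁.integrableOn (m.q₁.integrable_sq.div_const 2)
    rw [integral_div] at h2
    simp only [mul_one]
    rw [nrm_sq m.q₁, h2, h1]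
    ring
  have mp := (hF.memL2_strain hl hB).1
  have b1 := (abs_le.1 (abs_integral_mul_le mp m1)).2
  have b2 := (abs_le.1 (abs_integral_mul_le hB.a₁.1 m1)).1
  have n1 := nrm_nonneg (volume.restrict (plate l 1)) fun _ => (1 : ℝ)
  have na := nrm_nonneg (volume.restrict (plate l 1)) B.a₁
  have e2 : pnrm l F.q₁ ^ 2 ≤ 2 * D ^ 2 * (1 + P) := by
    have c1 : pnrm l F.p₁₁ * pnrm l (fun _ => 1) ≤ P * D :=
      mul_le_mul (by linarith) hB.one n1 hP
    have c2 : pnrm l B.a₁ * pnrm l (fun _ => 1) ≤ D * D :=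
      mul_le_mul hB.a₁.2 hB.one n1 (by linarith)
    have c3 : P * D ≤ P * D ^ 2 := mul_le_mul_of_nonneg_left (by nlinarith) hP
    simp only [pnrm] at c1 c2 e1 ⊢
    nlinarith
  have e3 : pnrm l (fun x => F.q₁ x - B.v₁ x) ^ 2 ≤ 6 * D ^ 2 * (1 + P) := by
    have c1 := nrm_sub_le m.q₁ hB.v₁.1
    have c2 := hB.v₁.2
    have n0 := nrm_nonneg (volume.restrict (plate l 1)) (fun x => F.q₁ x - B.v₁ x)
    have nq := nrm_nonneg (volume.restrict (plate l 1)) F.q₁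
    have c3 : pnrm l (fun x => F.q₁ x - B.v₁ x) ^ 2 ≤ (pnrm l F.q₁ + D) ^ 2 :=
      pow_le_pow_left₀ n0 (by linarith) 2
    have c4 := mul_nonneg (sq_nonneg D) hP
    nlinarith [sq_nonneg (pnrm l F.q₁ - D)]
  have h := (hF.q₁.memL2_sq hl rfl rfl rfl).2
  rw [nrm_const_mul, abs_of_pos hε] at h
  refine h.trans ?_
  have e4 : ε * pnrm l F.h₁₂ ≤ 1 + H := by nlinarith
  have n0 := nrm_nonneg (volume.restrict (plate l 1)) (fun x => F.q₁ x - B.v₁ x)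
  have n3 := nrm_nonneg (volume.restrict (plate l 1)) (fun x => F.h₁₁ x - B.v₂ x)
  have hp : (0 : ℝ) ≤ 1 + H := by linarith
  have e5 : pnrm l (fun x => F.q₁ x - B.v₁ x) + 2 * (ε * pnrm l F.h₁₂) ≤ 3 * D ^ 2 * (1 + H) := by
    have : 1 + H ≤ D ^ 2 * (1 + H) := le_mul_of_one_le_left hp (by nlinarith)
    linarith
  -- The regrouping that isolates n₀², the quantity bounded through P.
  calc _ = pnrm l (fun x => F.q₁ x - B.v₁ x) ^ 2 *
        (pnrm l (fun x => F.q₁ x - B.v₁ x) + 2 * (ε * pnrm l F.h₁₂)) *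
        (2 * pnrm l (fun x => F.h₁₁ x - B.v₂ x)) := by simp only [pnrm]; ring
    _ ≤ (6 * D ^ 2 * (1 + P)) * (3 * D ^ 2 * (1 + H)) * (2 * (D * (1 + H))) := by gcongr
    _ = _ := by ring

lemma sum_sq_le_sq_sum {a b c : ℝ} (ha : 0 ≤ a) (hb : 0 ≤ b) (hc : 0 ≤ c) :
    a ^ 2 + b ^ 2 + c ^ 2 ≤ (a + b + c) ^ 2 := by
  nlinarith [mul_nonneg ha hb, mul_nonneg ha hc, mul_nonneg hb hc]

/-- The sum of the norms of the entries of the linear strain of `y`. -/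
def Fields.linearStrain (F : Fields) (l : ℝ) : ℝ :=
  pnrm l F.y₁₁ + pnrm l F.y₂₂ + pnrm l (fun x => F.y₂₁ x + F.y₁₂ x)

/-- Korn and Poincaré require zero traces, so they are applied after subtracting the data a and b,
which costs multiples of D. Korn's constant is at most D², whence the factor D after taking the
root. -/
lemma IsScaled.korn (hl : 0 < l) (hB : B.Bounded l D) (hF : IsScaled l ε B F) :
    pnrm l F.y₁₂ ≤ D * (F.linearStrain l + 3 * D) + D ∧
      pnrm l F.y₂₁ ≤ D * (F.linearStrain l + 3 * D) + D ∧
      pnrm l F.y₁ ≤ D * F.linearStrain l + 2 * D ^ 2 ∧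
      pnrm l F.y₂ ≤ D ^ 2 * F.linearStrain l + 4 * D ^ 3 := by
  have m := hF.memL2 hB
  have hD := hB.one_le
  have n11 := nrm_nonneg (volume.restrict (plate l 1)) F.y₁₁
  have n22 := nrm_nonneg (volume.restrict (plate l 1)) F.y₂₂
  have nd := nrm_nonneg (volume.restrict (plate l 1)) (fun x => F.y₂₁ x + F.y₁₂ x)
  have kA : pnrm l (fun x => F.y₁₁ x - B.a₁ x) ≤ pnrm l F.y₁₁ + D :=
    (nrm_sub_le m.y₁₁ hB.a₁.1).trans (by linarith [hB.a₁.2])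
  have kD : pnrm l (fun x => F.y₂₁ x - B.b₁ x + (F.y₁₂ x - B.a₂ x)) ≤
      pnrm l (fun x => F.y₂₁ x + F.y₁₂ x) + 2 * D := by
    have e : (fun x => F.y₂₁ x - B.b₁ x + (F.y₁₂ x - B.a₂ x)) =
        fun x => (F.y₂₁ x + F.y₁₂ x) - (B.b₁ x + B.a₂ x) := by ext x; ring
    rw [e]
    have h1 := nrm_sub_le (m.y₂₁.add m.y₁₂) (hB.b₁.1.add hB.a₂.1)
    have h2 := nrm_add_le hB.b₁.1 hB.a₂.1
    have := hB.b₁.2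
    have := hB.a₂.2
    refine le_trans h1 ?_
    refine add_le_add le_rfl (h2.trans ?_)
    linarith
  have he : F.linearStrain l = pnrm l F.y₁₁ + pnrm l F.y₂₂ + pnrm l (fun x => F.y₂₁ x + F.y₁₂ x) := rfl
  set e := F.linearStrain l
  have he0 : 0 ≤ e := by rw [he]; positivity
  have hk := Ribbon.korn hl hF.y₁ hF.y₂ rfl rfl rfl
  have kk : pnrm l (fun x => F.y₂₁ x - B.b₁ x) ^ 2 + pnrm l (fun x => F.y₁₂ x - B.a₂ x) ^ 2 ≤
      (D * (e + 3 * D)) ^ 2 := by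
    refine hk.trans ?_
    have nA := nrm_nonneg (volume.restrict (plate l 1)) (fun x => F.y₁₁ x - B.a₁ x)
    have nD := nrm_nonneg (volume.restrict (plate l 1))
      (fun x => F.y₂₁ x - B.b₁ x + (F.y₁₂ x - B.a₂ x))
    have c1 : pnrm l (fun x => F.y₁₁ x - B.a₁ x) ^ 2 + pnrm l F.y₂₂ ^ 2 +
        pnrm l (fun x => F.y₂₁ x - B.b₁ x + (F.y₁₂ x - B.a₂ x)) ^ 2 ≤ (e + 3 * D) ^ 2 := by
      have c2 : pnrm l (fun x => F.y₁₁ x - B.a₁ x) + pnrm l F.y₂₂ +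
        pnrm l (fun x => F.y₂₁ x - B.b₁ x + (F.y₁₂ x - B.a₂ x)) ≤ e + 3 * D := by linarith
      refine le_trans ?_ (pow_le_pow_left₀ (by positivity) c2 2)
      exact sum_sq_le_sq_sum nA n22 nD
    rw [mul_pow]
    exact mul_le_mul hB.korn c1 (by positivity) (by positivity)
  have hpos : 0 ≤ D * (e + 3 * D) := by positivity
  have k21 : pnrm l (fun x => F.y₂₁ x - B.b₁ x) ≤ D * (e + 3 * D) :=
    (abs_le_of_sq_le_sq' (by nlinarith [sq_nonneg (pnrm l (fun x => F.y₁₂ x - B.a₂ x))]) hpos).2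
  have k12 : pnrm l (fun x => F.y₁₂ x - B.a₂ x) ≤ D * (e + 3 * D) :=
    (abs_le_of_sq_le_sq' (by nlinarith [sq_nonneg (pnrm l (fun x => F.y₂₁ x - B.b₁ x))]) hpos).2
  refine ⟨?_, ?_, ?_, ?_⟩
  · have := nrm_le_sub_add hF.y₁.mem₁ hB.a₂.1
    linarith [hB.a₂.2]
  · have := nrm_le_sub_add hF.y₂.mem₀ hB.b₁.1
    linarith [hB.b₁.2]
  · have h1 := nrm_le_sub_add hF.y₁.mem hB.a.1
    have h2 : pnrm l (fun x => F.y₁ x - B.a x) ≤ D * (e + D) :=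
      (hF.y₁.nrm_le hl).trans (mul_le_mul hB.l_le (by linarith) (nrm_nonneg _ _) (by linarith))
    have := hB.a.2
    nlinarith
  · have h1 := nrm_le_sub_add hF.y₂.mem hB.b.1
    have h2 : pnrm l (fun x => F.y₂ x - B.b x) ≤ D * (D * (e + 3 * D)) :=
      (hF.y₂.nrm_le hl).trans (mul_le_mul hB.l_le k21 (nrm_nonneg _ _) (by linarith))
    have h3 := hB.b.2
    have h4 : D ≤ D ^ 3 := by nlinarith [mul_nonneg (sub_nonneg.2 hD) (by nlinarith : 0 ≤ D ^ 2 + D)]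
    nlinarith

/-- Each linear strain entry is the nonlinear one minus a product of gradients, with q₁q₂ split by
Young. In the linear strain of y the entries are y₁₁, 2ε e₁₂ and ε² e₂₂, so q₂² carries a factor ε,
whereas the scaled entries e₁₂ and e₂₂ retain the full order H². The witness ρ is ‖(q₁ − v₁)²‖. -/
lemma IsScaled.stretching (hl : 0 < l) (hε : 0 < ε) (hε1 : ε ≤ 1) (hB : B.Bounded l D)
    (hF : IsScaled l ε B F) :
    ∃ ρ : ℝ, 0 ≤ ρ ∧ ρ ^ 2 ≤ 36 * D ^ 5 * (1 + F.P l ε) * (1 + F.H l) ^ 2 ∧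
      F.linearStrain l ≤ 2 * F.P l ε + (2 * ρ + 2 * D) + 3 * ε * D ^ 2 * (1 + F.H l) ^ 2 ∧
      pnrm l (F.e₁₂ ε) ≤ F.P l ε + (2 * ρ + 2 * D) + 3 * D ^ 2 * (1 + F.H l) ^ 2 ∧
      pnrm l (F.e₂₂ ε) ≤ F.P l ε + 3 * D ^ 2 * (1 + F.H l) ^ 2 := by
  have m := hF.memL2 hB
  have hD := hB.one_le
  obtain ⟨-, -, -, -, -, s2⟩ := hF.bending hl hε hε1 hB
  have hg := hF.gradient hl hε hε1 hB
  obtain ⟨ms1, s1⟩ := hF.memL2_sq₁ hl hB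
  have ms2 := (hF.q₂.memL2_sq hl rfl rfl rfl).1
  obtain ⟨mm, s12⟩ := memL2_mul_of_sq m.q₁ m.q₂ ms1 ms2
  obtain ⟨mp1, mp2, mp3⟩ := hF.memL2_strain hl hB
  have hP₁ := nrm_nonneg (volume.restrict (plate l 1)) F.p₁₁
  have hP₂ := nrm_nonneg (volume.restrict (plate l 1)) (F.p₁₂ ε)
  have hP₃ := nrm_nonneg (volume.restrict (plate l 1)) (F.p₂₂ ε)
  have hPd : F.P l ε = pnrm l F.p₁₁ + pnrm l (F.p₁₂ ε) + pnrm l (F.p₂₂ ε) := rfl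
  set P := F.P l ε
  set Z := 3 * D ^ 2 * (1 + F.H l) ^ 2 with hZ
  have hZ0 : 0 ≤ Z := by positivity
  set ρ := pnrm l (fun x => (F.q₁ x - B.v₁ x) ^ 2) with hρ
  have hρ0 : 0 ≤ ρ := nrm_nonneg _ _
  have hT0 : 0 ≤ 2 * ρ + 2 * D := by linarith
  have a11 : pnrm l F.y₁₁ ≤ pnrm l F.p₁₁ + (2 * ρ + 2 * D) / 2 := by
    have h := nrm_sub_le mp1 (memL2_div_two ms1)
    rw [nrm_div_two] at h
    have e : (fun x => F.p₁₁ x - F.q₁ x ^ 2 / 2) = F.y₁₁ := by ext x; simp [Fields.p₁₁]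
    rw [e] at h
    linarith
  have b22 : pnrm l (F.e₂₂ ε) ≤ pnrm l (F.p₂₂ ε) + Z / 2 := by
    have h := nrm_sub_le mp3 (memL2_div_two ms2)
    rw [nrm_div_two] at h
    have e : (fun x => F.p₂₂ ε x - F.q₂ x ^ 2 / 2) = F.e₂₂ ε := by ext x; simp [Fields.p₂₂]
    rw [e] at h
    linarith
  have a22 : pnrm l F.y₂₂ ≤ pnrm l (F.p₂₂ ε) + ε * (Z / 2) := by
    have h := b22
    unfold Fields.e₂₂ at h
    rw [pnrm, nrm_const_mul, abs_of_pos (by positivity)] at h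
    have h' : pnrm l F.y₂₂ ≤ ε ^ 2 * (pnrm l (F.p₂₂ ε) + Z / 2) := by
      have : 1 / ε ^ 2 * pnrm l F.y₂₂ ≤ pnrm l (F.p₂₂ ε) + Z / 2 := by linarith
      rw [one_div_mul_eq_div, div_le_iff₀ (by positivity)] at this
      linarith
    have c1 : ε ^ 2 * pnrm l (F.p₂₂ ε) ≤ 1 * pnrm l (F.p₂₂ ε) :=
      mul_le_mul_of_nonneg_right (by nlinarith) hP₃
    have c2 : ε ^ 2 * (Z / 2) ≤ ε * (Z / 2) :=
      mul_le_mul_of_nonneg_right (by nlinarith) (by linarith)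
    linarith
  have a12 : pnrm l (F.e₁₂ ε) ≤ pnrm l (F.p₁₂ ε) + (2 * ρ + 2 * D) / 4 + Z / 4 := by
    have h := nrm_sub_le mp2 (memL2_div_two mm)
    rw [nrm_div_two] at h
    have e : (fun x => F.p₁₂ ε x - F.q₁ x * F.q₂ x / 2) = F.e₁₂ ε := by ext x; simp [Fields.p₁₂]
    rw [e] at h
    linarith
  have ad : pnrm l (fun x => F.y₂₁ x + F.y₁₂ x) ≤
      2 * pnrm l (F.p₁₂ ε) + (2 * ρ + 2 * D) / 2 + ε * (Z / 2) := by
    have e : (fun x => F.y₂₁ x + F.y₁₂ x) = fun x => (2 * ε) * F.e₁₂ ε x := by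
      ext x; simp only [Fields.e₁₂]; field_simp
    rw [e, pnrm, nrm_const_mul, abs_of_pos (by positivity)]
    have c1 : 2 * ε * pnrm l (F.e₁₂ ε) ≤
        2 * ε * (pnrm l (F.p₁₂ ε) + (2 * ρ + 2 * D) / 4 + Z / 4) :=
      mul_le_mul_of_nonneg_left a12 (by positivity)
    have c2 : ε * (2 * pnrm l (F.p₁₂ ε) + (2 * ρ + 2 * D) / 2) ≤
        1 * (2 * pnrm l (F.p₁₂ ε) + (2 * ρ + 2 * D) / 2) :=
      mul_le_mul_of_nonneg_right hε1 (by positivity)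
    linarith
  refine ⟨ρ, hρ0, hg, ?_, by linarith, by linarith⟩
  have : 3 * ε * D ^ 2 * (1 + F.H l) ^ 2 = ε * Z := by rw [hZ]; ring
  rw [this, Fields.linearStrain]
  have := mul_nonneg hε.le hZ0
  linarith

end apriori

/-! ### Uniform bounds by absorbing the loads into the energy. -/

section uniform

variable {l ε D : ℝ} {B : BdryData} {F : Fields}

/-- Pure algebra: the load is linear in P, H and e. The dangerous part 4D³ρ of e is split by Young
into (c/8)(1 + H)² plus a multiple of 1 + P, and the part ε H² is below (c/8)(1 + H)² for small ε.
The coercive term dominates what remains. -/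
lemma exists_bound_of_quadratic_le {c : ℝ} (hD : 1 ≤ D) (hc : 0 < c) :
    ∃ R ε₀ : ℝ, 0 ≤ R ∧ 0 < ε₀ ∧ ε₀ ≤ 1 ∧ ∀ ε P H ρ e : ℝ, 0 < ε → ε ≤ ε₀ → 0 ≤ P → 0 ≤ H → 0 ≤ ρ →
      0 ≤ e → ρ ^ 2 ≤ 36 * D ^ 5 * (1 + P) * (1 + H) ^ 2 →
      e ≤ 2 * P + (2 * ρ + 2 * D) + 3 * ε * D ^ 2 * (1 + H) ^ 2 →
      c * (P ^ 2 + H ^ 2) ≤ D + D * (2 * D ^ 3 * (1 + H) + (D * e + 2 * D ^ 2) +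
        (D ^ 2 * e + 4 * D ^ 3)) → P ≤ R ∧ H ≤ R := by
  have hD0 : 0 < D := by linarith
  -- K is the Young weight: 16D⁶ · 36D⁵ = 4 · (c/8) · K.
  obtain ⟨K, hK⟩ : ∃ K, K = 1152 * D ^ 11 / c := ⟨_, rfl⟩
  have hK0 : 0 ≤ K := by rw [hK]; positivity
  obtain ⟨A, hA⟩ : ∃ A, A = D + 2 * D ^ 4 + 6 * D ^ 4 + 4 * D ^ 4 + K + c := ⟨_, rfl⟩
  obtain ⟨N, hN⟩ : ∃ N, N = 2 * D ^ 4 + 4 * D ^ 3 + K := ⟨_, rfl⟩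
  have hA0 : 0 ≤ A := by rw [hA]; positivity
  have hN0 : 0 ≤ N := by rw [hN]; positivity
  -- The summand 1 ensures P + H ≥ 1 in the contradiction, so that A ≤ A (P + H). The threshold
  -- c/(48D⁵) gives 6εD⁵ ≤ c/8.
  refine ⟨4 * (A + N) / c + 1, min 1 (c / (48 * D ^ 5)), by positivity, by positivity, min_le_left _ _,
    fun ε P H ρ e hε hε0 hP hH hρ he hρ2 he2 hE => ?_⟩
  have h1 : 6 * ε * D ^ 5 ≤ c / 8 := by
    have := hε0.trans (min_le_right _ _)
    rw [le_div_iff₀ (by positivity)] at this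
    linarith
  have h2 : 4 * D ^ 3 * ρ ≤ c / 8 * (1 + H) ^ 2 + K * (1 + P) := by
    refine (abs_le_of_sq_le_sq' ?_ (by positivity)).2
    have e1 : (4 * D ^ 3 * ρ) ^ 2 ≤ 16 * D ^ 6 * (36 * D ^ 5 * (1 + P) * (1 + H) ^ 2) := by
      calc _ = 16 * D ^ 6 * ρ ^ 2 := by ring
        _ ≤ _ := by gcongr
    have e2 : 16 * D ^ 6 * (36 * D ^ 5 * (1 + P) * (1 + H) ^ 2) =
        4 * ((c / 8 * (1 + H) ^ 2) * (K * (1 + P))) := by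
      rw [hK]; field_simp; ring
    nlinarith [sq_nonneg (c / 8 * (1 + H) ^ 2 - K * (1 + P))]
  have h3 : (1 + H) ^ 2 ≤ 2 + 2 * H ^ 2 := by nlinarith [sq_nonneg (1 - H)]
  have h4 : D * (D * e) ≤ D ^ 3 * e := by
    have : D ^ 2 * e ≤ D ^ 3 * e := mul_le_mul_of_nonneg_right
      (pow_le_pow_right₀ hD (by norm_num)) he
    linarith
  have h5 : D * (D * e) + D * (D ^ 2 * e) ≤ 4 * D ^ 3 * P + 4 * D ^ 3 * ρ + 4 * D ^ 4 +
      c / 8 * (1 + H) ^ 2 := by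
    have e1 : 2 * D ^ 3 * e ≤
        2 * D ^ 3 * (2 * P + (2 * ρ + 2 * D) + 3 * ε * D ^ 2 * (1 + H) ^ 2) := by gcongr
    have e2 : 6 * ε * D ^ 5 * (1 + H) ^ 2 ≤ c / 8 * (1 + H) ^ 2 := by gcongr
    linarith
  have h6 : D * (2 * D ^ 2) ≤ 2 * D ^ 4 := by
    have : D ^ 3 ≤ D ^ 4 := pow_le_pow_right₀ hD (by norm_num)
    linarith
  have h7 : c / 2 * (P ^ 2 + H ^ 2) ≤ A + N * (P + H) := by
    have e3 : c / 4 * (1 + H) ^ 2 ≤ c / 4 * (2 + 2 * H ^ 2) := by gcongr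
    have e4 : 0 ≤ c * P ^ 2 := by positivity
    have e5 : 0 ≤ D ^ 3 * H := by positivity
    have e6 : 0 ≤ D ^ 4 * P := by positivity
    have e7 : 0 ≤ K * H := by positivity
    rw [hA, hN]
    linarith
  have h8 : P + H ≤ 4 * (A + N) / c + 1 := by
    by_contra! hlt
    have s1 : 1 ≤ P + H := le_trans (by
      have : 0 ≤ 4 * (A + N) / c := by positivity
      linarith) hlt.le
    have s2 : 4 * (A + N) < c * (P + H) := by
      have : 4 * (A + N) / c < P + H := by linarith
      rw [div_lt_iff₀ hc] at this
      linarith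
    have s3 : 4 * (A + N) * (P + H) < c * (P + H) * (P + H) :=
      mul_lt_mul_of_pos_right s2 (by linarith)
    have s4 : A ≤ A * (P + H) := le_mul_of_one_le_right hA0 s1
    nlinarith [mul_nonneg hc.le (sq_nonneg (P - H))]
  constructor <;> linarith

/-- All fields and the strain entries have norm at most `R`. -/
structure Fields.BoundedBy (F : Fields) (l ε R : ℝ) : Prop where
  w : pnrm l F.w ≤ R
  q₁ : pnrm l F.q₁ ≤ R
  q₂ : pnrm l F.q₂ ≤ R
  h₁₁ : pnrm l F.h₁₁ ≤ R
  h₁₂ : pnrm l F.h₁₂ ≤ R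
  h₂₂ : pnrm l F.h₂₂ ≤ R
  y₁ : pnrm l F.y₁ ≤ R
  y₂ : pnrm l F.y₂ ≤ R
  y₁₁ : pnrm l F.y₁₁ ≤ R
  y₁₂ : pnrm l F.y₁₂ ≤ R
  y₂₁ : pnrm l F.y₂₁ ≤ R
  y₂₂ : pnrm l F.y₂₂ ≤ R
  e₁₂ : pnrm l (F.e₁₂ ε) ≤ R
  e₂₂ : pnrm l (F.e₂₂ ε) ≤ R

lemma exists_boundedBy (hl : 0 < l) (hB : B.Bounded l D) {c : ℝ} (hc : 0 < c) :
    ∃ R ε₀ : ℝ, 0 < ε₀ ∧ ∀ ε F, 0 < ε → ε ≤ ε₀ → IsScaled l ε B F →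
      c * (F.P l ε ^ 2 + F.H l ^ 2) ≤ D + D * (pnrm l F.w + pnrm l F.y₁ + pnrm l F.y₂) →
      F.BoundedBy l ε R := by
  have hD := hB.one_le
  have hD0 : 0 < D := by linarith
  obtain ⟨R, ε₀, hR, hε₀, hε₀1, key⟩ := exists_bound_of_quadratic_le hD hc
  -- S bounds ρ itself through ρ ≤ ρ² + 1, which avoids a square root.
  obtain ⟨S, hS⟩ : ∃ S, S = 36 * D ^ 5 * (1 + R) * (1 + R) ^ 2 + 1 := ⟨_, rfl⟩
  obtain ⟨Z, hZ⟩ : ∃ Z, Z = 2 * R + (2 * S + 2 * D) + 3 * D ^ 2 * (1 + R) ^ 2 := ⟨_, rfl⟩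
  have hS0 : 0 ≤ S := by rw [hS]; positivity
  have hZ0 : 0 ≤ Z := by rw [hZ]; positivity
  obtain ⟨T₁, hT₁⟩ : ∃ T, T = 2 * D ^ 3 * (1 + R) := ⟨_, rfl⟩
  obtain ⟨T₂, hT₂⟩ : ∃ T, T = 2 * D ^ 2 * (1 + R) := ⟨_, rfl⟩
  obtain ⟨T₃, hT₃⟩ : ∃ T, T = D * (1 + R) := ⟨_, rfl⟩
  obtain ⟨T₄, hT₄⟩ : ∃ T, T = D * (Z + 3 * D) + D := ⟨_, rfl⟩
  obtain ⟨T₅, hT₅⟩ : ∃ T, T = D * Z + 2 * D ^ 2 := ⟨_, rfl⟩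
  obtain ⟨T₆, hT₆⟩ : ∃ T, T = D ^ 2 * Z + 4 * D ^ 3 := ⟨_, rfl⟩
  have p1 : 0 ≤ T₁ := by rw [hT₁]; positivity
  have p2 : 0 ≤ T₂ := by rw [hT₂]; positivity
  have p3 : 0 ≤ T₃ := by rw [hT₃]; positivity
  have p4 : 0 ≤ T₄ := by rw [hT₄]; positivity
  have p5 : 0 ≤ T₅ := by rw [hT₅]; positivity
  have p6 : 0 ≤ T₆ := by rw [hT₆]; positivity
  obtain ⟨X, hX⟩ : ∃ X, X = T₁ + T₂ + T₃ + R + Z + T₄ + T₅ + T₆ := ⟨_, rfl⟩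
  refine ⟨X, ε₀, hε₀, fun ε F hε hεle hF hE => ?_⟩
  have hε1 := hεle.trans hε₀1
  obtain ⟨-, -, bq₁, bw, bq₂, -⟩ := hF.bending hl hε hε1 hB
  obtain ⟨ρ, hρ, hρ2, he, he₁₂, he₂₂⟩ := hF.stretching hl hε hε1 hB
  obtain ⟨k12, k21, k1, k2⟩ := hF.korn hl hB
  have n11 := nrm_nonneg (volume.restrict (plate l 1)) F.y₁₁
  have n22 := nrm_nonneg (volume.restrict (plate l 1)) F.y₂₂
  have nd := nrm_nonneg (volume.restrict (plate l 1)) (fun x => F.y₂₁ x + F.y₁₂ x)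
  have hLd : F.linearStrain l = pnrm l F.y₁₁ + pnrm l F.y₂₂ +
    pnrm l (fun x => F.y₂₁ x + F.y₁₂ x) := rfl
  have hH₁ := nrm_nonneg (volume.restrict (plate l 1)) F.h₁₁
  have hH₂ := nrm_nonneg (volume.restrict (plate l 1)) F.h₁₂
  have hH₃ := nrm_nonneg (volume.restrict (plate l 1)) F.h₂₂
  have hHd : F.H l = pnrm l F.h₁₁ + pnrm l F.h₁₂ + pnrm l F.h₂₂ := rfl
  have hP₁ := nrm_nonneg (volume.restrict (plate l 1)) F.p₁₁
  have hP₂ := nrm_nonneg (volume.restrict (plate l 1)) (F.p₁₂ ε)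
  have hP₃ := nrm_nonneg (volume.restrict (plate l 1)) (F.p₂₂ ε)
  have hPd : F.P l ε = pnrm l F.p₁₁ + pnrm l (F.p₁₂ ε) + pnrm l (F.p₂₂ ε) := rfl
  have hH0 : 0 ≤ F.H l := by rw [hHd]; positivity
  have hP0 : 0 ≤ F.P l ε := by rw [hPd]; positivity
  have hL0 : 0 ≤ F.linearStrain l := by rw [hLd]; positivity
  obtain ⟨hPR, hHR⟩ := key ε (F.P l ε) (F.H l) ρ (F.linearStrain l) hε hεle hP0 hH0 hρ hL0 hρ2 he
    (hE.trans (by gcongr))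
  have hρS : ρ ≤ S := by
    have : 36 * D ^ 5 * (1 + F.P l ε) * (1 + F.H l) ^ 2 ≤ 36 * D ^ 5 * (1 + R) * (1 + R) ^ 2 := by
      gcongr
    have h1 : ρ ≤ ρ ^ 2 + 1 := by nlinarith only [sq_nonneg (ρ - 1)]
    linarith only [h1, hρ2, this, hS]
  have hq : 3 * D ^ 2 * (1 + F.H l) ^ 2 ≤ 3 * D ^ 2 * (1 + R) ^ 2 := by gcongr
  have hLZ : F.linearStrain l ≤ Z := by
    have : 3 * ε * D ^ 2 * (1 + F.H l) ^ 2 ≤ 3 * 1 * D ^ 2 * (1 + R) ^ 2 := by gcongr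
    rw [hZ]; linarith only [this, he, hPR, hρS, hR]
  have c1 : 2 * D ^ 3 * (1 + F.H l) ≤ T₁ := by rw [hT₁]; gcongr
  have c2 : 2 * D ^ 2 * (1 + F.H l) ≤ T₂ := by rw [hT₂]; gcongr
  have c3 : D * (1 + F.H l) ≤ T₃ := by rw [hT₃]; gcongr
  have c4 : D * (F.linearStrain l + 3 * D) + D ≤ T₄ := by rw [hT₄]; gcongr
  have c5 : D * F.linearStrain l + 2 * D ^ 2 ≤ T₅ := by rw [hT₅]; gcongr
  have c6 : D ^ 2 * F.linearStrain l + 4 * D ^ 3 ≤ T₆ := by rw [hT₆]; gcongr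
  have c7 : F.P l ε + (2 * ρ + 2 * D) + 3 * D ^ 2 * (1 + F.H l) ^ 2 ≤ Z := by
    rw [hZ]; linarith only [hPR, hρS, hq, hR]
  have c8 : F.P l ε + 3 * D ^ 2 * (1 + F.H l) ^ 2 ≤ Z := by
    linarith only [hZ, hPR, hq, hS0, hR, hD0]
  have xR : R ≤ X := by linarith only [hX, p1, p2, p3, p4, p5, p6, hZ0]
  have xZ : Z ≤ X := by linarith only [hX, p1, p2, p3, p4, p5, p6, hR]
  have x1 : T₁ ≤ X := by linarith only [hX, p1, p2, p3, p4, p5, p6, hR, hZ0]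
  have x2 : T₂ ≤ X := by linarith only [hX, p1, p2, p3, p4, p5, p6, hR, hZ0]
  have x3 : T₃ ≤ X := by linarith only [hX, p1, p2, p3, p4, p5, p6, hR, hZ0]
  have x4 : T₄ ≤ X := by linarith only [hX, p1, p2, p3, p4, p5, p6, hR, hZ0]
  have x5 : T₅ ≤ X := by linarith only [hX, p1, p2, p3, p4, p5, p6, hR, hZ0]
  have x6 : T₆ ≤ X := by linarith only [hX, p1, p2, p3, p4, p5, p6, hR, hZ0]
  exact
    { w := (bw.trans c1).trans x1
      q₁ := (bq₁.trans c2).trans x2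
      q₂ := (bq₂.trans c3).trans x3
      h₁₁ := by linarith only [hHd, hHR, hH₁, hH₂, hH₃, xR]
      h₁₂ := by linarith only [hHd, hHR, hH₁, hH₂, hH₃, xR]
      h₂₂ := by linarith only [hHd, hHR, hH₁, hH₂, hH₃, xR]
      y₁ := (k1.trans c5).trans x5
      y₂ := (k2.trans c6).trans x6
      y₁₁ := by linarith only [hLd, hLZ, n11, n22, nd, xZ]
      y₁₂ := (k12.trans c4).trans x4
      y₂₁ := (k21.trans c4).trans x4
      y₂₂ := by linarith only [hLd, hLZ, n11, n22, nd, xZ]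
      e₁₂ := (he₁₂.trans c7).trans xZ
      e₂₂ := (he₂₂.trans c8).trans xZ }

end uniform

/-! ## The scaled fields of an admissible displacement -/

section fields

variable {l ε : ℝ} {uhat₁ uhat₂ vhat : ℝ → ℝ} {u : Fin 2 → ℝ × ℝ → ℝ} {v : ℝ × ℝ → ℝ}

/-- The scaled fields of a displacement `(u, v)` of the plate of width `ε`. -/
def scaledFields (l ε : ℝ) (u : Fin 2 → ℝ × ℝ → ℝ) (v : ℝ × ℝ → ℝ) : Fields where
  w := rescale ε v
  q₁ := rescale ε (pd (plate l ε) 0 v)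
  q₂ := rescale ε (pd (plate l ε) 1 v)
  h₁₁ := rescale ε (pd (plate l ε) 0 (pd (plate l ε) 0 v))
  h₁₂ := rescale ε (pd (plate l ε) 1 (pd (plate l ε) 0 v))
  h₂₂ := rescale ε (pd (plate l ε) 1 (pd (plate l ε) 1 v))
  y₁ := rescale ε (u 0)
  y₂ := fun x => ε * rescale ε (u 1) x
  y₁₁ := rescale ε (pd (plate l ε) 0 (u 0))
  y₁₂ := fun x => ε * rescale ε (pd (plate l ε) 1 (u 0)) x
  y₂₁ := fun x => ε * rescale ε (pd (plate l ε) 0 (u 1)) x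
  y₂₂ := fun x => ε * (ε * rescale ε (pd (plate l ε) 1 (u 1)) x)

/-- The boundary data on the reference plate. -/
def bdryData (l : ℝ) (uhat₁ uhat₂ vhat : ℝ → ℝ) : BdryData where
  v := fun x => vhat x.1
  v₁ := fun x => D1 l vhat x.1
  v₂ := fun x => D1 l (D1 l vhat) x.1
  a := fun x => uhat₁ x.1 - x.2 * D1 l uhat₂ x.1
  a₁ := fun x => D1 l uhat₁ x.1 - x.2 * D1 l (D1 l uhat₂) x.1
  a₂ := fun x => - D1 l uhat₂ x.1
  b := fun x => uhat₂ x.1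
  b₁ := fun x => D1 l uhat₂ x.1

/-- A single constant, at least 1, serves for the data, the length, Korn's constant and the external
bound C, which will collect the load norms and the energy level. -/
lemma exists_bounded_bdryData (hl : 0 < l) (huhat₁ : MemW12I l uhat₁) (huhat₂ : MemW22I l uhat₂)
    (hvhat : MemW22I l vhat) (C : ℝ) : ∃ D, C ≤ D ∧ (bdryData l uhat₁ uhat₂ vhat).Bounded l D := by
  have mv : MemL2 (plate l 1) fun x => vhat x.1 := memL2_fst hvhat.1.1
  have mv₁ : MemL2 (plate l 1) fun x => D1 l vhat x.1 := memL2_fst hvhat.2.1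
  have mv₂ : MemL2 (plate l 1) fun x => D1 l (D1 l vhat) x.1 := memL2_fst hvhat.2.memL2_D1
  have mv₁s : MemL2 (plate l 1) fun x => D1 l vhat x.1 ^ 2 := by
    obtain ⟨K, hK⟩ := hvhat.2.hasWeakDeriv.exists_bound hl hvhat.2.memL2_D1
    exact memL2_fst (f := fun s => D1 l vhat s ^ 2) (memLp_sq_of_bound hvhat.2.1 hK)
  have ma : MemL2 (plate l 1) fun x => uhat₁ x.1 - x.2 * D1 l uhat₂ x.1 := by
    have := MemLp.sub (memL2_fst (ε := 1) huhat₁.1) (memL2_mul_prod (ε := 1) huhat₂.2.1 continuous_id)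
    exact this.ae_eq (Eventually.of_forall fun x => by simp [mul_comm])
  have ma₁ : MemL2 (plate l 1) fun x => D1 l uhat₁ x.1 - x.2 * D1 l (D1 l uhat₂) x.1 := by
    have := MemLp.sub (memL2_fst (ε := 1) huhat₁.memL2_D1)
      (memL2_mul_prod (ε := 1) huhat₂.2.memL2_D1 continuous_id)
    exact this.ae_eq (Eventually.of_forall fun x => by simp [mul_comm])
  have ma₂ : MemL2 (plate l 1) fun x => - D1 l uhat₂ x.1 := (memL2_fst (ε := 1) huhat₂.2.1).neg
  have mb : MemL2 (plate l 1) fun x => uhat₂ x.1 := memL2_fst huhat₂.1.1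
  have mb₁ : MemL2 (plate l 1) fun x => D1 l uhat₂ x.1 := memL2_fst huhat₂.2.1
  have nn : ∀ f, 0 ≤ pnrm l f := fun f => nrm_nonneg _ f
  obtain ⟨S, hS⟩ : ∃ S, S = 1 + |C| + l + pnrm l (fun _ => 1) + (1026 + 147456 * l ^ 2) +
    pnrm l (fun x => vhat x.1) + pnrm l (fun x => D1 l vhat x.1) +
    pnrm l (fun x => D1 l (D1 l vhat) x.1) + pnrm l (fun x => D1 l vhat x.1 ^ 2) +
    pnrm l (fun x => uhat₁ x.1 - x.2 * D1 l uhat₂ x.1) +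
    pnrm l (fun x => D1 l uhat₁ x.1 - x.2 * D1 l (D1 l uhat₂) x.1) +
    pnrm l (fun x => - D1 l uhat₂ x.1) + pnrm l (fun x => uhat₂ x.1) +
    pnrm l (fun x => D1 l uhat₂ x.1) := ⟨_, rfl⟩
  have n1 := nn fun _ => 1
  have n2 := nn fun x => vhat x.1
  have n3 := nn fun x => D1 l vhat x.1
  have n4 := nn fun x => D1 l (D1 l vhat) x.1
  have n5 := nn fun x => D1 l vhat x.1 ^ 2
  have n6 := nn fun x => uhat₁ x.1 - x.2 * D1 l uhat₂ x.1
  have n7 := nn fun x => D1 l uhat₁ x.1 - x.2 * D1 l (D1 l uhat₂) x.1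
  have n8 := nn fun x => - D1 l uhat₂ x.1
  have n9 := nn fun x => uhat₂ x.1
  have n10 := nn fun x => D1 l uhat₂ x.1
  have n11 := abs_nonneg C
  have n12 := sq_nonneg l
  have hS1 : 1 ≤ S := by linarith
  refine ⟨S, by linarith [le_abs_self C], hS1, by linarith, by linarith, ?_,
    ⟨mv, ?_⟩, ⟨mv₁, ?_⟩, ⟨mv₁s, ?_⟩, ⟨mv₂, ?_⟩, ⟨ma, ?_⟩, ⟨ma₁, ?_⟩, ⟨ma₂, ?_⟩, ⟨mb, ?_⟩, ⟨mb₁, ?_⟩⟩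
  -- The requirement on Korn's constant is against D², so D ≥ 1 suffices.
  · have : S ≤ S ^ 2 := le_self_pow₀ hS1 two_ne_zero
    refine le_trans ?_ this
    linarith
  all_goals (simp only [bdryData]; linarith)

lemma hasLat_of_lateralTraceEq (hl : 0 < l) (hε : 0 < ε) {f g g₀ g₁ : ℝ × ℝ → ℝ}
    (hf : MemW12 (plate l ε) f) (ht : LateralTraceEq l ε f g) (mg : MemL2 (plate l ε) g)
    (mg₀ : MemL2 (plate l ε) g₀) (mg₁ : MemL2 (plate l ε) g₁)
    (h₀ : HasWeakDeriv (plate l ε) (dir 0) g g₀) (h₁ : HasWeakDeriv (plate l ε) (dir 1) g g₁) :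
    HasLat l (fun x => rescale ε f x - rescale ε g x)
      (fun x => rescale ε (pd (plate l ε) 0 f) x - rescale ε g₀ x)
      (fun x => ε * (rescale ε (pd (plate l ε) 1 f) x - rescale ε g₁ x)) := by
  have hΩ := measurableSet_plate l ε
  have hO := isOpen_plate l ε
  have d₀ := (hf.hasWeakDeriv_pd 0).sub hΩ h₀
  have d₁ := (hf.hasWeakDeriv_pd 1).sub hΩ h₁
  have hm : MemW12 (plate l ε) fun x => f x - g x :=
    memW12_of_hasWeakDeriv (hf.1.sub mg) d₀ d₁ ((hf.memL2_pd hO 0).sub mg₀)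
      ((hf.memL2_pd hO 1).sub mg₁)
  refine (hasLat_rescale hl hε hm ht).congr (EventuallyEq.refl _ _)
    (ae_rescale hε (d₀.weakDeriv_ae_eq hO)) ?_
  filter_upwards [ae_rescale hε (d₁.weakDeriv_ae_eq hO)] with x hx
  simp only [rescale, pd] at hx ⊢
  rw [hx]

lemma isScaled_scaledFields (hl : 0 < l) (hε : 0 < ε) (huhat₁ : MemW12I l uhat₁)
    (huhat₂ : MemW22I l uhat₂) (hvhat : MemW22I l vhat)
    (h : Admissible l ε uhat₁ uhat₂ vhat u v) :
    IsScaled l ε (bdryData l uhat₁ uhat₂ vhat) (scaledFields l ε u v) := by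
  have hO := isOpen_plate l ε
  have zero : MemL2 (plate l ε) fun _ => 0 := MemLp.zero
  have hw : HasLat l (fun x => rescale ε v x - vhat x.1)
      (fun x => rescale ε (pd (plate l ε) 0 v) x - D1 l vhat x.1)
      (fun x => ε * rescale ε (pd (plate l ε) 1 v) x) := by
    have := hasLat_of_lateralTraceEq hl hε h.v_mem.1 h.v_bdry (memL2_fst hvhat.1.1)
      (memL2_fst hvhat.1.memL2_D1) zero (hvhat.1.hasWeakDeriv.fst hvhat.1.1 hvhat.1.memL2_D1)
      (hasWeakDeriv_fst_snd hvhat.1.1)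
    simpa [rescale] using this
  have hq : HasLat l (fun x => rescale ε (pd (plate l ε) 0 v) x - D1 l vhat x.1)
      (fun x => rescale ε (pd (plate l ε) 0 (pd (plate l ε) 0 v)) x - D1 l (D1 l vhat) x.1)
      (fun x => ε * rescale ε (pd (plate l ε) 1 (pd (plate l ε) 0 v)) x) := by
    have := hasLat_of_lateralTraceEq hl hε (h.v_mem.2 0) h.dv_bdry (memL2_fst hvhat.2.1)
      (memL2_fst hvhat.2.memL2_D1) zero (hvhat.2.hasWeakDeriv.fst hvhat.2.1 hvhat.2.memL2_D1)
      (hasWeakDeriv_fst_snd hvhat.2.1)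
    simpa [rescale] using this
  have hv₁ := h.v_mem.2 1
  refine ⟨hw, hq, ?_, ?_, ?_, memL2_rescale hε (hv₁.memL2_pd hO 1)⟩
  -- No boundary condition is imposed on ∂₂v. The zero trace of ε q₂ = ∂₂(w − v̂) follows from those
  -- of w − v̂ and q₁ − v̂′, and is then divided by ε.
  · have d := hasWeakDeriv_rescale hε (hv₁.hasWeakDeriv_pd 1) hv₁.1 (hv₁.memL2_pd hO 1)
    have := (hw.deriv₁_hasLat hl hq (d.const_mul ε)
      (((memL2_rescale hε (hv₁.memL2_pd hO 1)).const_mul _).const_mul ε)).const_mul ε⁻¹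
    simpa [inv_mul_cancel_left₀ hε.ne', scaledFields] using this
  · have mp : ∀ {f : ℝ → ℝ}, MemL2 (interval l) f → MemL2 (plate l ε) fun x => f x.1 * (x.2 / ε) :=
      fun hf => memL2_mul_prod (h := fun t => t / ε) hf (by fun_prop)
    have hh : ContDiff ℝ ∞ fun t : ℝ => t / ε := contDiff_id.div_const ε
    have e : ∀ f : ℝ × ℝ → ℝ, (fun x : ℝ × ℝ => uhat₁ x.1 - x.2 / ε * D1 l uhat₂ x.1) =
        fun x => uhat₁ x.1 - D1 l uhat₂ x.1 * (x.2 / ε) := fun _ => by ext x; ring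
    have ht := h.u_bdry₁
    rw [e 0] at ht
    have d0 := (huhat₁.hasWeakDeriv.fst (ε := ε) huhat₁.1 huhat₁.memL2_D1).sub
      (measurableSet_plate l ε) (huhat₂.2.hasWeakDeriv.mul_prod_fst (ε := ε) huhat₂.2.1
        huhat₂.2.memL2_D1 hh.continuous)
    have d1 := (hasWeakDeriv_fst_snd (ε := ε) huhat₁.1).sub (measurableSet_plate l ε)
      (hasWeakDeriv_mul_prod_snd (ε := ε) huhat₂.2.1 hh)
    have := hasLat_of_lateralTraceEq hl hε (h.u_mem 0) ht ((memL2_fst huhat₁.1).sub (mp huhat₂.2.1))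
      ((memL2_fst huhat₁.memL2_D1).sub (mp huhat₂.2.memL2_D1))
      (zero.sub (memL2_mul_prod huhat₂.2.1 (hh.continuous_deriv (by simp)))) d0 d1
    refine this.congr (Eventually.of_forall fun x => ?_) (Eventually.of_forall fun x => ?_)
      (Eventually.of_forall fun x => ?_) <;>
    simp only [rescale, bdryData, scaledFields, Pi.sub_apply, deriv_div_const, deriv_id''] <;> field_simp <;> ring
  · have ht := h.u_bdry₂
    have e : (fun x : ℝ × ℝ => 1 / ε * uhat₂ x.1) = fun x => uhat₂ x.1 * (1 / ε) := by ext x; ring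
    rw [e] at ht
    have d0 := huhat₂.1.hasWeakDeriv.mul_prod_fst (ε := ε) (h := fun _ => 1 / ε) huhat₂.1.1
        huhat₂.1.memL2_D1 continuous_const
    have d1 := hasWeakDeriv_mul_prod_snd (ε := ε) (h := fun _ => 1 / ε) huhat₂.1.1 contDiff_const
    have := (hasLat_of_lateralTraceEq hl hε (h.u_mem 1) ht
      (memL2_mul_prod (h := fun _ => 1 / ε) huhat₂.1.1 continuous_const)
      (memL2_mul_prod (h := fun _ => 1 / ε) huhat₂.1.memL2_D1 continuous_const)
      (memL2_mul_prod huhat₂.1.1 (by simpa using continuous_const)) d0 d1).const_mul ε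
    refine this.congr (Eventually.of_forall fun x => ?_) (Eventually.of_forall fun x => ?_)
      (Eventually.of_forall fun x => ?_) <;>
    simp only [rescale, bdryData, scaledFields, deriv_const', mul_zero, sub_zero] <;> field_simp

/-- The relation for q₂ already identifies its x₁-derivative as h₁₂, defined with the opposite order
of differentiation; uniqueness gives the symmetry of the Hessian. -/
lemma rescale_hess_comm (hε : 0 < ε) (h : MemW22 (plate l ε) v)
    (hF : IsScaled l ε (bdryData l uhat₁ uhat₂ vhat) (scaledFields l ε u v)) :
    rescale ε (pd (plate l ε) 0 (pd (plate l ε) 1 v)) =ᵐ[volume.restrict (plate l 1)]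
      rescale ε (pd (plate l ε) 1 (pd (plate l ε) 0 v)) := by
  have d := hasWeakDeriv_rescale hε ((h.2 1).hasWeakDeriv_pd 0) (h.2 1).1
    ((h.2 1).memL2_pd (isOpen_plate l ε) 0)
  simp only [Matrix.cons_val_zero, one_mul] at d
  exact d.ae_eq (isOpen_plate l 1) hF.q₂.hasWeakDeriv₀

lemma integral_add_three {X : Type*} [MeasurableSpace X] {μ : Measure X} {f g h : X → ℝ}
    (hf : Integrable f μ) (hg : Integrable g μ) (hh : Integrable h μ) :
    ∫ x, (f x + g x + h x) ∂μ = ∫ x, f x ∂μ + ∫ x, g x ∂μ + ∫ x, h x ∂μ := by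
  have := integral_add (hf.add hg) hh
  rw [← integral_add hf hg]
  exact this

/-- On the fixed plate the factor 1/ε disappears and the integrands become Q of the scaled strain
and Hessian. The constant c/72 is 1/24 from the bending term times c/3 from passing from squares of
norms to the square of their sum; the stretching term has the larger weight 1/6. -/
lemma energy_lower_bound (hl : 0 < l) (hε : 0 < ε)
    {Q : QuadraticForm ℝ (Matrix (Fin 2) (Fin 2) ℝ)}
    (hQsym : ∀ A, Q A = Q ((1 / 2 : ℝ) • (A + A.transpose))) {c D K : ℝ} (hc : 0 < c)
    (hQ : ∀ A, c * (A 0 0 ^ 2 + ((A 0 1 + A 1 0) / 2) ^ 2 + A 1 1 ^ 2) ≤ Q A)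
    (hB : (bdryData l uhat₁ uhat₂ vhat).Bounded l D)
    (h : Admissible l ε uhat₁ uhat₂ vhat u v)
    (hF : IsScaled l ε (bdryData l uhat₁ uhat₂ vhat) (scaledFields l ε u v))
    {f : ℝ × ℝ → ℝ} {g : Fin 2 → ℝ × ℝ → ℝ}
    (hf : MemL2 (plate l ε) f) (hg : ∀ i, MemL2 (plate l ε) (g i))
    (hfK : pnrm l (rescale ε f) ≤ K) (hgK₀ : pnrm l (rescale ε (g 0)) ≤ K)
    (hgK₁ : pnrm l (fun x => 1 / ε * rescale ε (g 1) x) ≤ K) :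
    c / 72 * ((scaledFields l ε u v).P l ε ^ 2 + (scaledFields l ε u v).H l ^ 2) ≤
      energy Q l ε f g u v + K * (pnrm l (scaledFields l ε u v).w +
        pnrm l (scaledFields l ε u v).y₁ + pnrm l (scaledFields l ε u v).y₂) := by
  have m := hF.memL2 hB
  obtain ⟨mp₁, mp₂, mp₃⟩ := hF.memL2_strain hl hB
  have hcomm := rescale_hess_comm hε h.v_mem hF
  set F := scaledFields l ε u v with hFd
  set μ := (volume.restrict (plate l 1) : Measure (ℝ × ℝ)) with hμ
  have bound : ∀ {A : ℝ × ℝ → Matrix (Fin 2) (Fin 2) ℝ} {a b d : ℝ × ℝ → ℝ} {κ : ℝ}, 0 ≤ κ →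
      MemLp a 2 μ → MemLp b 2 μ → MemLp d 2 μ → (∀ i j, MemLp (fun x => A x i j) 2 μ) →
      (∀ᵐ x ∂μ, A x 0 0 = a x ∧ (A x 0 1 + A x 1 0) / 2 = b x ∧ A x 1 1 = d x) →
      κ * (c / 3 * (nrm μ a + nrm μ b + nrm μ d) ^ 2) ≤ ∫ x, κ * Q (A x) ∂μ := by
    intro A a b d κ hκ ma mb md mA hA
    rw [integral_const_mul]
    refine mul_le_mul_of_nonneg_left ?_ hκ
    have e1 : c * (nrm μ a ^ 2 + nrm μ b ^ 2 + nrm μ d ^ 2) ≤ ∫ x, Q (A x) ∂μ := by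
      rw [nrm_sq ma, nrm_sq mb, nrm_sq md, ← integral_add_three ma.integrable_sq mb.integrable_sq
        md.integrable_sq, ← integral_const_mul]
      refine integral_mono_ae (((ma.integrable_sq.add mb.integrable_sq).add md.integrable_sq).const_mul c)
        (integrable_quadratic hQsym mA) ?_
      filter_upwards [hA] with x hx
      have := hQ (A x)
      rwa [hx.1, hx.2.1, hx.2.2] at this
    refine le_trans ?_ e1
    have e2 : (nrm μ a + nrm μ b + nrm μ d) ^ 2 ≤ 3 * (nrm μ a ^ 2 + nrm μ b ^ 2 + nrm μ d ^ 2) := by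
      nlinarith [sq_nonneg (nrm μ a - nrm μ b), sq_nonneg (nrm μ a - nrm μ d),
        sq_nonneg (nrm μ b - nrm μ d)]
    nlinarith
  have i1 := integral_rescale (l := l) hε fun x => (1 / 2) * Q (strain (plate l ε) u x +
      (1 / 2 : ℝ) • Matrix.vecMulVec (grad (plate l ε) v x) (grad (plate l ε) v x))
  have i2 := integral_rescale (l := l) hε fun x => (1 / 24) * Q (hess (plate l ε) v x)
  have i3 := integral_rescale (l := l) hε fun x => f x * v x + ∑ i, g i x * u i x
  have b1 := bound (κ := 1 / 2) (A := fun x : ℝ × ℝ => strain (plate l ε) u (x.1, ε * x.2) +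
      (1 / 2 : ℝ) • Matrix.vecMulVec (grad (plate l ε) v (x.1, ε * x.2))
        (grad (plate l ε) v (x.1, ε * x.2))) (by norm_num) mp₁ mp₂ mp₃ (fun i j => by
      have o : ∀ x : ℝ × ℝ, F.p₁₂ ε x = (pd (plate l ε) 1 (u 0) (x.1, ε * x.2) +
          pd (plate l ε) 0 (u 1) (x.1, ε * x.2)) / 2 +
            1 / 2 * (pd (plate l ε) 0 v (x.1, ε * x.2) * pd (plate l ε) 1 v (x.1, ε * x.2)) := by
        intro x
        simp only [Fields.p₁₂, Fields.e₁₂, hFd, scaledFields, rescale]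
        field_simp; ring
      fin_cases i <;> fin_cases j
      · refine mp₁.ae_eq (Eventually.of_forall fun x => ?_)
        simp [Fields.p₁₁, hFd, scaledFields, rescale, strain, grad, Matrix.vecMulVec_apply]; ring
      · refine mp₂.ae_eq (Eventually.of_forall fun x => ?_)
        simp [o, strain, grad, Matrix.vecMulVec_apply]
      · refine mp₂.ae_eq (Eventually.of_forall fun x => ?_)
        simp [o, strain, grad, Matrix.vecMulVec_apply]; ring
      · refine mp₃.ae_eq (Eventually.of_forall fun x => ?_)
        simp [Fields.p₂₂, Fields.e₂₂, hFd, scaledFields, rescale, strain, grad, Matrix.vecMulVec_apply]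
        field_simp)
    (Eventually.of_forall fun x => by
      refine ⟨?_, ?_, ?_⟩
      · simp [Fields.p₁₁, hFd, scaledFields, rescale, strain, grad, Matrix.vecMulVec_apply]; ring
      · simp [Fields.p₁₂, Fields.e₁₂, hFd, scaledFields, rescale, strain, grad,
          Matrix.vecMulVec_apply]
        field_simp; ring
      · simp [Fields.p₂₂, Fields.e₂₂, hFd, scaledFields, rescale, strain, grad, Matrix.vecMulVec_apply]
        field_simp)
  have b2 := bound (κ := 1 / 24) (A := fun x : ℝ × ℝ => hess (plate l ε) v (x.1, ε * x.2))
    (by norm_num) m.h₁₁ m.h₁₂ m.h₂₂ (fun i j => by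
      fin_cases i <;> fin_cases j
      · exact m.h₁₁
      · exact m.h₁₂.ae_eq hcomm.symm
      · exact m.h₁₂
      · exact m.h₂₂)
    (by
      filter_upwards [hcomm] with x hx
      refine ⟨rfl, ?_, rfl⟩
      simp only [rescale] at hx
      simp [hess, hFd, scaledFields, rescale, hx])
  -- The pairing g₂u₂ is rewritten as (g₂/ε)(εu₂), which matches the scaling of y₂ and the assumed
  -- convergence of the forces.
  have b3 : ∫ x in plate l 1, (f (x.1, ε * x.2) * v (x.1, ε * x.2) +
      ∑ i, g i (x.1, ε * x.2) * u i (x.1, ε * x.2)) ≤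
      K * (nrm μ F.w + nrm μ F.y₁ + nrm μ F.y₂) := by
    have mf := memL2_rescale hε hf
    have mg₀ := memL2_rescale hε (hg 0)
    have mg₁ : MemLp (fun x => 1 / ε * rescale ε (g 1) x) 2 μ := (memL2_rescale hε (hg 1)).const_mul _
    have e : ∀ x : ℝ × ℝ, f (x.1, ε * x.2) * v (x.1, ε * x.2) +
        ∑ i, g i (x.1, ε * x.2) * u i (x.1, ε * x.2) = rescale ε f x * F.w x +
          rescale ε (g 0) x * F.y₁ x + (1 / ε * rescale ε (g 1) x) * F.y₂ x := fun x => by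
      simp only [Fin.sum_univ_two, hFd, scaledFields, rescale]
      field_simp
      ring
    simp_rw [e]
    have j1 := integrable_mul_of_memLp mf m.w
    have j2 := integrable_mul_of_memLp mg₀ m.y₁
    have j3 := integrable_mul_of_memLp mg₁ m.y₂
    rw [integral_add_three j1 j2 j3]
    have k1 := (abs_le.1 (abs_integral_mul_le mf m.w)).2
    have k2 := (abs_le.1 (abs_integral_mul_le mg₀ m.y₁)).2
    have k3 := (abs_le.1 (abs_integral_mul_le mg₁ m.y₂)).2
    have l1 := mul_le_mul_of_nonneg_right hfK (nrm_nonneg μ F.w)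
    have l2 := mul_le_mul_of_nonneg_right hgK₀ (nrm_nonneg μ F.y₁)
    have l3 := mul_le_mul_of_nonneg_right hgK₁ (nrm_nonneg μ F.y₂)
    simp only [pnrm] at l1 l2 l3
    linarith
  rw [energy, ← i1, ← i2, ← i3]
  have eP : F.P l ε = nrm μ F.p₁₁ + nrm μ (F.p₁₂ ε) + nrm μ (F.p₂₂ ε) := rfl
  have eH : F.H l = nrm μ F.h₁₁ + nrm μ F.h₁₂ + nrm μ F.h₂₂ := rfl
  rw [← eP] at b1
  rw [← eH] at b2
  have := mul_nonneg hc.le (sq_nonneg (F.P l ε))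
  linarith

end fields

/-! ## Weak compactness in `L²` -/

section weak

variable {l : ℝ} {F : ℕ → ℝ × ℝ → ℝ}

/-- The functional `h ↦ ∫ f h` on `L²(μ)`. -/
def l2Functional {X : Type*} [MeasurableSpace X] {μ : Measure X} {f : X → ℝ} (hf : MemLp f 2 μ) :
    StrongDual ℝ (Lp ℝ 2 μ) := innerSL ℝ (hf.toLp f)

lemma l2Functional_apply {X : Type*} [MeasurableSpace X] {μ : Measure X} {f h : X → ℝ}
    (hf : MemLp f 2 μ) (hh : MemLp h 2 μ) :
    l2Functional hf (hh.toLp h) = ∫ x, f x * h x ∂μ := by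
  rw [l2Functional, innerSL_apply_apply, L2.inner_def]
  refine integral_congr_ae ?_
  filter_upwards [hf.coeFn_toLp, hh.coeFn_toLp] with x h1 h2
  rw [h1, h2]
  simp [mul_comm]

lemma norm_l2Functional {X : Type*} [MeasurableSpace X] {μ : Measure X} {f : X → ℝ}
    (hf : MemLp f 2 μ) : ‖l2Functional hf‖ = nrm μ f := by
  rw [l2Functional, innerSL_apply_norm, Lp.norm_toLp, nrm]

/-- Uniform boundedness principle for the functionals h ↦ ∫ Fₙ h. -/
lemma WeakL2.exists_nrm_le {Ω : Set (ℝ × ℝ)} {f : ℝ × ℝ → ℝ} (h : WeakL2 Ω F f) :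
    ∃ K, ∀ n, nrm (volume.restrict Ω) (F n) ≤ K := by
  have h1 : ∀ n, MemLp (F n) 2 (volume.restrict Ω) := h.1
  obtain ⟨K, hK⟩ := banach_steinhaus (g := fun n => l2Functional (h1 n)) fun x => by
    have hx : MemLp x 2 (volume.restrict Ω) := Lp.memLp x
    have e : ∀ n, l2Functional (h1 n) x = ∫ t in Ω, F n t * x t := fun n => by
      rw [← l2Functional_apply (h1 n) hx, Lp.toLp_coeFn]
    have hb := (h.2.2 x hx).norm.bddAbove_range
    obtain ⟨C, hC⟩ := hb
    refine ⟨C, fun n => ?_⟩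
    rw [e]
    exact hC ⟨n, rfl⟩
  exact ⟨K, fun n => by rw [← norm_l2Functional (h1 n)]; exact hK n⟩

lemma WeakL2.comp {Ω : Set (ℝ × ℝ)} {f : ℝ × ℝ → ℝ} (h : WeakL2 Ω F f) {k : ℕ → ℕ}
    (hk : StrictMono k) : WeakL2 Ω (fun n => F (k n)) f :=
  ⟨fun n => h.1 (k n), h.2.1, fun g hg => (h.2.2 g hg).comp hk.tendsto_atTop⟩

lemma WeakL2.congr {Ω : Set (ℝ × ℝ)} {f f' : ℝ × ℝ → ℝ} {F' : ℕ → ℝ × ℝ → ℝ} (h : WeakL2 Ω F f)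
    (hF : ∀ n, F n =ᵐ[volume.restrict Ω] F' n) (hf : f =ᵐ[volume.restrict Ω] f') :
    WeakL2 Ω F' f' := by
  refine ⟨fun n => (MemLp.ae_eq (hF n) (h.1 n)), MemLp.ae_eq hf h.2.1, fun g hg => ?_⟩
  have e : ∫ x in Ω, f' x * g x = ∫ x in Ω, f x * g x :=
    integral_congr_ae (by filter_upwards [hf] with x hx; rw [hx])
  rw [e]
  refine (h.2.2 g hg).congr fun n => integral_congr_ae ?_
  filter_upwards [hF n] with x hx
  rw [hx]

/-- Sequential weak-* compactness of the ball in the dual of L², with the limit functional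
represented by a function through the Riesz theorem. -/
lemma exists_weakL2_subseq {Ω : Set (ℝ × ℝ)} (hF : ∀ n, MemLp (F n) 2 (volume.restrict Ω)) {R : ℝ}
    (hR : ∀ n, nrm (volume.restrict Ω) (F n) ≤ R) :
    ∃ (k : ℕ → ℕ) (f : ℝ × ℝ → ℝ), StrictMono k ∧ WeakL2 Ω (fun n => F (k n)) f := by
  have : Fact ((2 : ENNReal) ≠ ⊤) := ⟨by norm_num⟩
  have hc := WeakDual.isSeqCompact_closedBall (𝕜 := ℝ) (E := Lp ℝ 2 (volume.restrict Ω)) 0 R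
  obtain ⟨T, -, k, hk, hT⟩ := hc (x := fun n => StrongDual.toWeakDual (l2Functional (hF n)))
    fun n => by
      have : ‖l2Functional (hF n)‖ ≤ R := by rw [norm_l2Functional]; exact hR n
      simpa using this
  set f := (InnerProductSpace.toDual ℝ _).symm (WeakDual.toStrongDual T) with hf
  have hfm : MemLp f 2 (volume.restrict Ω) := Lp.memLp f
  refine ⟨k, f, hk, fun n => hF (k n), hfm, fun g (hg : MemLp g 2 _) => ?_⟩
  have h1 : Tendsto (fun n => l2Functional (hF (k n)) (hg.toLp g)) atTop (𝓝 (T (hg.toLp g))) :=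
    ((WeakDual.eval_continuous (hg.toLp g)).tendsto T).comp hT
  have h2 : T (hg.toLp g) = ∫ x in Ω, f x * g x := by
    rw [← l2Functional_apply hfm hg, l2Functional, Lp.toLp_coeFn, innerSL_apply_apply, hf,
      InnerProductSpace.toDual_symm_apply]
    rfl
  rw [h2] at h1
  refine h1.congr fun n => l2Functional_apply _ hg

lemma exists_weakL2_subseq_finite {Ω : Set (ℝ × ℝ)} {ι : Type*} (s : Finset ι)
    {F : ι → ℕ → ℝ × ℝ → ℝ} (hF : ∀ i n, MemL2 Ω (F i n)) {R : ℝ}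
    (hR : ∀ i n, nrm (volume.restrict Ω) (F i n) ≤ R) :
    ∃ (k : ℕ → ℕ) (f : ι → ℝ × ℝ → ℝ), StrictMono k ∧
      ∀ i ∈ s, WeakL2 Ω (fun n => F i (k n)) (f i) := by
  classical
  induction s using Finset.induction_on with
  | empty => exact ⟨id, fun _ _ => 0, strictMono_id, by simp⟩
  | insert j s hj ih =>
    obtain ⟨k, f, hk, h⟩ := ih
    obtain ⟨k', g, hk', h'⟩ := exists_weakL2_subseq (F := fun n => F j (k n)) (fun n => hF j _)
      (fun n => hR j _)
    refine ⟨k ∘ k', Function.update f j g, hk.comp hk', fun i hi => ?_⟩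
    rcases Finset.mem_insert.1 hi with rfl | hi
    · simpa using h'
    · rw [Function.update_of_ne (ne_of_mem_of_not_mem hi hj)]
      exact (h i hi).comp hk'

lemma WeakL2.const {Ω : Set (ℝ × ℝ)} {f : ℝ × ℝ → ℝ} (hf : MemL2 Ω f) : WeakL2 Ω (fun _ => f) f :=
  ⟨fun _ => hf, hf, fun _ _ => tendsto_const_nhds⟩

lemma WeakL2.add {Ω : Set (ℝ × ℝ)} {f g : ℝ × ℝ → ℝ} {G : ℕ → ℝ × ℝ → ℝ} (hf : WeakL2 Ω F f)
    (hg : WeakL2 Ω G g) : WeakL2 Ω (fun n x => F n x + G n x) (fun x => f x + g x) := by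
  refine ⟨fun n => (hf.1 n).add (hg.1 n), hf.2.1.add hg.2.1, fun h hh => ?_⟩
  have e : ∀ {a b : ℝ × ℝ → ℝ}, MemL2 Ω a → MemL2 Ω b →
      ∫ x in Ω, (a x + b x) * h x = (∫ x in Ω, a x * h x) + ∫ x in Ω, b x * h x := fun ha hb => by
    simp_rw [add_mul]
    exact integral_add (integrable_mul_of_memLp ha hh) (integrable_mul_of_memLp hb hh)
  rw [e hf.2.1 hg.2.1]
  exact ((hf.2.2 h hh).add (hg.2.2 h hh)).congr fun n => (e (hf.1 n) (hg.1 n)).symm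

lemma WeakL2.mul_seq {Ω : Set (ℝ × ℝ)} {f : ℝ × ℝ → ℝ} (hf : WeakL2 Ω F f) {c : ℕ → ℝ} {c₀ : ℝ}
    (hc : Tendsto c atTop (𝓝 c₀)) : WeakL2 Ω (fun n x => c n * F n x) (fun x => c₀ * f x) := by
  refine ⟨fun n => (hf.1 n).const_mul _, hf.2.1.const_mul _, fun h hh => ?_⟩
  simp_rw [mul_assoc, integral_const_mul]
  exact hc.mul (hf.2.2 h hh)

lemma WeakL2.sub_const {Ω : Set (ℝ × ℝ)} {f g : ℝ × ℝ → ℝ} (hf : WeakL2 Ω F f) (hg : MemL2 Ω g) :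
    WeakL2 Ω (fun n x => F n x - g x) (fun x => f x - g x) := by
  have := hf.add ((WeakL2.const hg).mul_seq (tendsto_const_nhds (x := (-1 : ℝ))))
  simpa [sub_eq_add_neg] using this

lemma WeakL2.ae_eq {Ω : Set (ℝ × ℝ)} {f g : ℝ × ℝ → ℝ} (hf : WeakL2 Ω F f) (hg : WeakL2 Ω F g) :
    f =ᵐ[volume.restrict Ω] g := by
  have hm : MemL2 Ω fun x => f x - g x := hf.2.1.sub hg.2.1
  have h1 := tendsto_nhds_unique (hf.2.2 _ hm) (hg.2.2 _ hm)
  have h2 : nrm (volume.restrict Ω) (fun x => f x - g x) ^ 2 = 0 := by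
    rw [nrm_sq hm, ← sub_eq_zero.2 h1, ← integral_sub (integrable_mul_of_memLp hf.2.1 hm)
      (integrable_mul_of_memLp hg.2.1 hm)]
    refine integral_congr_ae (Eventually.of_forall fun x => ?_)
    simp only; ring
  filter_upwards [(nrm_eq_zero hm).1 (pow_eq_zero_iff two_ne_zero |>.1 h2)] with x hx
  exact sub_eq_zero.1 hx

/-- For a fixed test function both sides of the defining identity are pairings with fixed L²
functions. -/
lemma HasWeakDeriv.of_weakL2 {e : ℝ × ℝ} {f g : ℝ × ℝ → ℝ} {G : ℕ → ℝ × ℝ → ℝ}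
    (h : ∀ n, HasWeakDeriv (plate l 1) e (F n) (G n)) (hf : WeakL2 (plate l 1) F f)
    (hg : WeakL2 (plate l 1) G g) : HasWeakDeriv (plate l 1) e f g := by
  refine ⟨hf.2.1.locallyIntegrableOn, hg.2.1.locallyIntegrableOn, fun φ hφ hc hs => ?_⟩
  have h1 := hf.2.2 _ (memLp_of_continuous l 1 (continuous_fderivApply hφ e) 2)
  have h2 := hg.2.2 _ (memLp_of_continuous l 1 hφ.continuous 2)
  exact tendsto_nhds_unique h1 (h2.neg.congr fun n => ((h n).2.2 φ hφ hc hs).symm)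

/-- Here the integrated form of the trace condition pays off: it is linear in the functions and
closed under weak convergence, so no trace operator is needed. -/
lemma HasLat.of_weakL2 {f f₀ f₁ : ℝ × ℝ → ℝ} {F₀ F₁ : ℕ → ℝ × ℝ → ℝ}
    (h : ∀ n, HasLat l (F n) (F₀ n) (F₁ n)) (hf : WeakL2 (plate l 1) F f)
    (hf₀ : WeakL2 (plate l 1) F₀ f₀) (hf₁ : WeakL2 (plate l 1) F₁ f₁) : HasLat l f f₀ f₁ where
  mem := hf.2.1
  mem₀ := hf₀.2.1
  mem₁ := hf₁.2.1
  deriv₀ φ hφ := by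
    have h1 := hf.2.2 _ (memLp_of_continuous l 1 (continuous_fderivApply hφ (1, 0)) 2)
    have h2 := hf₀.2.2 _ (memLp_of_continuous l 1 hφ.continuous 2)
    exact tendsto_nhds_unique h1 (h2.neg.congr fun n => ((h n).deriv₀ φ hφ).symm)
  deriv₁ := HasWeakDeriv.of_weakL2 (fun n => (h n).deriv₁) hf hf₁

end weak

/-! ## Weak limits of scaled fields -/

section limit

variable {l ε : ℝ} {F G : Fields}

/-- The differential relations between the scaled fields. For `ε = 0` these are the relations
satisfied by weak limits. -/
structure Fields.HasDerivs (l ε : ℝ) (F : Fields) : Prop where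
  mem : F.MemL2 l
  w₀ : HasWeakDeriv (plate l 1) (dir 0) F.w F.q₁
  w₁ : HasWeakDeriv (plate l 1) (dir 1) F.w fun x => ε * F.q₂ x
  q₁₀ : HasWeakDeriv (plate l 1) (dir 0) F.q₁ F.h₁₁
  q₁₁ : HasWeakDeriv (plate l 1) (dir 1) F.q₁ fun x => ε * F.h₁₂ x
  q₂₀ : HasWeakDeriv (plate l 1) (dir 0) F.q₂ F.h₁₂
  q₂₁ : HasWeakDeriv (plate l 1) (dir 1) F.q₂ fun x => ε * F.h₂₂ x
  y₁₀ : HasWeakDeriv (plate l 1) (dir 0) F.y₁ F.y₁₁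
  y₁₁ : HasWeakDeriv (plate l 1) (dir 1) F.y₁ F.y₁₂
  y₂₀ : HasWeakDeriv (plate l 1) (dir 0) F.y₂ F.y₂₁
  y₂₁ : HasWeakDeriv (plate l 1) (dir 1) F.y₂ F.y₂₂

lemma hasDerivs_scaledFields {uhat₁ uhat₂ vhat : ℝ → ℝ} {u : Fin 2 → ℝ × ℝ → ℝ} {v : ℝ × ℝ → ℝ}
    (hε : 0 < ε) (hu : ∀ i, MemW12 (plate l ε) (u i)) (hv : MemW22 (plate l ε) v)
    (hF : IsScaled l ε (bdryData l uhat₁ uhat₂ vhat) (scaledFields l ε u v))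
    (m : (scaledFields l ε u v).MemL2 l) : (scaledFields l ε u v).HasDerivs l ε := by
  have d : ∀ {f} (i : Fin 2), MemW12 (plate l ε) f → HasWeakDeriv (plate l 1) (dir i) (rescale ε f)
      fun x => ![1, ε] i * rescale ε (pd (plate l ε) i f) x := fun i hf =>
    hasWeakDeriv_rescale hε (hf.hasWeakDeriv_pd i) hf.1 (hf.memL2_pd (isOpen_plate l ε) i)
  have d₀ : ∀ {f}, MemW12 (plate l ε) f → HasWeakDeriv (plate l 1) (dir 0) (rescale ε f)
      (rescale ε (pd (plate l ε) 0 f)) := fun hf => by simpa using d 0 hf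
  exact
    { mem := m
      w₀ := d₀ hv.1
      w₁ := d 1 hv.1
      q₁₀ := d₀ (hv.2 0)
      q₁₁ := d 1 (hv.2 0)
      q₂₀ := hF.q₂.hasWeakDeriv₀
      q₂₁ := d 1 (hv.2 1)
      y₁₀ := d₀ (hu 0)
      y₁₁ := d 1 (hu 0)
      y₂₀ := (d₀ (hu 1)).const_mul ε
      y₂₁ := (d 1 (hu 1)).const_mul ε }

/-- Weak convergence of scaled fields and of the scaled strains. -/
structure Fields.Weak (l : ℝ) (ε : ℕ → ℝ) (F : ℕ → Fields) (G : Fields) (s₁₂ s₂₂ : ℝ × ℝ → ℝ) :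
    Prop where
  w : WeakL2 (plate l 1) (fun n => (F n).w) G.w
  q₁ : WeakL2 (plate l 1) (fun n => (F n).q₁) G.q₁
  q₂ : WeakL2 (plate l 1) (fun n => (F n).q₂) G.q₂
  h₁₁ : WeakL2 (plate l 1) (fun n => (F n).h₁₁) G.h₁₁
  h₁₂ : WeakL2 (plate l 1) (fun n => (F n).h₁₂) G.h₁₂
  h₂₂ : WeakL2 (plate l 1) (fun n => (F n).h₂₂) G.h₂₂
  y₁ : WeakL2 (plate l 1) (fun n => (F n).y₁) G.y₁
  y₂ : WeakL2 (plate l 1) (fun n => (F n).y₂) G.y₂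
  y₁₁ : WeakL2 (plate l 1) (fun n => (F n).y₁₁) G.y₁₁
  y₁₂ : WeakL2 (plate l 1) (fun n => (F n).y₁₂) G.y₁₂
  y₂₁ : WeakL2 (plate l 1) (fun n => (F n).y₂₁) G.y₂₁
  y₂₂ : WeakL2 (plate l 1) (fun n => (F n).y₂₂) G.y₂₂
  e₁₂ : WeakL2 (plate l 1) (fun n => (F n).e₁₂ (ε n)) s₁₂
  e₂₂ : WeakL2 (plate l 1) (fun n => (F n).e₂₂ (ε n)) s₂₂

lemma exists_weak_limit {ε : ℕ → ℝ} {F : ℕ → Fields} (hm : ∀ n, (F n).MemL2 l) {R : ℝ}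
    (hR : ∀ n, (F n).BoundedBy l (ε n) R) :
    ∃ (k : ℕ → ℕ) (G : Fields) (s₁₂ s₂₂ : ℝ × ℝ → ℝ), StrictMono k ∧
      Fields.Weak l (fun n => ε (k n)) (fun n => F (k n)) G s₁₂ s₂₂ := by
  have me₁₂ : ∀ n, MemL2 (plate l 1) ((F n).e₁₂ (ε n)) := fun n =>
    ((hm n).y₂₁.add (hm n).y₁₂).const_mul _
  have me₂₂ : ∀ n, MemL2 (plate l 1) ((F n).e₂₂ (ε n)) := fun n => (hm n).y₂₂.const_mul _
  obtain ⟨k, g, hk, h⟩ := exists_weakL2_subseq_finite (Ω := plate l 1) (Finset.univ : Finset (Fin 14))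
    (F := fun i n => ![(F n).w, (F n).q₁, (F n).q₂, (F n).h₁₁, (F n).h₁₂, (F n).h₂₂, (F n).y₁,
      (F n).y₂, (F n).y₁₁, (F n).y₁₂, (F n).y₂₁, (F n).y₂₂, (F n).e₁₂ (ε n), (F n).e₂₂ (ε n)] i)
    (fun i n => by
      fin_cases i
      exacts [(hm n).w, (hm n).q₁, (hm n).q₂, (hm n).h₁₁, (hm n).h₁₂, (hm n).h₂₂, (hm n).y₁,
        (hm n).y₂, (hm n).y₁₁, (hm n).y₁₂, (hm n).y₂₁, (hm n).y₂₂, me₁₂ n, me₂₂ n])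
    (R := R) (fun i n => by
      fin_cases i
      exacts [(hR n).w, (hR n).q₁, (hR n).q₂, (hR n).h₁₁, (hR n).h₁₂, (hR n).h₂₂, (hR n).y₁,
        (hR n).y₂, (hR n).y₁₁, (hR n).y₁₂, (hR n).y₂₁, (hR n).y₂₂, (hR n).e₁₂, (hR n).e₂₂])
  exact ⟨k, ⟨g 0, g 1, g 2, g 3, g 4, g 5, g 6, g 7, g 8, g 9, g 10, g 11⟩, g 12, g 13, hk,
    { w := h 0 (Finset.mem_univ _)
      q₁ := h 1 (Finset.mem_univ _)
      q₂ := h 2 (Finset.mem_univ _)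
      h₁₁ := h 3 (Finset.mem_univ _)
      h₁₂ := h 4 (Finset.mem_univ _)
      h₂₂ := h 5 (Finset.mem_univ _)
      y₁ := h 6 (Finset.mem_univ _)
      y₂ := h 7 (Finset.mem_univ _)
      y₁₁ := h 8 (Finset.mem_univ _)
      y₁₂ := h 9 (Finset.mem_univ _)
      y₂₁ := h 10 (Finset.mem_univ _)
      y₂₂ := h 11 (Finset.mem_univ _)
      e₁₂ := h 12 (Finset.mem_univ _)
      e₂₂ := h 13 (Finset.mem_univ _) }⟩

variable {εs : ℕ → ℝ} {Fs : ℕ → Fields} {s₁₂ s₂₂ : ℝ × ℝ → ℝ}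

/-- A factor ε tending to 0 times a weakly convergent sequence converges weakly to 0, so the
x₂-derivatives of w, q₁ and q₂ vanish in the limit. -/
lemma Fields.Weak.hasDerivs (h : Fields.Weak l εs Fs G s₁₂ s₂₂) (hε : Tendsto εs atTop (𝓝 0))
    (hF : ∀ n, (Fs n).HasDerivs l (εs n)) : G.HasDerivs l 0 where
  mem := ⟨h.w.2.1, h.q₁.2.1, h.q₂.2.1, h.h₁₁.2.1, h.h₁₂.2.1, h.h₂₂.2.1, h.y₁.2.1, h.y₂.2.1,
    h.y₁₁.2.1, h.y₁₂.2.1, h.y₂₁.2.1, h.y₂₂.2.1⟩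
  w₀ := HasWeakDeriv.of_weakL2 (fun n => (hF n).w₀) h.w h.q₁
  w₁ := HasWeakDeriv.of_weakL2 (fun n => (hF n).w₁) h.w (h.q₂.mul_seq hε)
  q₁₀ := HasWeakDeriv.of_weakL2 (fun n => (hF n).q₁₀) h.q₁ h.h₁₁
  q₁₁ := HasWeakDeriv.of_weakL2 (fun n => (hF n).q₁₁) h.q₁ (h.h₁₂.mul_seq hε)
  q₂₀ := HasWeakDeriv.of_weakL2 (fun n => (hF n).q₂₀) h.q₂ h.h₁₂
  q₂₁ := HasWeakDeriv.of_weakL2 (fun n => (hF n).q₂₁) h.q₂ (h.h₂₂.mul_seq hε)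
  y₁₀ := HasWeakDeriv.of_weakL2 (fun n => (hF n).y₁₀) h.y₁ h.y₁₁
  y₁₁ := HasWeakDeriv.of_weakL2 (fun n => (hF n).y₁₁) h.y₁ h.y₁₂
  y₂₀ := HasWeakDeriv.of_weakL2 (fun n => (hF n).y₂₀) h.y₂ h.y₂₁
  y₂₁ := HasWeakDeriv.of_weakL2 (fun n => (hF n).y₂₁) h.y₂ h.y₂₂

lemma Fields.Weak.isScaled {B : BdryData} {D : ℝ} (hB : B.Bounded l D)
    (h : Fields.Weak l εs Fs G s₁₂ s₂₂)
    (hε : Tendsto εs atTop (𝓝 0)) (hF : ∀ n, IsScaled l (εs n) B (Fs n)) : IsScaled l 0 B G where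
  w := HasLat.of_weakL2 (fun n => (hF n).w) (h.w.sub_const hB.v.1) (h.q₁.sub_const hB.v₁.1)
    (h.q₂.mul_seq hε)
  q₁ := HasLat.of_weakL2 (fun n => (hF n).q₁) (h.q₁.sub_const hB.v₁.1) (h.h₁₁.sub_const hB.v₂.1)
    (h.h₁₂.mul_seq hε)
  q₂ := HasLat.of_weakL2 (fun n => (hF n).q₂) h.q₂ h.h₁₂ (h.h₂₂.mul_seq hε)
  y₁ := HasLat.of_weakL2 (fun n => (hF n).y₁) (h.y₁.sub_const hB.a.1) (h.y₁₁.sub_const hB.a₁.1)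
    (h.y₁₂.sub_const hB.a₂.1)
  y₂ := HasLat.of_weakL2 (fun n => (hF n).y₂) (h.y₂.sub_const hB.b.1) (h.y₂₁.sub_const hB.b₁.1) h.y₂₂
  h₂₂ := h.h₂₂.2.1

/-- Weak convergence in W^{1,2} is stated through the chosen derivatives `pd`, which agree with the
fields only almost everywhere; this lemma performs the transfer. -/
lemma weakW12_of_ae_eq {f a b₀ b₁ : ℕ → ℝ × ℝ → ℝ} {f' A B₀ B₁ : ℝ × ℝ → ℝ}
    (hf : ∀ n, a n =ᵐ[volume.restrict (plate l 1)] f n)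
    (hf' : A =ᵐ[volume.restrict (plate l 1)] f')
    (h₀ : ∀ n, HasWeakDeriv (plate l 1) (dir 0) (a n) (b₀ n))
    (h₁ : ∀ n, HasWeakDeriv (plate l 1) (dir 1) (a n) (b₁ n)) (ha : WeakL2 (plate l 1) a A)
    (hb₀ : WeakL2 (plate l 1) b₀ B₀) (hb₁ : WeakL2 (plate l 1) b₁ B₁) :
    WeakW12 (plate l 1) f f' := by
  have hO := isOpen_plate l 1
  have d₀ : ∀ n, HasWeakDeriv (plate l 1) (dir 0) (f n) (b₀ n) := fun n =>
    (h₀ n).congr_memL2 (hf n) (EventuallyEq.refl _ _) (ha.1 n) (hb₀.1 n)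
  have d₁ : ∀ n, HasWeakDeriv (plate l 1) (dir 1) (f n) (b₁ n) := fun n =>
    (h₁ n).congr_memL2 (hf n) (EventuallyEq.refl _ _) (ha.1 n) (hb₁.1 n)
  have hw := ha.congr hf hf'
  have D₀ := HasWeakDeriv.of_weakL2 d₀ hw hb₀
  have D₁ := HasWeakDeriv.of_weakL2 d₁ hw hb₁
  refine ⟨fun n => memW12_of_hasWeakDeriv (hw.1 n) (d₀ n) (d₁ n) (hb₀.1 n) (hb₁.1 n),
    memW12_of_hasWeakDeriv hw.2.1 D₀ D₁ hb₀.2.1 hb₁.2.1, hw, fun i => ?_⟩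
  fin_cases i
  · exact hb₀.congr (fun n => ((d₀ n).weakDeriv_ae_eq hO).symm) (D₀.weakDeriv_ae_eq hO).symm
  · exact hb₁.congr (fun n => ((d₁ n).weakDeriv_ae_eq hO).symm) (D₁.weakDeriv_ae_eq hO).symm

lemma weakW22_of_weakW12 {f : ℕ → ℝ × ℝ → ℝ} {f' : ℝ × ℝ → ℝ} (h : WeakW12 (plate l 1) f f')
    (hd : ∀ i, WeakW12 (plate l 1) (fun n => pd (plate l 1) i (f n)) (pd (plate l 1) i f')) :
    WeakW22 (plate l 1) f f' :=
  ⟨fun n => ⟨h.1 n, fun i => (hd i).1 n⟩, ⟨h.2.1, fun i => (hd i).2.1⟩, h.2.2.1, h.2.2.2,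
    fun i j => (hd j).2.2.2 i⟩

lemma pd_congr {f f' g : ℝ × ℝ → ℝ} {i : Fin 2} (h : HasWeakDeriv (plate l 1) (dir i) f g)
    (hf : f =ᵐ[volume.restrict (plate l 1)] f') (mf : MemL2 (plate l 1) f)
    (mg : MemL2 (plate l 1) g) : pd (plate l 1) i f' =ᵐ[volume.restrict (plate l 1)] g :=
  (h.congr_memL2 hf (EventuallyEq.refl _ _) mf mg).weakDeriv_ae_eq (isOpen_plate l 1)

lemma Fields.HasDerivs.pd_w₀ (h : F.HasDerivs l ε) :
    F.q₁ =ᵐ[volume.restrict (plate l 1)] pd (plate l 1) 0 F.w :=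
  (h.w₀.weakDeriv_ae_eq (isOpen_plate l 1)).symm

lemma Fields.HasDerivs.pd_w₁ (h : F.HasDerivs l ε) :
    (fun x => ε * F.q₂ x) =ᵐ[volume.restrict (plate l 1)] pd (plate l 1) 1 F.w :=
  (h.w₁.weakDeriv_ae_eq (isOpen_plate l 1)).symm

lemma Fields.Weak.weakW22 (h : Fields.Weak l εs Fs G s₁₂ s₂₂) (hε : Tendsto εs atTop (𝓝 0))
    (hF : ∀ n, (Fs n).HasDerivs l (εs n)) : WeakW22 (plate l 1) (fun n => (Fs n).w) G.w := by
  have hG := h.hasDerivs hε hF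
  refine weakW22_of_weakW12 (weakW12_of_ae_eq (fun n => EventuallyEq.refl _ _) (EventuallyEq.refl _ _)
    (fun n => (hF n).w₀) (fun n => (hF n).w₁) h.w h.q₁ (h.q₂.mul_seq hε)) fun i => ?_
  fin_cases i
  · exact weakW12_of_ae_eq (fun n => (hF n).pd_w₀) hG.pd_w₀ (fun n => (hF n).q₁₀)
      (fun n => (hF n).q₁₁) h.q₁ h.h₁₁ (h.h₁₂.mul_seq hε)
  · exact weakW12_of_ae_eq (fun n => (hF n).pd_w₁) hG.pd_w₁ (fun n => (hF n).q₂₀.const_mul _)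
      (fun n => (hF n).q₂₁.const_mul _) (h.q₂.mul_seq hε) (h.h₁₂.mul_seq hε)
      ((h.h₂₂.mul_seq hε).mul_seq hε)

lemma Fields.Weak.weakW12_grad (h : Fields.Weak l εs Fs G s₁₂ s₂₂) (hpos : ∀ n, 0 < εs n)
    (hε : Tendsto εs atTop (𝓝 0)) (hF : ∀ n, (Fs n).HasDerivs l (εs n)) (i : Fin 2) :
    WeakW12 (plate l 1) (fun n x => scaledGrad (plate l 1) (εs n) (Fs n).w x i)
      (![G.q₁, G.q₂] i) := by
  fin_cases i
  · exact weakW12_of_ae_eq (fun n => (hF n).pd_w₀) (EventuallyEq.refl _ _) (fun n => (hF n).q₁₀)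
      (fun n => (hF n).q₁₁) h.q₁ h.h₁₁ (h.h₁₂.mul_seq hε)
  · refine weakW12_of_ae_eq (a := fun n => (Fs n).q₂) (fun n => ?_) (EventuallyEq.refl _ _)
      (fun n => (hF n).q₂₀) (fun n => (hF n).q₂₁) h.q₂ h.h₁₂ (h.h₂₂.mul_seq hε)
    filter_upwards [(hF n).pd_w₁] with x hx
    have := (hpos n).ne'
    simp [scaledGrad, ← hx, this]

lemma Fields.Weak.weakL2_hess (h : Fields.Weak l εs Fs G s₁₂ s₂₂) (hpos : ∀ n, 0 < εs n)
    (hF : ∀ n, (Fs n).HasDerivs l (εs n)) :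
    WeakL2Matrix (plate l 1) (fun n => scaledHess (plate l 1) (εs n) (Fs n).w)
      (fun x => !![G.h₁₁ x, G.h₁₂ x; G.h₁₂ x, G.h₂₂ x]) := by
  intro i j
  fin_cases i <;> fin_cases j
  · refine h.h₁₁.congr (fun n => ?_) (EventuallyEq.refl _ _)
    exact (pd_congr (hF n).q₁₀ (hF n).pd_w₀ (hF n).mem.q₁ (hF n).mem.h₁₁).symm
  · refine h.h₁₂.congr (fun n => ?_) (EventuallyEq.refl _ _)
    filter_upwards [pd_congr ((hF n).q₂₀.const_mul (εs n)) (hF n).pd_w₁ ((hF n).mem.q₂.const_mul _)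
      ((hF n).mem.h₁₂.const_mul _)] with x hx
    have := (hpos n).ne'
    simp [scaledHess, hx, this]
  · refine h.h₁₂.congr (fun n => ?_) (EventuallyEq.refl _ _)
    filter_upwards [pd_congr (hF n).q₁₁ (hF n).pd_w₀ (hF n).mem.q₁
      ((hF n).mem.h₁₂.const_mul _)] with x hx
    have := (hpos n).ne'
    simp [scaledHess, hx, this]
  · refine h.h₂₂.congr (fun n => ?_) (EventuallyEq.refl _ _)
    filter_upwards [pd_congr ((hF n).q₂₁.const_mul (εs n)) (hF n).pd_w₁ ((hF n).mem.q₂.const_mul _)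
      (((hF n).mem.h₂₂.const_mul _).const_mul _)] with x hx
    have := (hpos n).ne'
    simp [scaledHess, hx]
    field_simp

lemma Fields.Weak.weakW12_y (h : Fields.Weak l εs Fs G s₁₂ s₂₂)
    (hF : ∀ n, (Fs n).HasDerivs l (εs n)) (i : Fin 2) :
    WeakW12 (plate l 1) (fun n => ![(Fs n).y₁, (Fs n).y₂] i) (![G.y₁, G.y₂] i) := by
  fin_cases i
  · exact weakW12_of_ae_eq (fun n => EventuallyEq.refl _ _) (EventuallyEq.refl _ _)
      (fun n => (hF n).y₁₀) (fun n => (hF n).y₁₁) h.y₁ h.y₁₁ h.y₁₂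
  · exact weakW12_of_ae_eq (fun n => EventuallyEq.refl _ _) (EventuallyEq.refl _ _)
      (fun n => (hF n).y₂₀) (fun n => (hF n).y₂₁) h.y₂ h.y₂₁ h.y₂₂

lemma Fields.Weak.weakL2_strain (h : Fields.Weak l εs Fs G s₁₂ s₂₂)
    (hε : Tendsto εs atTop (𝓝 0)) (hF : ∀ n, (Fs n).HasDerivs l (εs n)) :
    WeakL2Matrix (plate l 1)
      (fun n => scaledStrain (plate l 1) (εs n) ![(Fs n).y₁, (Fs n).y₂])
      (fun x => !![pd (plate l 1) 0 G.y₁ x, s₁₂ x; s₁₂ x, s₂₂ x]) := by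
  have hG := h.hasDerivs hε hF
  have hO := isOpen_plate l 1
  intro i j
  fin_cases i <;> fin_cases j
  · exact h.y₁₁.congr (fun n => ((hF n).y₁₀.weakDeriv_ae_eq hO).symm)
      (hG.y₁₀.weakDeriv_ae_eq hO).symm
  · refine h.e₁₂.congr (fun n => ?_) (EventuallyEq.refl _ _)
    filter_upwards [(hF n).y₁₁.weakDeriv_ae_eq hO, (hF n).y₂₀.weakDeriv_ae_eq hO] with x h1 h2
    simp [scaledStrain, pd, h1, h2, Fields.e₁₂]
  · refine h.e₁₂.congr (fun n => ?_) (EventuallyEq.refl _ _)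
    filter_upwards [(hF n).y₁₁.weakDeriv_ae_eq hO, (hF n).y₂₀.weakDeriv_ae_eq hO] with x h1 h2
    simp [scaledStrain, pd, h1, h2, Fields.e₁₂, add_comm]
  · refine h.e₂₂.congr (fun n => ?_) (EventuallyEq.refl _ _)
    filter_upwards [(hF n).y₂₁.weakDeriv_ae_eq hO] with x h1
    simp [scaledStrain, pd, h1, Fields.e₂₂]

/-- The shear of y is 2ε e₁₂ and its transversal strain is ε² e₂₂. Since e₁₂ and e₂₂ converge
weakly, both products tend weakly to 0, and weak limits are unique. -/
lemma Fields.Weak.bernoulliNavier {uhat₁ uhat₂ vhat : ℝ → ℝ} (hl : 0 < l)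
    (h : Fields.Weak l εs Fs G s₁₂ s₂₂)
    (hpos : ∀ n, 0 < εs n) (hε : Tendsto εs atTop (𝓝 0)) (hF : ∀ n, (Fs n).HasDerivs l (εs n))
    (hG : IsScaled l 0 (bdryData l uhat₁ uhat₂ vhat) G) :
    BernoulliNavier l uhat₁ uhat₂ ![G.y₁, G.y₂] where
  mem i := (h.weakW12_y hF i).2.1
  strain_zero := by
    have hd := h.hasDerivs hε hF
    have hO := isOpen_plate l 1
    have e1 : (fun x => 0 * s₁₂ x) =ᵐ[volume.restrict (plate l 1)] fun x => G.y₂₁ x + G.y₁₂ x := by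
      have := h.e₁₂.mul_seq (c := fun n => 2 * εs n) (c₀ := 0) (by simpa using hε.const_mul 2)
      refine WeakL2.ae_eq (this.congr (fun n => ?_) (EventuallyEq.refl _ _)) (h.y₂₁.add h.y₁₂)
      refine Eventually.of_forall fun x => ?_
      have := (hpos n).ne'
      simp only [Fields.e₁₂]
      field_simp
    have e2 : (fun x => 0 * s₂₂ x) =ᵐ[volume.restrict (plate l 1)] G.y₂₂ := by
      have := h.e₂₂.mul_seq (c := fun n => εs n ^ 2) (c₀ := 0) (by simpa using hε.pow 2)
      refine WeakL2.ae_eq (this.congr (fun n => ?_) (EventuallyEq.refl _ _)) h.y₂₂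
      refine Eventually.of_forall fun x => ?_
      have := (hpos n).ne'
      simp only [Fields.e₂₂]
      field_simp
    filter_upwards [e1, e2, hd.y₁₁.weakDeriv_ae_eq hO, hd.y₂₀.weakDeriv_ae_eq hO,
      hd.y₂₁.weakDeriv_ae_eq hO] with x h1 h2 h3 h4 h5
    simp only [zero_mul] at h1 h2
    constructor
    · simp [strain, pd, h3, h4]; linarith
    · simp [strain, pd, h5]; linarith
  bdry₁ := hG.y₁.zeroLateralTrace hl
  bdry₂ := hG.y₂.zeroLateralTrace hl

lemma ZeroTraceI.congr {f g : ℝ → ℝ} (h : ZeroTraceI l f)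
    (hfg : f =ᵐ[volume.restrict (interval l)] g) : ZeroTraceI l g := by
  obtain ⟨p, hp, he, h0, h1⟩ := h
  exact ⟨p, hp, he.trans hfg, h0, h1⟩

end limit

/-! ### Identification of the limit deflection as a function of one variable. -/

section identification

variable {l : ℝ}

lemma ae_fst {ε : ℝ} {f g : ℝ → ℝ} (h : f =ᵐ[volume.restrict (interval l)] g) :
    (fun x : ℝ × ℝ => f x.1) =ᵐ[volume.restrict (plate l ε)] fun x => g x.1 := by
  rw [restrict_plate]
  exact Measure.quasiMeasurePreserving_fst.ae h

/-- The limit deflection depends only on `x₁`, and it satisfies the boundary conditions. -/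
lemma exists_limit_deflection (hl : 0 < l) {uhat₁ uhat₂ vhat : ℝ → ℝ} (hvhat : MemW22I l vhat)
    {G : Fields} (hG : IsScaled l 0 (bdryData l uhat₁ uhat₂ vhat) G) :
    ∃ w θ : ℝ → ℝ, MemW22IBdry l vhat w ∧ MemW12I0 l θ ∧
      G.w =ᵐ[volume.restrict (plate l 1)] (fun x => w x.1) ∧
      G.q₁ =ᵐ[volume.restrict (plate l 1)] (fun x => D1 l w x.1) ∧
      G.q₂ =ᵐ[volume.restrict (plate l 1)] (fun x => θ x.1) ∧
      G.h₁₁ =ᵐ[volume.restrict (plate l 1)] (fun x => D1 l (D1 l w) x.1) ∧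
      G.h₁₂ =ᵐ[volume.restrict (plate l 1)] (fun x => D1 l θ x.1) := by
  have zero : ∀ f : ℝ × ℝ → ℝ, (fun x => 0 * f x) =ᵐ[volume.restrict (plate l 1)] 0 := fun f =>
    Eventually.of_forall fun x => zero_mul (f x)
  -- At ε = 0 the x₂-derivatives in the trace relations are zero, so w − v̂, q₁ − v̂′ and q₂
  -- coincide with their cross-sectional averages.
  obtain ⟨b1, z1, z2⟩ := hG.w.exists_avg hl (zero _)
  obtain ⟨b2, -, z3⟩ := hG.q₁.exists_avg hl (zero _)
  obtain ⟨b3, z4, z5⟩ := hG.q₂.exists_avg hl (zero _)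
  generalize avg (fun x => G.w x - (bdryData l uhat₁ uhat₂ vhat).v x) = ζ at *
  generalize avg (fun x => G.q₁ x - (bdryData l uhat₁ uhat₂ vhat).v₁ x) = ζ₁ at *
  generalize avg (fun x => G.h₁₁ x - (bdryData l uhat₁ uhat₂ vhat).v₂ x) = ζ₂ at *
  generalize avg G.q₂ = θ at *
  generalize avg G.h₁₂ = θ₁ at *
  have hI := isOpen_interval l
  -- Adding v̂ back to the average yields the limit w; the boundary conditions are then exactly the
  -- zero traces of the averages.
  have hw : HasWeakDeriv (interval l) 1 (fun s => ζ s + vhat s) (fun s => ζ₁ s + D1 l vhat s) :=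
    b1.hasWeakDeriv.add (measurableSet_interval l) hvhat.1.hasWeakDeriv
  have e1 : D1 l (fun s => ζ s + vhat s) =ᵐ[volume.restrict (interval l)]
      fun s => ζ₁ s + D1 l vhat s := hw.weakDeriv_ae_eq hI
  have m0 : MemL2 (interval l) fun s => ζ s + vhat s := b1.mem.add hvhat.1.1
  have m1 : MemL2 (interval l) fun s => ζ₁ s + D1 l vhat s := b1.mem₁.add hvhat.2.1
  have m2 : MemL2 (interval l) fun s => ζ₂ s + D1 l (D1 l vhat) s := b2.mem₁.add hvhat.2.memL2_D1
  have m1' : MemL2 (interval l) (D1 l fun s => ζ s + vhat s) := MemLp.ae_eq e1.symm m1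
  have hw2 : HasWeakDeriv (interval l) 1 (D1 l fun s => ζ s + vhat s)
      (fun s => ζ₂ s + D1 l (D1 l vhat) s) :=
    (b2.hasWeakDeriv.add (measurableSet_interval l) hvhat.2.hasWeakDeriv).congr e1.symm
      (EventuallyEq.refl _ _) m1'.locallyIntegrableOn m2.locallyIntegrableOn
  have e2 : D1 l (D1 l fun s => ζ s + vhat s) =ᵐ[volume.restrict (interval l)]
      fun s => ζ₂ s + D1 l (D1 l vhat) s := hw2.weakDeriv_ae_eq hI
  refine ⟨fun s => ζ s + vhat s, θ, ⟨⟨⟨m0, _, hw, m1⟩, m1', _, hw2, m2⟩, ?_, ?_⟩,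
    ⟨⟨b3.mem, _, b3.hasWeakDeriv, b3.mem₁⟩, b3.zeroTraceI hl⟩, ?_, ?_, z4, ?_,
    z5.trans (ae_fst b3.D1_ae_eq.symm)⟩
  · simpa using b1.zeroTraceI hl
  · refine (b2.zeroTraceI hl).congr ?_
    filter_upwards [e1] with s hs
    rw [hs]; ring
  · filter_upwards [z1] with x hx
    rw [← hx]; simp [bdryData]
  · filter_upwards [z2, ae_fst e1] with x hx hx'
    rw [hx', ← hx]; simp [bdryData]
  · filter_upwards [z3, ae_fst e2] with x hx hx'
    rw [hx', ← hx]; simp [bdryData]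

end identification

end Ribbon

end

/-! ### Assembly of the compactness theorem. -/

theorem proposition2p1 (l : ℝ) (hl : 0 < l)
    (Q : QuadraticForm ℝ (Matrix (Fin 2) (Fin 2) ℝ))
    (hQsym : ∀ A, Q A = Q ((1 / 2 : ℝ) • (A + A.transpose)))
    (hQpos : ∀ A : Matrix (Fin 2) (Fin 2) ℝ, A.IsSymm → A ≠ 0 → 0 < Q A)
    (uhat₁ uhat₂ vhat : ℝ → ℝ)
    (huhat₁ : MemW12I l uhat₁) (huhat₂ : MemW22I l uhat₂) (hvhat : MemW22I l vhat)
    (ε : ℕ → ℝ) (hεpos : ∀ n, 0 < ε n) (hε : Tendsto ε atTop (𝓝 0))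
    (f : ℕ → ℝ × ℝ → ℝ) (g : ℕ → Fin 2 → ℝ × ℝ → ℝ)
    (hf : ∀ n, MemL2 (plate l (ε n)) (f n)) (hg : ∀ n i, MemL2 (plate l (ε n)) (g n i))
    (f1D : ℝ → ℝ) (g1D : Fin 2 → ℝ → ℝ)
    (hf1D : MemL2 (interval l) f1D) (hg1D : ∀ i, MemL2 (interval l) (g1D i))
    (hf_conv : WeakL2 (plate l 1) (fun n => rescale (ε n) (f n)) (fun x => f1D x.1))
    (hg_conv₁ : WeakL2 (plate l 1) (fun n => rescale (ε n) (g n 0)) (fun x => g1D 0 x.1))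
    (hg_conv₂ : WeakL2 (plate l 1) (fun n x => 1 / ε n * rescale (ε n) (g n 1) x)
      (fun x => g1D 1 x.1))
    (M : ℝ) (hM : 0 < M)
    (u : ℕ → Fin 2 → ℝ × ℝ → ℝ) (v : ℕ → ℝ × ℝ → ℝ)
    (hadm : ∀ n, Admissible l (ε n) uhat₁ uhat₂ vhat (u n) (v n))
    (henergy : ∀ n, energy Q l (ε n) (f n) (g n) (u n) (v n) ≤ M) :
    ∃ k : ℕ → ℕ, StrictMono k ∧
      ∃ (w θ : ℝ → ℝ) (y : Fin 2 → ℝ × ℝ → ℝ) (γ : ℝ × ℝ → ℝ)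
        (E : ℝ × ℝ → Matrix (Fin 2) (Fin 2) ℝ),
        MemW22IBdry l vhat w ∧ MemW12I0 l θ ∧ BernoulliNavier l uhat₁ uhat₂ y ∧
        MemL2 (plate l 1) γ ∧
        (∀ i j, MemL2 (plate l 1) (fun x => E x i j)) ∧ (∀ x, (E x).IsSymm) ∧
        (∀ᵐ x ∂volume.restrict (plate l 1), E x 0 0 = pd (plate l 1) 0 (y 0) x) ∧
        WeakW22 (plate l 1) (fun n => rescale (ε (k n)) (v (k n))) (fun x => w x.1) ∧
        (∀ i, WeakW12 (plate l 1)
          (fun n x => scaledGrad (plate l 1) (ε (k n)) (rescale (ε (k n)) (v (k n))) x i)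
          (fun x => (![D1 l w x.1, θ x.1] : Fin 2 → ℝ) i)) ∧
        WeakL2Matrix (plate l 1)
          (fun n => scaledHess (plate l 1) (ε (k n)) (rescale (ε (k n)) (v (k n))))
          (fun x => !![D1 l (D1 l w) x.1, D1 l θ x.1; D1 l θ x.1, γ x]) ∧
        (∀ i, WeakW12 (plate l 1) (fun n => scaledY (ε (k n)) (u (k n)) i) (y i)) ∧
        WeakL2Matrix (plate l 1)
          (fun n => scaledStrain (plate l 1) (ε (k n)) (scaledY (ε (k n)) (u (k n)))) E := by
  obtain ⟨c, hc, hQ⟩ := exists_coercive hQsym hQpos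
  obtain ⟨K₁, hK₁⟩ := hf_conv.exists_nrm_le
  obtain ⟨K₂, hK₂⟩ := hg_conv₁.exists_nrm_le
  obtain ⟨K₃, hK₃⟩ := hg_conv₂.exists_nrm_le
  obtain ⟨D, hCD, hB⟩ := exists_bounded_bdryData hl huhat₁ huhat₂ hvhat
    (max (max K₁ K₂) (max K₃ M))
  simp only [max_le_iff] at hCD
  obtain ⟨⟨hD₁, hD₂⟩, hD₃, hDM⟩ := hCD
  obtain ⟨R, ε₀, hε₀, hR⟩ := exists_boundedBy hl hB (c := c / 72) (by positivity)
  -- The a priori bounds hold only for ε ≤ ε₀, so the sequence is shifted by N and the extracted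
  -- subsequence is k n + N.
  obtain ⟨N, hN⟩ := eventually_atTop.1 (hε.eventually_le_const hε₀)
  have hS : ∀ n, IsScaled l (ε n) (bdryData l uhat₁ uhat₂ vhat) (scaledFields l (ε n) (u n) (v n)) :=
    fun n => isScaled_scaledFields hl (hεpos n) huhat₁ huhat₂ hvhat (hadm n)
  have hbound : ∀ n, (scaledFields l (ε (n + N)) (u (n + N)) (v (n + N))).BoundedBy l
      (ε (n + N)) R := fun n => by
    refine hR _ _ (hεpos _) (hN _ (Nat.le_add_left N n)) (hS _) ?_
    exact (energy_lower_bound hl (hεpos _) hQsym hc hQ hB (hadm _) (hS _) (hf _) (hg _)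
      ((hK₁ _).trans hD₁) ((hK₂ _).trans hD₂) ((hK₃ _).trans hD₃)).trans
      (by gcongr; exact (henergy _).trans hDM)
  obtain ⟨k, G, s₁₂, s₂₂, hk, hG⟩ := exists_weak_limit (ε := fun n => ε (n + N))
    (F := fun n => scaledFields l (ε (n + N)) (u (n + N)) (v (n + N)))
    (fun n => (hS _).memL2 hB) hbound
  have hkN : StrictMono fun n => k n + N := fun a b hab => Nat.add_lt_add_right (hk hab) N
  have hεk : Tendsto (fun n => ε (k n + N)) atTop (𝓝 0) := hε.comp hkN.tendsto_atTop
  have hF : ∀ n, (scaledFields l (ε (k n + N)) (u (k n + N)) (v (k n + N))).HasDerivs l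
      (ε (k n + N)) := fun n =>
    hasDerivs_scaledFields (hεpos _) (hadm _).u_mem (hadm _).v_mem (hS _) ((hS _).memL2 hB)
  obtain ⟨w, θ, hw, hθ, e1, e2, e3, e4, e5⟩ := exists_limit_deflection hl hvhat
    (hG.isScaled hB hεk fun n => hS _)
  -- The weak limits are replaced by their one-variable representatives, so that the limits in the
  -- conclusion appear in the required form; the remaining fields are kept.
  have hG' : Fields.Weak l (fun n => ε (k n + N))
      (fun n => scaledFields l (ε (k n + N)) (u (k n + N)) (v (k n + N)))
      { G with
        w := fun x => w x.1
        q₁ := fun x => D1 l w x.1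
        q₂ := fun x => θ x.1
        h₁₁ := fun x => D1 l (D1 l w) x.1
        h₁₂ := fun x => D1 l θ x.1 } s₁₂ s₂₂ :=
    { hG with
      w := hG.w.congr (fun _ => EventuallyEq.refl _ _) e1
      q₁ := hG.q₁.congr (fun _ => EventuallyEq.refl _ _) e2
      q₂ := hG.q₂.congr (fun _ => EventuallyEq.refl _ _) e3
      h₁₁ := hG.h₁₁.congr (fun _ => EventuallyEq.refl _ _) e4
      h₁₂ := hG.h₁₂.congr (fun _ => EventuallyEq.refl _ _) e5 }
  have hstrain := hG'.weakL2_strain hεk hF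
  refine ⟨fun n => k n + N, hkN, w, θ, ![G.y₁, G.y₂], G.h₂₂,
    fun x => !![pd (plate l 1) 0 G.y₁ x, s₁₂ x; s₁₂ x, s₂₂ x], hw, hθ,
    hG.bernoulliNavier hl (fun n => hεpos _) hεk hF (hG.isScaled hB hεk fun n => hS _), hG.h₂₂.2.1,
    fun i j => (hstrain i j).2.1, fun x => ?_, Eventually.of_forall fun x => rfl,
    hG'.weakW22 hεk hF, fun i => ?_, hG'.weakL2_hess (fun n => hεpos _) hF,
    hG'.weakW12_y hF, hstrain⟩
  · ext i j
    fin_cases i <;> fin_cases j <;> rfl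
  · have := hG'.weakW12_grad (fun n => hεpos _) hεk hF i
    fin_cases i <;> exact this
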